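/- Let $k\ge 0$ be even, $d=2k+1$ (so $d\equiv 1 \bmod 4$), and for $L\ge 1$ consider the periodic hypercubic lattice on the torus $(\mathbb Z/L)^d$ with one qubit (Pauli operators $X_e,Z_e$) on every $(k+1)$-cell $e$ and one qubit (Pauli operators $\tilde X_c,\tilde Z_c$) on every $k$-cell $c$. Products over cells are taken with mod $2$ incidence numbers. For two $(k+1)$-cells let $\int e'\cup_1 e\in\mathbb Z/2$ be the hypercubic $\cup_1$ pairing: it is $1$ if and only if the direction sets $J',J$ of $e',e$ meet in exactly one direction $m$ and $e',e$ are faces of a common unit $d$-cube such that, in the directions $i\notin J'$, $e'$ sits at coordinate $0$ for $i<m$ and at $1$ for $i>m$, and, in the directions $i\notin J$, $e$ sits at coordinate $1$ for $i<m$ and at $0$ for $i>m$. Let $\hat c$ be the Poincaré dual $(k+1)$-cell of the $k$-cell $c$, the dual lattice being identified with the original one by translation by $(\frac12,\dots,\frac12)$. Define the flux operators $$G_c=\prod_{e\supset c}X_e\prod_{e'}Z_{e'}^{\int dc\,\cup_1 e'},\qquad \tilde G_e=\prod_{c\subset e}\tilde X_c\prod_{c'}\tilde Z_{c'}^{\int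 d\hat e\,\cup_1\hat c'},$$ where $dc=\sum_{e\supset c}e$ and $d\hat e=\sum_{c\subset e}\hat c$. The Walker--Wang Clifford QCA is the automorphism $\alpha$ given by $$\alpha(Z_e)=Z_e\tilde G_e,\quad \alpha(\tilde Z_c)=\tilde Z_cG_c,\quad \alpha(X_e)=X_e\prod_{e'}\tilde G_{e'}^{\int e'\cup_1 e},\quad \alpha(\tilde X_c)=\tilde X_c\prod_{c'}G_{c'}^{\int\hat c'\cup_1\hat c}.$$ Then $\alpha$ is trivial: there are constants $r,D$ depending only on $k$ such that, for every $L\ge1$, there is a unitary $U=U^{WW}_{2k+1}$ with the following properties. 1. $\alpha(O)=U^\dagger O\,U$ for each of the generators $O$ above. 2. $U=(-1)^{\int a\cup db}$: if $a$ is a $\mathbb Z/2$-valued $k$-cochain of the dual lattice (equivalently, a function on the $(k+1)$-cells of the original lattice) and $b$ is a $\mathbb Z/2$-valued $k$-cochain of the original lattice, then every joint eigenvector $\psi$ with $G_c\psi=(-1)^{da(c)}\psi$ for all $c$ and $\tilde G_e\psi=(-1)^{db(e)}\psi$ for all $e$, where $da(c)=\sum_{e\supset c}a(e)$ and $db(e)=\sum_{c\subset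 e}b(c)$, satisfies $U\psi=(-1)^{\sum_e a(e)\,db(e)}\psi$. 3. $U$ is a quantum circuit of depth $D$: a product of $D$ layers, each a product of (not necessarily Clifford) unitary gates with pairwise disjoint supports of diameter at most $r$, where a qubit is located at the base vertex of its cell and the torus carries the sup metric. -/

import Mathlib

open scoped Matrix

/-! ### Local quantum circuits on a finite set of qubits located on a discrete torus -/

section Circuits

/-- Computational basis states (bit strings) of the qubits `Q`. -/
abbrev Config (Q : Type) : Type := Q → ZMod 2

/-- Operators on the Hilbert space `(ℂ²)^{⊗ Q}`, as matrices in the computational basis. -/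
abbrev Op (Q : Type) : Type := Matrix (Config Q) (Config Q) ℂ

/-- `(-1)^s` for `s` in `ℤ/2`. -/
def sgn (s : ZMod 2) : ℂ := if s = 0 then 1 else -1

/-- `∏_q X_q ^ (u q)`: it maps the basis state `y` to `y + u`. -/
def pauliX {Q : Type} [Fintype Q] [DecidableEq Q] (u : Q → ZMod 2) : Op Q :=
  Matrix.of fun x y => if x = y + u then 1 else 0

/-- `∏_q Z_q ^ (v q)`: it multiplies the basis state `x` by `(-1) ^ ∑ q, v q * x q`. -/
def pauliZ {Q : Type} [Fintype Q] [DecidableEq Q] (v : Q → ZMod 2) : Op Q :=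
  Matrix.diagonal fun x => sgn (∑ q, v q * x q)

/-- `A ^ s` for an exponent `s` in `ℤ/2`. -/
def opPow {Q : Type} [Fintype Q] [DecidableEq Q] (A : Op Q) (s : ZMod 2) : Op Q :=
  if s = 0 then 1 else A

/-- `A` acts only on the qubits of `S`, i.e. `A = B ⊗ 1` for some operator `B` on the
qubits in `S`. -/
def SupportedOn {Q : Type} (S : Finset Q) (A : Op Q) : Prop :=
  ∃ B : Matrix (S → ZMod 2) (S → ZMod 2) ℂ, ∀ x y : Config Q,
    ((∀ q, q ∉ S → x q = y q) → A x y = B (fun q => x q) (fun q => y q)) ∧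
    ((∃ q, q ∉ S ∧ x q ≠ y q) → A x y = 0)

/-- `S` has diameter at most `r` in the sup metric of the torus `(ℤ/L)^d`, the qubit `q` being
located at `pos q`. -/
def DiamLE {Q : Type} {d L : ℕ} (pos : Q → Fin d → ZMod L) (r : ℕ) (S : Finset Q) : Prop :=
  ∀ q ∈ S, ∀ q' ∈ S, ∀ i, (pos q i - pos q' i).valMinAbs.natAbs ≤ r

/-- One layer of a circuit: a product of arbitrary unitary gates with pairwise disjoint supports
of diameter at most `r`. -/
def IsLayer {Q : Type} [Fintype Q] [DecidableEq Q] {d L : ℕ} (pos : Q → Fin d → ZMod L)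
    (r : ℕ) (U : Op Q) : Prop :=
  ∃ (n : ℕ) (S : Fin n → Finset Q) (g : Fin n → Op Q),
    (∀ i, g i ∈ Matrix.unitaryGroup (Config Q) ℂ ∧ SupportedOn (S i) (g i) ∧ DiamLE pos r (S i)) ∧
    (∀ i j, i ≠ j → Disjoint (S i) (S j)) ∧
    U = (List.ofFn g).prod

/-- `U` is a quantum circuit of depth `D` with gates of range at most `r`. -/
def IsCircuit {Q : Type} [Fintype Q] [DecidableEq Q] {d L : ℕ} (pos : Q → Fin d → ZMod L)
    (r D : ℕ) (U : Op Q) : Prop :=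
  ∃ layer : Fin D → Op Q, (∀ t, IsLayer pos r (layer t)) ∧ U = (List.ofFn layer).prod

end Circuits

/-! ### Cells and cochain operations of the hypercubic lattice on the torus `(ℤ/L)^d` -/

section Lattice

/-- An `n`-cell of the periodic hypercubic lattice: the cube with base vertex `c.1` that extends
by one unit in each of the `n` directions in `c.2`. -/
abbrev Cell (d L n : ℕ) : Type := (Fin d → ZMod L) × {I : Finset (Fin d) // I.card = n}

/-- The mod 2 incidence number of the `n`-cell `c` in the boundary of the `(n+1)`-cell `e`. A cell
with base `p` has, for each of its directions `j`, the two faces with bases `p` and `p + e_j`. -/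
def incidence {d L n : ℕ} (c : Cell d L n) (e : Cell d L (n + 1)) : ZMod 2 :=
  ∑ j : Fin d, if j ∉ c.2.1 ∧ e.2.1 = insert j c.2.1 then
    (if c.1 = e.1 then 1 else 0) + (if c.1 = e.1 + Pi.single j 1 then 1 else 0) else 0

/-- The coboundary `d b` of a `ℤ/2`-valued `n`-cochain. -/
def coboundary {d L n : ℕ} [NeZero L] (b : Cell d L n → ZMod 2) : Cell d L (n + 1) → ZMod 2 :=
  fun e => ∑ c, incidence c e * b c

/-- The boundary of a `ℤ/2`-valued `(n+1)`-chain. Read through Poincaré duality, it is the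
coboundary on the dual lattice. -/
def boundary {d L n : ℕ} [NeZero L] (a : Cell d L (n + 1) → ZMod 2) : Cell d L n → ZMod 2 :=
  fun c => ∑ e, incidence c e * a e

open Classical in
/-- `∫ c' ∪₁ c` in `ℤ/2` for (the indicator cochains of) two cells. On the unit cube with base
`p`, the hypercubic `∪₁` product pairs the faces `c'` and `c` whose sets of directions `J'`, `J`
satisfy `J' ∪ J = everything` and `J' ∩ J = {m}`. In the directions `i` in which it does not extend,
`c'` sits at coordinate `0` if `i < m` and at `1` if `m < i`, while `c` sits at `1` if `i < m` and
at `0` if `m < i`. -/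
noncomputable def cupOne {d L n : ℕ} (c' c : Cell d L n) : ZMod 2 :=
  if ∃ (m : Fin d) (p : Fin d → ZMod L),
      c'.2.1 ∪ c.2.1 = Finset.univ ∧ c'.2.1 ∩ c.2.1 = {m} ∧
      c'.1 = (p + fun i => if i ∉ c'.2.1 ∧ m < i then 1 else 0) ∧
      c.1 = (p + fun i => if i ∉ c.2.1 ∧ i < m then 1 else 0)
  then 1 else 0

/-- The `(k+1)`-cell Poincaré dual to the `k`-cell `c` in dimension `2k+1` (the cell of the dual
lattice with the same centre), where the dual lattice is identified with the original one by
translation by `(1/2, …, 1/2)`. -/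
def dualCell {k L : ℕ} (c : Cell (2 * k + 1) L k) : Cell (2 * k + 1) L (k + 1) :=
  (fun i => if i ∈ c.2.1 then c.1 i + 1 else c.1 i,
    ⟨c.2.1ᶜ, by rw [Finset.card_compl, c.2.2, Fintype.card_fin]; omega⟩)

end Lattice

/-! ### The `(2k+1)`-dimensional Walker–Wang QCA -/

section WalkerWang

/-- One qubit on each `(k+1)`-cell and one ("dual") qubit on each `k`-cell. -/
abbrev Qubit (k L : ℕ) : Type := Cell (2 * k + 1) L (k + 1) ⊕ Cell (2 * k + 1) L k

/-- A qubit is located at the base vertex of its cell. -/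
def Qubit.pos {k L : ℕ} : Qubit k L → Fin (2 * k + 1) → ZMod L :=
  Sum.elim (fun e => e.1) (fun c => c.1)

variable {k L : ℕ} [NeZero L]

/-- The Pauli `X` operator of a single qubit. -/
def siteX (q : Qubit k L) : Op (Qubit k L) := pauliX (Pi.single q 1)

/-- The Pauli `Z` operator of a single qubit. -/
def siteZ (q : Qubit k L) : Op (Qubit k L) := pauliZ (Pi.single q 1)

/-- The flux operator of the `k`-cell `c`:
`G_c = (∏_{e ⊃ c} X_e) (∏_{e'} Z_{e'} ^ ∫ dc ∪₁ e')`. -/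
noncomputable def fluxG (c : Cell (2 * k + 1) L k) : Op (Qubit k L) :=
  pauliX (Sum.elim (fun e => incidence c e) 0) *
    pauliZ (Sum.elim (fun e' => ∑ e, incidence c e * cupOne e e') 0)

/-- The dual flux operator of the `(k+1)`-cell `e`, with hats denoting Poincaré duals:
`G̃_e = (∏_{c ⊂ e} X̃_c) (∏_{c'} Z̃_{c'} ^ ∫ dê ∪₁ ĉ')`, where `dê` is the sum of `ĉ`, `c ⊂ e`. -/
noncomputable def fluxGDual (e : Cell (2 * k + 1) L (k + 1)) : Op (Qubit k L) :=
  pauliX (Sum.elim 0 (fun c => incidence c e)) *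
    pauliZ (Sum.elim 0 (fun c' => ∑ c, incidence c e * cupOne (dualCell c) (dualCell c')))

/-- The unitary `V` implements the Walker–Wang QCA `α(O) = V† O V`, given on the generators of the
operator algebra by
`α(Z_e) = Z_e G̃_e`, `α(Z̃_c) = Z̃_c G_c`, `α(X_e) = X_e ∏_{e'} G̃_{e'} ^ ∫ e' ∪₁ e`,
`α(X̃_c) = X̃_c ∏_{c'} G_{c'} ^ ∫ ĉ' ∪₁ ĉ`.
(The flux operators commute with each other, so the order of the two products is immaterial.) -/
def ImplementsWalkerWangQCA (V : Op (Qubit k L)) : Prop :=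
  V ∈ Matrix.unitaryGroup (Config (Qubit k L)) ℂ ∧
  (∀ e, Vᴴ * siteZ (Sum.inl e) * V = siteZ (Sum.inl e) * fluxGDual e) ∧
  (∀ c, Vᴴ * siteZ (Sum.inr c) * V = siteZ (Sum.inr c) * fluxG c) ∧
  (∀ e, Vᴴ * siteX (Sum.inl e) * V = siteX (Sum.inl e) *
    (Finset.univ.toList.map fun e' => opPow (fluxGDual e') (cupOne e' e)).prod) ∧
  (∀ c, Vᴴ * siteX (Sum.inr c) * V = siteX (Sum.inr c) *
    (Finset.univ.toList.map fun c' => opPow (fluxG c') (cupOne (dualCell c') (dualCell c))).prod)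

/-- `V = (-1)^{∫ a ∪ db}`: on each joint eigenstate of the flux operators with fluxes `da` and
`db`, i.e. `G_c = (-1)^{da(c)}` and `G̃_e = (-1)^{db(e)}`, it acts by the mod 2 linking number
`∫ a ∪ db` of the fluxes. Here `a` is a `k`-cochain of the dual lattice, written as a function of the
dual `(k+1)`-cells of the original one, so that `da` is `boundary a` and `∫ a ∪ db` is the
intersection pairing. -/
def IsLinkingPhase (V : Op (Qubit k L)) : Prop :=
  ∀ (a : Cell (2 * k + 1) L (k + 1) → ZMod 2) (b : Cell (2 * k + 1) L k → ZMod 2)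
    (ψ : Config (Qubit k L) → ℂ),
    (∀ c, fluxG c *ᵥ ψ = sgn (boundary a c) • ψ) →
    (∀ e, fluxGDual e *ᵥ ψ = sgn (coboundary b e) • ψ) →
    V *ᵥ ψ = sgn (∑ e, a e * coboundary b e) • ψ

end WalkerWang

/-! Suppose `k ≥ 2`. Split the state space by the joint eigenvalues `y` of the dual flux operators
`G̃_e`, and let `V` act on the sector `y = db` by `A y`, the product of the `G_c` with exponents `b
c`. An operator on the `(k+1)`-cells passes through `A y` up to a sign that is a value of dual
fluxes on the sector. An operator on the `k`-cells shifts the label, and adding `dc` to `y`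
multiplies `A y` by `G_c`. These two facts give the four conjugation rules (`primal_mul_V`,
`dual_mul_V`). On an eigenvector with fluxes `da` and `db`, only sectors with flux `db` contribute,
and `A y` acts there by the sign of `∑ b c * da(c)`, which is `∑ a e * db(e)` (`V_mulVec`).

What must be shown is that `A y` depends on `b` only through `t = db`, and locally so. As a Pauli
operator it is `X^t Z^(∫ t ∪₁ ·)` times a phase. Multiplying by `G_c` produces the sign of `∫ t ∪₁
dc`, so the phase has to be a quadratic refinement of `∪₁`. The power of `i` with exponent `∫ u ∪₁
u`, for an integral coboundary `u` lifting `t`, is one. Integral `∪₁` is symmetric on closed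
cochains because its antisymmetrization is the coboundary of `∪₂` (`torusCupOne_symm`; the sign
needs `k` even), and `dc` has square zero because `k ≥ 2`. Such a lift is not a local function of
`t`. The corrected form `K - P * D`, however, takes the same value mod `4` on every integral lift of
`t` (`bil_reduce`), so the lift with values in `{0, 1}` can be used, and the phase becomes a product
of local factors. The same form shows that dual fluxes multiply to `1` over cycles, so only
coboundaries occur as labels (`jointProj_eq_zero`).

For bounded depth, `V_eq` splits `V` into an `X` part and a `Z` part. Each is a product of gates
controlled by nearby labels, and a colouring of the torus sorts these gates into layers whose number
does not depend on `L` (`isCircuit_of_multiplicative`).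

For `k = 0` the argument for square zero breaks down. There `G̃_e = -Y_v Y_w` for the ends `v ≠ w`
of `e`; the labels are the eigenvalues of the `Y_v` and the phase is the product of the signs of
`y_v * y_w`. For `L = 1` all fluxes are trivial and `V = 1`. -/

section Pauli

/-! ### Signs and the Pauli algebra -/

theorem sgn_zero : sgn 0 = 1 := by simp [sgn]

theorem sgn_one : sgn 1 = -1 := by simp [sgn]

theorem sgn_add (a b : ZMod 2) : sgn (a + b) = sgn a * sgn b := by
  have h : ∀ c : ZMod 2, c = 0 ∨ c = 1 := by decide
  rcases h a with rfl | rfl <;> rcases h b with rfl | rfl <;>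
    simp [sgn, show (1 + 1 : ZMod 2) = 0 from rfl]

theorem sgn_mul_self (a : ZMod 2) : sgn a * sgn a = 1 := by
  rw [← sgn_add, CharTwo.add_self_eq_zero, sgn_zero]

theorem star_sgn (a : ZMod 2) : star (sgn a) = sgn a := by
  unfold sgn; split <;> simp

theorem sgn_injective : Function.Injective sgn := by
  have h : ∀ c : ZMod 2, c = 0 ∨ c = 1 := by decide
  intro a b hab
  rcases h a with rfl | rfl <;> rcases h b with rfl | rfl <;>
    first | rfl | norm_num [sgn, Complex.ext_iff] at hab

theorem add_self_eq_zero_of_zmodTwo {Q : Type} (u : Q → ZMod 2) : u + u = 0 :=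
  funext fun q => CharTwo.add_self_eq_zero (u q)

/-- Signs of Pauli products are even powers of `i`. This lets an integral quadratic form in the
exponent of `i` absorb them. -/
theorem sgn_intCast (n : ℤ) : sgn (n : ZMod 2) = Complex.I ^ (2 * n) := by
  rw [zpow_mul]
  have h : (Complex.I ^ (2 : ℤ)) = -1 := by
    rw [show (2 : ℤ) = ((2 : ℕ) : ℤ) from rfl, zpow_natCast, Complex.I_sq]
  rw [h]
  rcases Int.even_or_odd n with hn | hn
  · rw [hn.neg_one_zpow, (ZMod.intCast_eq_zero_iff_even).2 hn, sgn_zero]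
  · rw [hn.neg_one_zpow, (ZMod.intCast_eq_one_iff_odd).2 hn, sgn_one]

variable {Q : Type} [Fintype Q] [DecidableEq Q]

theorem pauliX_apply (u : Q → ZMod 2) (x y : Config Q) :
    pauliX u x y = if x = y + u then 1 else 0 := rfl

theorem pauliX_zero : pauliX (0 : Q → ZMod 2) = 1 := by
  ext x y
  simp [pauliX_apply, Matrix.one_apply]

theorem pauliZ_zero : pauliZ (0 : Q → ZMod 2) = 1 := by
  ext x y
  simp [pauliZ, sgn_zero]

theorem pauliX_mul (u v : Q → ZMod 2) : pauliX u * pauliX v = pauliX (u + v) := by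
  ext x y
  simp [Matrix.mul_apply, pauliX_apply, add_assoc, add_comm u v]

theorem pauliZ_mul (u v : Q → ZMod 2) : pauliZ u * pauliZ v = pauliZ (u + v) := by
  unfold pauliZ
  rw [Matrix.diagonal_mul_diagonal]
  congr 1
  ext x
  rw [← sgn_add, ← Finset.sum_add_distrib]
  simp [add_mul]

theorem pauliZ_mul_pauliX (v u : Q → ZMod 2) :
    pauliZ v * pauliX u = sgn (v ⬝ᵥ u) • (pauliX u * pauliZ v) := by
  ext x y
  unfold pauliZ
  rw [Matrix.smul_apply, Matrix.diagonal_mul, Matrix.mul_diagonal, pauliX_apply]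
  split_ifs with h
  · subst h
    rw [mul_one, one_mul, smul_eq_mul, ← sgn_add]
    congr 1
    simp [dotProduct, mul_add, Finset.sum_add_distrib, add_comm]
  · simp

theorem pauliX_conjTranspose (u : Q → ZMod 2) : (pauliX u)ᴴ = pauliX u := by
  ext x y
  have h : (y = x + u) ↔ (x = y + u) := by
    constructor <;> rintro rfl <;> rw [add_assoc, add_self_eq_zero_of_zmodTwo, add_zero]
  simp [Matrix.conjTranspose_apply, pauliX_apply, h, apply_ite]

theorem pauliZ_conjTranspose (u : Q → ZMod 2) : (pauliZ u)ᴴ = pauliZ u := by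
  unfold pauliZ
  rw [Matrix.diagonal_conjTranspose]
  congr 1
  ext x
  simp [star_sgn]

theorem pauliX_mem_unitary (u : Q → ZMod 2) : pauliX u ∈ Matrix.unitaryGroup (Config Q) ℂ := by
  rw [Matrix.mem_unitaryGroup_iff, Matrix.star_eq_conjTranspose, pauliX_conjTranspose,
    pauliX_mul, add_self_eq_zero_of_zmodTwo, pauliX_zero]

theorem pauliZ_mem_unitary (u : Q → ZMod 2) : pauliZ u ∈ Matrix.unitaryGroup (Config Q) ℂ := by
  rw [Matrix.mem_unitaryGroup_iff, Matrix.star_eq_conjTranspose, pauliZ_conjTranspose,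
    pauliZ_mul, add_self_eq_zero_of_zmodTwo, pauliZ_zero]

theorem smul_mem_unitary {U : Op Q} (hU : U ∈ Matrix.unitaryGroup (Config Q) ℂ) {z : ℂ}
    (hz : star z * z = 1) : z • U ∈ Matrix.unitaryGroup (Config Q) ℂ := by
  rw [Matrix.mem_unitaryGroup_iff'] at hU ⊢
  rw [star_smul, smul_mul_smul_comm, hU, hz, one_smul]

/-- The Pauli operator `X^x Z^z`. -/
def weyl (x z : Q → ZMod 2) : Op Q := pauliX x * pauliZ z

theorem weyl_mul (x z x' z' : Q → ZMod 2) :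
    weyl x z * weyl x' z' = sgn (z ⬝ᵥ x') • weyl (x + x') (z + z') := by
  unfold weyl
  calc pauliX x * pauliZ z * (pauliX x' * pauliZ z')
      = pauliX x * (pauliZ z * pauliX x') * pauliZ z' := by simp only [Matrix.mul_assoc]
    _ = _ := by
      rw [pauliZ_mul_pauliX, ← pauliX_mul, ← pauliZ_mul]
      simp only [Matrix.mul_smul, Matrix.smul_mul, Matrix.mul_assoc]

theorem weyl_zero : weyl (0 : Q → ZMod 2) 0 = 1 := by
  rw [weyl, pauliX_zero, pauliZ_zero, one_mul]

theorem weyl_zero_right (x : Q → ZMod 2) : weyl x 0 = pauliX x := by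
  rw [weyl, pauliZ_zero, mul_one]

theorem weyl_zero_left (z : Q → ZMod 2) : weyl 0 z = pauliZ z := by
  rw [weyl, pauliX_zero, one_mul]

theorem weyl_mul_comm (x z x' z' : Q → ZMod 2) :
    weyl x z * weyl x' z' = sgn (z ⬝ᵥ x' + z' ⬝ᵥ x) • (weyl x' z' * weyl x z) := by
  rw [weyl_mul, weyl_mul, smul_smul, sgn_add, mul_assoc, sgn_mul_self, mul_one, add_comm x,
    add_comm z]

theorem weyl_commute {x z x' z' : Q → ZMod 2} (h : z ⬝ᵥ x' = z' ⬝ᵥ x) :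
    Commute (weyl x z) (weyl x' z') := by
  rw [Commute, SemiconjBy, weyl_mul_comm, h, CharTwo.add_self_eq_zero, sgn_zero, one_smul]

theorem weyl_conjTranspose (x z : Q → ZMod 2) : (weyl x z)ᴴ = sgn (z ⬝ᵥ x) • weyl x z := by
  rw [weyl, Matrix.conjTranspose_mul, pauliX_conjTranspose, pauliZ_conjTranspose,
    pauliZ_mul_pauliX]

theorem weyl_mem_unitary (x z : Q → ZMod 2) : weyl x z ∈ Matrix.unitaryGroup (Config Q) ℂ :=
  mul_mem (pauliX_mem_unitary x) (pauliZ_mem_unitary z)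

end Pauli

/-! ### Support of an operator from its commutant -/

section Support

variable {Q : Type} [Fintype Q] [DecidableEq Q]

/-- An operator that commutes with the site Pauli operators outside `S` acts only on `S`. -/
theorem supportedOn_of_commute {S : Finset Q} {A : Op Q}
    (hX : ∀ q ∉ S, Commute (pauliX (Pi.single q 1)) A)
    (hZ : ∀ q ∉ S, Commute (pauliZ (Pi.single q 1)) A) : SupportedOn S A := by
  have hXall : ∀ u : Q → ZMod 2, (∀ q ∈ S, u q = 0) → Commute (pauliX u) A := by
    intro u hu
    have key : ∀ T : Finset Q, Disjoint T S →
        Commute (pauliX (∑ q ∈ T, Pi.single q (u q))) A := by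
      intro T
      induction T using Finset.induction_on with
      | empty => intro _; rw [Finset.sum_empty, pauliX_zero]; exact Commute.one_left A
      | insert q T hq ih =>
        intro hd
        rw [Finset.disjoint_insert_left] at hd
        rw [Finset.sum_insert hq, ← pauliX_mul]
        refine Commute.mul_left ?_ (ih hd.2)
        have h01 : u q = 0 ∨ u q = 1 := by
          generalize u q = a; revert a; decide
        rcases h01 with h | h
        · rw [h, Pi.single_zero, pauliX_zero]; exact Commute.one_left A
        · rw [h]; exact hX q hd.1
    have h : u = ∑ q ∈ Sᶜ, Pi.single q (u q) := by
      ext q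
      rw [Finset.sum_apply]
      simp only [Pi.single_apply]
      rw [Finset.sum_ite_eq]
      split_ifs with h
      · rfl
      · exact hu q (by simpa using h)
    rw [h]
    exact key _ disjoint_compl_left
  have hsh : ∀ u : Q → ZMod 2, (∀ q ∈ S, u q = 0) → ∀ x y, A (x + u) (y + u) = A x y := by
    intro u hu x y
    have h := congrFun (congrFun (hXall u hu).eq (x + u)) y
    simp only [Matrix.mul_apply, pauliX_apply] at h
    simpa using h.symm
  refine ⟨fun x y => A (fun q => if h : q ∈ S then x ⟨q, h⟩ else 0)
    (fun q => if h : q ∈ S then y ⟨q, h⟩ else 0), fun x y => ⟨fun h => ?_, ?_⟩⟩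
  -- Adding the common outside bits of `x` and `y` to both indices sets those bits to `0`, the value
  -- used in the definition of `B`.
  · rw [← hsh (fun q => if q ∈ S then 0 else x q) (fun q hq => if_pos hq)]
    congr 1
    · ext q
      by_cases hq : q ∈ S <;> simp [hq, CharTwo.add_self_eq_zero]
    · ext q
      by_cases hq : q ∈ S
      · simp [hq]
      · simp [hq, h q hq, CharTwo.add_self_eq_zero]
  · rintro ⟨q, hq, hne⟩
    have h := congrFun (congrFun (hZ q hq).eq x) y
    unfold pauliZ at h
    rw [Matrix.diagonal_mul, Matrix.mul_diagonal] at h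
    simp only [Pi.single_apply, ite_mul, one_mul, zero_mul, Finset.sum_ite_eq',
      Finset.mem_univ, if_true] at h
    have h' : (sgn (x q) - sgn (y q)) * A x y = 0 := by rw [sub_mul, h]; ring
    rcases mul_eq_zero.1 h' with h0 | h0
    · exact absurd (sgn_injective (sub_eq_zero.1 h0)) hne
    · exact h0

end Support

/-! ### Distance and colourings on the circle -/

section Torus

/-- The length of the shortest path between `0` and `x` in `ℤ/L`. -/
def torusNorm {L : ℕ} (x : ZMod L) : ℕ := x.valMinAbs.natAbs

theorem torusNorm_zero {L : ℕ} : torusNorm (0 : ZMod L) = 0 := by simp [torusNorm]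

theorem torusNorm_neg {L : ℕ} (x : ZMod L) : torusNorm (-x) = torusNorm x :=
  ZMod.natAbs_valMinAbs_neg x

theorem torusNorm_sub_comm {L : ℕ} (x y : ZMod L) : torusNorm (x - y) = torusNorm (y - x) := by
  rw [← torusNorm_neg, neg_sub]

theorem torusNorm_add_le {L : ℕ} (x y : ZMod L) :
    torusNorm (x + y) ≤ torusNorm x + torusNorm y :=
  (ZMod.natAbs_valMinAbs_add_le x y).trans (Int.natAbs_add_le _ _)

theorem torusNorm_sub_le {L : ℕ} (x y z : ZMod L) :
    torusNorm (x - z) ≤ torusNorm (x - y) + torusNorm (y - z) := by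
  simpa using torusNorm_add_le (x - y) (y - z)

theorem torusNorm_one_le {L : ℕ} [NeZero L] : torusNorm (1 : ZMod L) ≤ 1 := by
  unfold torusNorm
  rw [ZMod.valMinAbs_natAbs_eq_min]
  refine (min_le_left _ _).trans ?_
  have h := ZMod.val_natCast L 1
  rw [Nat.cast_one] at h
  rw [h]
  exact Nat.mod_le 1 L

/-- A colouring of `ℤ/L` by `2 N` colours in which distinct points of the same colour have
distance at least `N`. -/
def torusColour (L N : ℕ) [NeZero N] (x : ZMod L) : Fin N × Bool :=
  (Fin.ofNat N x.val, decide (x.val < L / N * N))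

/-- Residues mod `N` separate points well except across the seam when `N ∤ L`. The Boolean splits
off the last `L % N` points. Among the first `L / N * N` points, the way round the seam is also at
least a positive multiple of `N`; the leftover points are too few to share a residue. -/
theorem le_torusNorm_of_colour_eq {L N : ℕ} [NeZero L] [NeZero N] {x y : ZMod L}
    (h : torusColour L N x = torusColour L N y) (hne : x ≠ y) : N ≤ torusNorm (x - y) := by
  wlog hle : y.val ≤ x.val generalizing x y
  · rw [torusNorm_sub_comm]
    exact this h.symm hne.symm (le_of_not_ge hle)
  have hlt : y.val < x.val := lt_of_le_of_ne hle fun h => hne (ZMod.val_injective L h).symm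
  have hmod : x.val % N = y.val % N := by
    have := congrArg (fun c => (c.1 : ℕ)) h
    simpa [torusColour, Fin.ofNat] using this
  have hdec : (x.val < L / N * N) ↔ (y.val < L / N * N) := by
    have := congrArg Prod.snd h
    simpa [torusColour] using this
  have hxL := ZMod.val_lt x
  have hdvd : N ∣ x.val - y.val := (Nat.modEq_iff_dvd' hle).1 hmod.symm
  have h1 : N ≤ x.val - y.val := Nat.le_of_dvd (by omega) hdvd
  have hLmod : L / N * N + L % N = L := by rw [mul_comm]; exact Nat.div_add_mod L N
  have hmodlt : L % N < N := Nat.mod_lt _ (NeZero.pos N)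
  have hx : x.val < L / N * N := by
    by_contra hx
    have hy := mt hdec.2 hx
    omega
  have h2 : N ≤ L / N * N - (x.val - y.val) :=
    Nat.le_of_dvd (by omega) (Nat.dvd_sub (dvd_mul_left N _) hdvd)
  unfold torusNorm
  rw [ZMod.valMinAbs_natAbs_eq_min, ZMod.val_sub hle]
  omega

end Torus

/-! ### Circuits from multiplicative families of gates -/

section CircuitLemmas

variable {Q : Type} [Fintype Q] {d L : ℕ} {pos : Q → Fin d → ZMod L}

/-- The qubits at distance at most `ρ` of the point `x`. -/
def torusBall (pos : Q → Fin d → ZMod L) (ρ : ℕ) (x : Fin d → ZMod L) : Finset Q :=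
  Finset.univ.filter fun q => ∀ a, torusNorm (pos q a - x a) ≤ ρ

theorem mem_torusBall {ρ : ℕ} {x : Fin d → ZMod L} {q : Q} :
    q ∈ torusBall pos ρ x ↔ ∀ a, torusNorm (pos q a - x a) ≤ ρ := by
  simp [torusBall]

theorem diamLE_torusBall (ρ : ℕ) (x : Fin d → ZMod L) : DiamLE pos (2 * ρ) (torusBall pos ρ x) := by
  intro q hq q' hq' a
  have h := mem_torusBall.1 hq a
  have h' := mem_torusBall.1 hq' a
  have := torusNorm_sub_le (pos q a) (x a) (pos q' a)
  rw [torusNorm_sub_comm (x a)] at this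
  change torusNorm _ ≤ _
  omega

variable [DecidableEq Q]

theorem IsCircuit.mul {r D D' : ℕ} {U U' : Op Q} (h : IsCircuit pos r D U)
    (h' : IsCircuit pos r D' U') : IsCircuit pos r (D + D') (U * U') := by
  obtain ⟨l, hl, rfl⟩ := h
  obtain ⟨l', hl', rfl⟩ := h'
  refine ⟨Fin.append l l', fun t => ?_, ?_⟩
  · refine Fin.addCases (fun t => ?_) (fun t => ?_) t
    · rw [Fin.append_left]; exact hl t
    · rw [Fin.append_right]; exact hl' t
  · rw [List.ofFn_fin_append, List.prod_append]

theorem isLayer_one (r : ℕ) : IsLayer pos r (1 : Op Q) :=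
  ⟨0, Fin.elim0, Fin.elim0, fun i => i.elim0, fun i => i.elim0, by simp⟩

theorem isCircuit_one (r D : ℕ) : IsCircuit pos r D (1 : Op Q) :=
  ⟨fun _ => 1, fun _ => isLayer_one r, by simp⟩

/-- A product of local unitaries, indexed by points of the torus (with finitely many of them at each
point) and multiplicative over disjoint unions of index sets, is a circuit whose depth depends only
on the locality. -/
theorem isCircuit_of_multiplicative [NeZero L] {ι T : Type} [Fintype ι] [DecidableEq ι]
    [Fintype T] [DecidableEq T] (ctr : ι → Fin d → ZMod L) (κ : ι → T)
    (hκ : ∀ i j, ctr i = ctr j → κ i = κ j → i = j) (ρ : ℕ) (V : Finset ι → Op Q)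
    (hV0 : V ∅ = 1) (hV : ∀ S S', Disjoint S S' → V (S ∪ S') = V S * V S')
    (hU : ∀ i, V {i} ∈ Matrix.unitaryGroup (Config Q) ℂ)
    (hS : ∀ i, SupportedOn (torusBall pos ρ (ctr i)) (V {i})) :
    IsCircuit pos (2 * ρ) (Fintype.card ((Fin d → Fin (2 * ρ + 1) × Bool) × T)) (V Finset.univ) := by
  classical
  let col : ι → (Fin d → Fin (2 * ρ + 1) × Bool) × T :=
    fun i => (fun a => torusColour L (2 * ρ + 1) (ctr i a), κ i)
  have hlayer : ∀ γ, IsLayer pos (2 * ρ) (V (Finset.univ.filter fun i => col i = γ)) := by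
    intro γ
    have hprod : ∀ S : Finset ι, V S = (S.toList.map fun i => V {i}).prod := by
      have aux : ∀ l : List ι, l.Nodup → V l.toFinset = (l.map fun i => V {i}).prod := by
        intro l
        induction l with
        | nil => intro _; simpa using hV0
        | cons i l ih =>
          intro hl
          rw [List.nodup_cons] at hl
          rw [List.toFinset_cons, Finset.insert_eq, hV _ _ (by simpa using hl.1), ih hl.2,
            List.map_cons, List.prod_cons]
      intro S
      conv_lhs => rw [← Finset.toList_toFinset S]
      exact aux _ S.nodup_toList
    set l := (Finset.univ.filter fun i => col i = γ).toList with hl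
    have hmem : ∀ i ∈ l, col i = γ := by simp [hl]
    refine ⟨l.length, fun n => torusBall pos ρ (ctr l[n]), fun n => V {l[n]},
      fun n => ⟨hU _, hS _, diamLE_torusBall ρ _⟩, fun m n hmn => ?_, ?_⟩
    · rw [Finset.disjoint_left]
      intro q hm hn
      have hne : l[m] ≠ l[n] := by
        intro h
        exact hmn (Fin.ext ((List.Nodup.getElem_inj_iff (Finset.nodup_toList _)).1 h))
      have hc : col l[m] = col l[n] := by
        exact (hmem _ (List.getElem_mem _)).trans (hmem _ (List.getElem_mem _)).symm
      -- Gates at the same point have different `κ`, hence different colours. Centres that differ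
      -- within a colour class are at least `2 * ρ + 1` apart in some coordinate, so their balls are
      -- disjoint.
      have hne' : ctr l[m] ≠ ctr l[n] := fun h => hne (hκ _ _ h (congrArg Prod.snd hc))
      obtain ⟨a, ha⟩ := Function.ne_iff.1 hne'
      have hfar := le_torusNorm_of_colour_eq (congrFun (congrArg Prod.fst hc) a) ha
      have h1 := mem_torusBall.1 hm a
      have h2 := mem_torusBall.1 hn a
      have := torusNorm_sub_le (ctr l[m] a) (pos q a) (ctr l[n] a)
      rw [torusNorm_sub_comm (ctr l[m] a) (pos q a)] at this
      omega
    · rw [hprod]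
      exact congrArg List.prod (List.ofFn_getElem_eq_map l fun i => V {i}).symm
  -- Multiplicativity once more, now over the colour classes, which become the layers.
  have hall : ∀ l : List ((Fin d → Fin (2 * ρ + 1) × Bool) × T), l.Nodup →
      V (Finset.univ.filter fun i => col i ∈ l) =
        (l.map fun γ => V (Finset.univ.filter fun i => col i = γ)).prod := by
    intro l
    induction l with
    | nil => intro _; simpa using hV0
    | cons γ l ih =>
      intro hl
      rw [List.nodup_cons] at hl
      rw [List.map_cons, List.prod_cons, ← ih hl.2, ← hV]
      · congr 1
        ext i
        simp
      · rw [Finset.disjoint_filter]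
        rintro i - rfl
        exact hl.1
  let eqv := Fintype.equivFin ((Fin d → Fin (2 * ρ + 1) × Bool) × T)
  refine ⟨fun t => V (Finset.univ.filter fun i => col i = eqv.symm t), fun t => hlayer _, ?_⟩
  have h := hall (List.ofFn eqv.symm) (List.nodup_ofFn.2 eqv.symm.injective)
  rw [List.map_ofFn] at h
  rw [show (List.ofFn fun t => V (Finset.univ.filter fun i => col i = eqv.symm t)) =
    List.ofFn ((fun γ => V (Finset.univ.filter fun i => col i = γ)) ∘ eqv.symm) from rfl, ← h]
  congr 1
  ext i
  simp only [Finset.mem_univ, Finset.mem_filter, true_and, true_iff, List.mem_ofFn]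
  exact eqv.symm.surjective _

end CircuitLemmas

/-! ### Joint spectral projectors and controlled operators -/

section Calculus

variable {Q J : Type} [Fintype Q] [DecidableEq Q] [Fintype J]

/-- The joint spectral projector of the commuting involutions `H j` for the eigenvalues
`(-1) ^ (y j)`. -/
noncomputable def jointProj (H : J → Op Q) (y : J → ZMod 2) : Op Q :=
  (Finset.univ.toList.map fun j => (1 / 2 : ℂ) • (1 + sgn (y j) • H j)).prod

/-- The operator that acts as `A y` on the joint eigenspace of the `H j` for the eigenvalues
`(-1) ^ (y j)`. -/
noncomputable def calculus [DecidableEq J] (H : J → Op Q) (A : (J → ZMod 2) → Op Q) : Op Q :=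
  ∑ y, jointProj H y * A y

/-- A family of commuting hermitian involutions. -/
structure CommutingInvolutions (H : J → Op Q) : Prop where
  comm : ∀ i j, Commute (H i) (H j)
  sq : ∀ j, H j * H j = 1
  herm : ∀ j, (H j)ᴴ = H j

/-- Anticommuting with `H j` flips the eigenvalue of `H j`, so the operator permutes the sectors by
the shift `s`. Pauli operators on the controlling qubits act on labels in this way. -/
theorem mul_jointProj {H : J → Op Q} {O : Op Q} {s : J → ZMod 2}
    (h : ∀ j, O * H j = sgn (s j) • (H j * O)) (y : J → ZMod 2) :
    O * jointProj H y = jointProj H (y + s) * O := by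
  unfold jointProj
  generalize (Finset.univ : Finset J).toList = l
  induction l with
  | nil => simp
  | cons j l ih =>
    rw [List.map_cons, List.prod_cons, List.map_cons, List.prod_cons, Matrix.mul_assoc, ← ih,
      ← Matrix.mul_assoc, ← Matrix.mul_assoc]
    congr 1
    rw [Pi.add_apply, sgn_add, Matrix.mul_smul, Matrix.smul_mul, mul_add, add_mul,
      Matrix.mul_smul, h, Matrix.smul_mul, smul_smul, mul_one, one_mul]

theorem commute_jointProj {H : J → Op Q} {O : Op Q} (h : ∀ j, Commute O (H j))
    (y : J → ZMod 2) : Commute O (jointProj H y) := by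
  have h0 : ∀ j, O * H j = sgn ((0 : J → ZMod 2) j) • (H j * O) := fun j => by
    rw [Pi.zero_apply, sgn_zero, one_smul, (h j).eq]
  have h1 := mul_jointProj h0 y
  rwa [add_zero] at h1

namespace CommutingInvolutions

variable {H : J → Op Q} (hH : CommutingInvolutions H)
include hH

theorem mul_jointProj_self (j : J) (y : J → ZMod 2) :
    H j * jointProj H y = sgn (y j) • jointProj H y := by
  have key : ∀ l : List J, j ∈ l →
      H j * (l.map fun j => (1 / 2 : ℂ) • (1 + sgn (y j) • H j)).prod =
        sgn (y j) • (l.map fun j => (1 / 2 : ℂ) • (1 + sgn (y j) • H j)).prod := by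
    intro l
    induction l with
    | nil => intro h; simp at h
    | cons i l ih =>
      intro h
      rw [List.map_cons, List.prod_cons]
      by_cases hij : j = i
      · subst hij
        rw [← Matrix.mul_assoc, ← Matrix.smul_mul]
        congr 1
        rw [Matrix.mul_smul, mul_add, mul_one, Matrix.mul_smul, hH.sq, smul_comm]
        congr 1
        rw [smul_add, smul_smul, sgn_mul_self, one_smul, add_comm]
      · have hl : j ∈ l := by simpa [hij] using h
        have hc : Commute (H j) ((1 / 2 : ℂ) • (1 + sgn (y i) • H i)) :=
          ((Commute.one_right _).add_right ((hH.comm j i).smul_right _)).smul_right _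
        rw [← Matrix.mul_assoc, hc.eq, Matrix.mul_assoc, ih hl, Matrix.mul_smul]
  exact key _ (by simp)

theorem jointProj_herm (y : J → ZMod 2) : (jointProj H y)ᴴ = jointProj H y := by
  unfold jointProj
  rw [Matrix.conjTranspose_list_prod, List.map_map]
  have h : (Matrix.conjTranspose ∘ fun j => (1 / 2 : ℂ) • (1 + sgn (y j) • H j)) =
      fun j => (1 / 2 : ℂ) • (1 + sgn (y j) • H j) := by
    ext1 j
    simp [Matrix.conjTranspose_smul, Matrix.conjTranspose_add, hH.herm, star_sgn]
  rw [h]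
  refine (List.reverse_perm _).prod_eq' ?_
  rw [List.pairwise_reverse, List.pairwise_map]
  refine List.Pairwise.imp_of_mem (R := fun _ _ => True) (fun {i j} _ _ _ => ?_)
    (List.pairwise_of_forall fun _ _ => trivial)
  refine Commute.smul_left (Commute.smul_right ?_ _) _
  refine Commute.add_left (Commute.one_left _) (Commute.smul_left ?_ _)
  exact (Commute.one_right _).add_right ((hH.comm j i).smul_right _)

/-- Expand the product over `j` of the sums of the two projectors of `H j`, each of which is `1`.
Distributing a product over sums needs a commutative ring, hence the passage to the algebra
generated by the `H j`. -/
theorem sum_jointProj [DecidableEq J] : ∑ y, jointProj H y = 1 := by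
  have hc : ∀ a ∈ Set.range H, ∀ b ∈ Set.range H, a * b = b * a := by
    rintro _ ⟨i, rfl⟩ _ ⟨j, rfl⟩
    exact hH.comm i j
  have := Algebra.isMulCommutative_adjoin ℂ hc
  let : CommRing (Algebra.adjoin ℂ (Set.range H)) :=
    { mul_comm := fun a b => mul_comm' a b }
  let g : J → ZMod 2 → Algebra.adjoin ℂ (Set.range H) := fun j a =>
    (1 / 2 : ℂ) • (1 + sgn a • ⟨H j, Algebra.subset_adjoin ⟨j, rfl⟩⟩)
  have h1 : ∀ y : J → ZMod 2, jointProj H y =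
      (Algebra.adjoin ℂ (Set.range H)).val (∏ j, g j (y j)) := by
    intro y
    rw [← Finset.prod_map_toList, map_list_prod, List.map_map]
    rfl
  have h2 : ∑ y : J → ZMod 2, ∏ j, g j (y j) = 1 := by
    have := Finset.prod_univ_sum (fun _ : J => (Finset.univ : Finset (ZMod 2))) g
    rw [Fintype.piFinset_univ] at this
    rw [← this]
    refine Finset.prod_eq_one fun j _ => ?_
    rw [show (Finset.univ : Finset (ZMod 2)) = {0, 1} from rfl, Finset.sum_pair (by decide)]
    simp only [g, sgn_zero, sgn_one]
    rw [← smul_add, one_smul, neg_smul, one_smul, add_add_add_comm, add_neg_cancel, add_zero,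
      smul_add, ← add_smul]
    norm_num
  simp_rw [h1]
  rw [← map_sum, h2, map_one]

theorem jointProj_mul_of_ne [DecidableEq J] {y y' : J → ZMod 2} (h : y ≠ y') :
    jointProj H y * jointProj H y' = 0 := by
  obtain ⟨j, hj⟩ := Function.ne_iff.1 h
  have hc := commute_jointProj (O := H j) (fun i => hH.comm j i) y
  have h1 : sgn (y j) • (jointProj H y * jointProj H y') =
      sgn (y' j) • (jointProj H y * jointProj H y') := by
    rw [← Matrix.smul_mul, ← hH.mul_jointProj_self, hc.eq, Matrix.mul_assoc,
      hH.mul_jointProj_self, Matrix.mul_smul]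
  rw [← sub_eq_zero, ← sub_smul] at h1
  exact (smul_eq_zero.1 h1).resolve_left fun h0 => hj (sgn_injective (sub_eq_zero.1 h0))

theorem jointProj_mul_self [DecidableEq J] (y : J → ZMod 2) :
    jointProj H y * jointProj H y = jointProj H y := by
  have h : jointProj H y * ∑ y', jointProj H y' = jointProj H y := by
    rw [hH.sum_jointProj, mul_one]
  rwa [Finset.mul_sum, Finset.sum_eq_single y (fun y' _ hne => hH.jointProj_mul_of_ne hne.symm)
    (fun h => absurd (Finset.mem_univ y) h)] at h

variable [DecidableEq J]

theorem calculus_one : calculus H (fun _ => 1) = 1 := by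
  simp [calculus, hH.sum_jointProj]

/-- The sectors are orthogonal and each `A y` preserves them, so controlled operators multiply
sector by sector. -/
theorem calculus_mul {A A' : (J → ZMod 2) → Op Q} (hA : ∀ y j, Commute (A y) (H j)) :
    calculus H A * calculus H A' = calculus H (fun y => A y * A' y) := by
  unfold calculus
  rw [Finset.sum_mul]
  refine Finset.sum_congr rfl fun y _ => ?_
  rw [Finset.mul_sum, Finset.sum_eq_single y]
  · rw [Matrix.mul_assoc, ← Matrix.mul_assoc (A y), (commute_jointProj (hA y) y).eq,
      Matrix.mul_assoc, ← Matrix.mul_assoc, hH.jointProj_mul_self]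
  · intro y' _ hne
    rw [Matrix.mul_assoc, ← Matrix.mul_assoc (A y), (commute_jointProj (hA y) y').eq,
      Matrix.mul_assoc, ← Matrix.mul_assoc, hH.jointProj_mul_of_ne hne.symm, zero_mul]
  · exact fun h => absurd (Finset.mem_univ y) h

theorem calculus_mem_unitary {A : (J → ZMod 2) → Op Q} (hA : ∀ y j, Commute (A y) (H j))
    (hU : ∀ y, A y ∈ Matrix.unitaryGroup (Config Q) ℂ) :
    calculus H A ∈ Matrix.unitaryGroup (Config Q) ℂ := by
  have hc : ∀ y, Commute (A y)ᴴ (jointProj H y) := by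
    intro y
    have h := congrArg Matrix.conjTranspose (commute_jointProj (hA y) y).eq
    rw [Matrix.conjTranspose_mul, Matrix.conjTranspose_mul, hH.jointProj_herm] at h
    exact h.symm
  rw [Matrix.mem_unitaryGroup_iff, Matrix.star_eq_conjTranspose]
  have h : (calculus H A)ᴴ = calculus H (fun y => (A y)ᴴ) := by
    unfold calculus
    rw [Matrix.conjTranspose_sum]
    refine Finset.sum_congr rfl fun y _ => ?_
    rw [Matrix.conjTranspose_mul, hH.jointProj_herm, (hc y).eq]
  rw [h, hH.calculus_mul hA]
  have h1 : (fun y => A y * (A y)ᴴ) = fun _ => 1 :=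
    funext fun y => Matrix.mem_unitaryGroup_iff.1 (hU y)
  rw [h1, hH.calculus_one]

end CommutingInvolutions

theorem mul_calculus [DecidableEq J] {H : J → Op Q} {A : (J → ZMod 2) → Op Q} {O : Op Q}
    {s : J → ZMod 2} (h : ∀ j, O * H j = sgn (s j) • (H j * O)) (hA : ∀ y, Commute O (A y)) :
    O * calculus H A = ∑ y, jointProj H y * A (y + s) * O := by
  unfold calculus
  rw [Finset.mul_sum, ← Equiv.sum_comp (Equiv.addRight s)]
  refine Finset.sum_congr rfl fun y _ => ?_
  rw [Equiv.coe_addRight, ← Matrix.mul_assoc, mul_jointProj h, add_assoc,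
    add_self_eq_zero_of_zmodTwo, add_zero, Matrix.mul_assoc, (hA _).eq, ← Matrix.mul_assoc]

/-- For support estimates: `O` may shift the labels, provided that `A` does not see the shift. -/
theorem commute_calculus [DecidableEq J] {H : J → Op Q} {A : (J → ZMod 2) → Op Q} {O : Op Q}
    {s : J → ZMod 2} (h : ∀ j, O * H j = sgn (s j) • (H j * O)) (hA : ∀ y, Commute O (A y))
    (hs : ∀ y, A (y + s) = A y) : Commute O (calculus H A) := by
  rw [Commute, SemiconjBy, mul_calculus h hA, calculus, Finset.sum_mul]
  simp_rw [hs]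

end Calculus

/-! ### The linking phase from abstract linking data -/

section Sectors

variable {E C : Type}

theorem elim_add_elim (x x' : E → ZMod 2) (y y' : C → ZMod 2) :
    Sum.elim x y + Sum.elim x' y' = Sum.elim (x + x') (y + y') := by
  ext q; cases q <;> rfl

theorem single_inl_eq [DecidableEq E] [DecidableEq C] (e : E) :
    (Pi.single (Sum.inl e) 1 : E ⊕ C → ZMod 2) = Sum.elim (Pi.single e 1) 0 := by
  ext q; cases q <;> simp [Pi.single_apply]

theorem single_inr_eq [DecidableEq E] [DecidableEq C] (c : C) :
    (Pi.single (Sum.inr c) 1 : E ⊕ C → ZMod 2) = Sum.elim (0 : E → ZMod 2) (Pi.single c 1) := by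
  ext q; cases q <;> simp [Pi.single_apply]

/-- The cochain `e' ↦ ∫ τ ∪₁ e'`, for the pairing `cup` of cells. -/
def cupMap [Fintype E] (cup : E → E → ZMod 2) (τ : E → ZMod 2) : E → ZMod 2 :=
  fun e' => ∑ e, τ e * cup e e'

theorem cupMap_add [Fintype E] (cup : E → E → ZMod 2) (τ τ' : E → ZMod 2) :
    cupMap cup (τ + τ') = cupMap cup τ + cupMap cup τ' := by
  ext e
  simp [cupMap, add_mul, Finset.sum_add_distrib]

theorem cupMap_zero [Fintype E] (cup : E → E → ZMod 2) : cupMap cup 0 = 0 := by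
  ext e
  simp [cupMap]

theorem cupMap_single_dotProduct [Fintype E] [DecidableEq E] (cup : E → E → ZMod 2) (τ : E → ZMod 2) (e : E) :
    cupMap cup τ ⬝ᵥ Pi.single e 1 = ∑ e', cup e' e * τ e' := by
  simp [cupMap, mul_comm]

theorem opPow_zero {Q : Type} [Fintype Q] [DecidableEq Q] (A : Op Q) : opPow A 0 = 1 :=
  if_pos rfl

theorem opPow_one {Q : Type} [Fintype Q] [DecidableEq Q] (A : Op Q) : opPow A 1 = A :=
  if_neg one_ne_zero

theorem mul_list_opPow {Q ι : Type} [Fintype Q] [DecidableEq Q] {P : Op Q} {G : ι → Op Q}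
    {t : ι → ZMod 2} (hG : ∀ i, P * G i = sgn (t i) • P) (f : ι → ZMod 2) (l : List ι) :
    P * (l.map fun i => opPow (G i) (f i)).prod = sgn (l.map fun i => f i * t i).sum • P := by
  induction l with
  | nil => simp [sgn_zero]
  | cons i l ih =>
    have h01 : f i = 0 ∨ f i = 1 := by
      generalize f i = a; revert a; decide
    simp only [List.map_cons, List.sum_cons, List.prod_cons]
    rcases h01 with h | h
    · simp only [h, opPow_zero, one_mul, zero_mul, zero_add]
      exact ih
    · rw [h, opPow_one, ← mul_assoc, hG, Matrix.smul_mul, ih, smul_smul, one_mul, sgn_add]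

theorem Commute.opPow_right {Q : Type} [Fintype Q] [DecidableEq Q] {A O : Op Q}
    (h : Commute O A) (a : ZMod 2) : Commute O (opPow A a) := by
  unfold opPow
  split_ifs
  · exact Commute.one_right O
  · exact h

variable [Fintype E] [DecidableEq E] [Fintype C] [DecidableEq C]

/-- A Pauli operator on the qubits in `E`. -/
def onPrimal (x z : E → ZMod 2) : Op (E ⊕ C) :=
  weyl (Sum.elim x 0) (Sum.elim z 0)

/-- A Pauli operator on the qubits in `C`. -/
def onDual (x z : C → ZMod 2) : Op (E ⊕ C) :=
  weyl (Sum.elim 0 x) (Sum.elim 0 z)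

theorem onPrimal_mul (x z x' z' : E → ZMod 2) :
    (onPrimal x z * onPrimal x' z' : Op (E ⊕ C)) = sgn (z ⬝ᵥ x') • onPrimal (x + x') (z + z') := by
  simp [onPrimal, weyl_mul, sumElim_dotProduct_sumElim, elim_add_elim]

theorem onDual_mul (x z x' z' : C → ZMod 2) :
    (onDual x z * onDual x' z' : Op (E ⊕ C)) = sgn (z ⬝ᵥ x') • onDual (x + x') (z + z') := by
  simp [onDual, weyl_mul, sumElim_dotProduct_sumElim, elim_add_elim]

theorem onPrimal_mul_comm (x z x' z' : E → ZMod 2) :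
    (onPrimal x z * onPrimal x' z' : Op (E ⊕ C)) =
      sgn (z ⬝ᵥ x' + z' ⬝ᵥ x) • (onPrimal x' z' * onPrimal x z) := by
  unfold onPrimal
  rw [weyl_mul_comm]
  simp [sumElim_dotProduct_sumElim]

theorem onDual_mul_comm (x z x' z' : C → ZMod 2) :
    (onDual x z * onDual x' z' : Op (E ⊕ C)) =
      sgn (z ⬝ᵥ x' + z' ⬝ᵥ x) • (onDual x' z' * onDual x z) := by
  unfold onDual
  rw [weyl_mul_comm]
  simp [sumElim_dotProduct_sumElim]

theorem onPrimal_commute {x z x' z' : E → ZMod 2}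
    (h : z ⬝ᵥ x' = z' ⬝ᵥ x) : Commute (onPrimal x z : Op (E ⊕ C)) (onPrimal x' z') := by
  rw [Commute, SemiconjBy, onPrimal_mul_comm, h, CharTwo.add_self_eq_zero, sgn_zero, one_smul]

theorem onDual_commute {x z x' z' : C → ZMod 2}
    (h : z ⬝ᵥ x' = z' ⬝ᵥ x) : Commute (onDual x z : Op (E ⊕ C)) (onDual x' z') := by
  rw [Commute, SemiconjBy, onDual_mul_comm, h, CharTwo.add_self_eq_zero, sgn_zero, one_smul]

theorem onPrimal_commute_onDual (x z : E → ZMod 2)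
    (x' z' : C → ZMod 2) : Commute (onPrimal x z) (onDual x' z') :=
  weyl_commute (by simp [sumElim_dotProduct_sumElim])

theorem onPrimal_zero : onPrimal (E := E) (C := C) 0 0 = 1 := by
  rw [onPrimal, Sum.elim_zero_zero, weyl_zero]

theorem onDual_zero : onDual (E := E) (C := C) 0 0 = 1 := by
  rw [onDual, Sum.elim_zero_zero, weyl_zero]

theorem siteX_inl (e : E) :
    pauliX (Pi.single (Sum.inl e) 1 : E ⊕ C → ZMod 2) = onPrimal (Pi.single e 1) 0 := by
  rw [single_inl_eq, onPrimal, Sum.elim_zero_zero, weyl_zero_right]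

theorem siteZ_inl (e : E) :
    pauliZ (Pi.single (Sum.inl e) 1 : E ⊕ C → ZMod 2) = onPrimal 0 (Pi.single e 1) := by
  rw [single_inl_eq, onPrimal, Sum.elim_zero_zero, weyl_zero_left]

theorem siteX_inr (c : C) :
    pauliX (Pi.single (Sum.inr c) 1 : E ⊕ C → ZMod 2) = onDual (Pi.single c 1) 0 := by
  rw [single_inr_eq, onDual, Sum.elim_zero_zero, weyl_zero_right]

theorem siteZ_inr (c : C) :
    pauliZ (Pi.single (Sum.inr c) 1 : E ⊕ C → ZMod 2) = onDual 0 (Pi.single c 1) := by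
  rw [single_inr_eq, onDual, Sum.elim_zero_zero, weyl_zero_left]

/-- The flux operator of `c`, for the incidence numbers `inc`. -/
def primalFlux (inc : C → E → ZMod 2) (cup : E → E → ZMod 2) (c : C) : Op (E ⊕ C) :=
  onPrimal (inc c) (cupMap cup (inc c))

/-- The dual flux operator of `e`. -/
def dualFlux (inc : C → E → ZMod 2) (cupD : C → C → ZMod 2) (e : E) : Op (E ⊕ C) :=
  onDual (fun c => inc c e) (cupMap cupD fun c => inc c e)

/-- The index set `J` labels commuting Pauli operators on the `k`-cells such that the flux operators
on the `(k+1)`-cells are functions of them: on the joint eigenspace of label `y`, the fluxes are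
`t y`. The label is shifted by `σ c = hx · c` when the flux `dc` is added. The phase `∏ φ e y`, a
product of local factors, turns the Pauli operator with fluxes `t y` into a product of flux
operators. -/
structure LinkingData {d L : ℕ} (inc : C → E → ZMod 2) (cup : E → E → ZMod 2)
    (cupD : C → C → ZMod 2) (pos : E ⊕ C → Fin d → ZMod L) (J : Type) [Fintype J] [DecidableEq J]
    (ρ : ℕ) where
  inc_local : ∀ c e, inc c e ≠ 0 → ∀ a, torusNorm (pos (Sum.inr c) a - pos (Sum.inl e) a) ≤ ρ
  cup_local : ∀ e' e, cup e' e ≠ 0 → ∀ a, torusNorm (pos (Sum.inl e') a - pos (Sum.inl e) a) ≤ ρ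
  cupD_local : ∀ c' c, cupD c' c ≠ 0 → ∀ a, torusNorm (pos (Sum.inr c') a - pos (Sum.inr c) a) ≤ ρ
  lam : J → ℂ
  hx : J → C → ZMod 2
  hz : J → C → ZMod 2
  inv : CommutingInvolutions fun j => lam j • onDual (E := E) (hx j) (hz j)
  hz_eq : ∀ j c, hz j c = ∑ c', cupD c' c * hx j c'
  t : (J → ZMod 2) → E → ZMod 2
  flux : ∀ y e, jointProj (fun j => lam j • onDual (hx j) (hz j)) y * dualFlux inc cupD e =
    sgn (t y e) • jointProj (fun j => lam j • onDual (hx j) (hz j)) y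
  t_add : ∀ y c, t (y + fun j => hx j c) = t y + inc c
  φ : E → (J → ZMod 2) → ℂ
  φ_unit : ∀ e y, star (φ e y) * φ e y = 1
  φ_local : ∀ e c y, (¬ ∀ a, torusNorm (pos (Sum.inr c) a - pos (Sum.inl e) a) ≤ ρ) →
    φ e (y + fun j => hx j c) = φ e y
  sector : (J → ZMod 2) → Prop
  sector_add : ∀ y c, sector y → sector (y + fun j => hx j c)
  proj_eq_zero : ∀ y, ¬ sector y →
    jointProj (fun j => lam j • onDual (E := E) (hx j) (hz j)) y = 0
  phase_add : ∀ y c, sector y →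
    (∏ e, φ e (y + fun j => hx j c)) • onPrimal (t y + inc c) (cupMap cup (t y + inc c)) =
      (∏ e, φ e y) • (onPrimal (t y) (cupMap cup (t y)) * primalFlux inc cup c)
  phase_zero : ∀ y, sector y → t y = 0 → ∏ e, φ e y = 1

namespace LinkingData

variable {d L : ℕ} {inc : C → E → ZMod 2} {cup : E → E → ZMod 2} {cupD : C → C → ZMod 2}
  {pos : E ⊕ C → Fin d → ZMod L} {J : Type} [Fintype J] [DecidableEq J] {ρ : ℕ}
  (W : LinkingData inc cup cupD pos J ρ)

/-- The commuting Pauli operators. -/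
noncomputable def H (j : J) : Op (E ⊕ C) := W.lam j • onDual (W.hx j) (W.hz j)

/-- The change of label that adds the flux `dc`. -/
def σ (c : C) : J → ZMod 2 := fun j => W.hx j c

/-- The operator on the `(k+1)`-cells in the sector of label `y`. -/
noncomputable def A (y : J → ZMod 2) : Op (E ⊕ C) :=
  (∏ e, W.φ e y) • onPrimal (W.t y) (cupMap cup (W.t y))

/-- The linking phase. -/
noncomputable def V : Op (E ⊕ C) := calculus W.H W.A

theorem onPrimal_commute_H (x z : E → ZMod 2) (j : J) :
    Commute (onPrimal x z) (W.H j) :=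
  (onPrimal_commute_onDual x z _ _).smul_right _

theorem A_add {y : J → ZMod 2} (hy : W.sector y) (c : C) :
    W.A (y + W.σ c) = W.A y * primalFlux inc cup c := by
  unfold A
  have h := W.phase_add y c hy
  rw [← W.t_add] at h
  rw [Matrix.smul_mul]
  exact h

/-- Fluxes are added one cell at a time. The sector condition is carried through the induction
because `A_add` is available only on admissible labels. -/
theorem sector_A_add_list (f : C → ZMod 2) (l : List (C))
    {y : J → ZMod 2} (hy : W.sector y) :
    W.sector (y + (l.map fun c => f c • W.σ c).sum) ∧
    W.t (y + (l.map fun c => f c • W.σ c).sum) = W.t y + (l.map fun c => f c • inc c).sum ∧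
    W.A (y + (l.map fun c => f c • W.σ c).sum) =
      W.A y * (l.map fun c => opPow (primalFlux inc cup c) (f c)).prod := by
  induction l generalizing y with
  | nil => simpa using hy
  | cons c l ih =>
    have h01 : f c = 0 ∨ f c = 1 := by
      generalize f c = a; revert a; decide
    simp only [List.map_cons, List.sum_cons, List.prod_cons]
    rcases h01 with h | h
    · simp only [h, zero_smul, zero_add, opPow_zero, one_mul]
      exact ih hy
    · have hs := W.sector_add y c hy
      have := ih hs
      rw [show (fun j => W.hx j c) = W.σ c from rfl] at this
      simp only [h, one_smul, opPow_one, ← add_assoc, ← mul_assoc]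
      rw [W.A_add hy, show W.t (y + W.σ c) = _ from W.t_add y c] at this
      exact this

theorem sector_A_add_sum (f : C → ZMod 2) {y : J → ZMod 2} (hy : W.sector y) :
    W.sector (y + ∑ c, f c • W.σ c) ∧
    W.t (y + ∑ c, f c • W.σ c) = W.t y + ∑ c, f c • inc c ∧
    W.A (y + ∑ c, f c • W.σ c) =
      W.A y * (Finset.univ.toList.map fun c => opPow (primalFlux inc cup c) (f c)).prod := by
  have h := W.sector_A_add_list f Finset.univ.toList hy
  rwa [Finset.sum_map_toList, Finset.sum_map_toList] at h

theorem pauliZ_mul_H (c : C) (j : J) :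
    pauliZ (Pi.single (Sum.inr c) 1 : E ⊕ C → ZMod 2) * W.H j =
      sgn (W.σ c j) • (W.H j * pauliZ (Pi.single (Sum.inr c) 1)) := by
  rw [H, Matrix.mul_smul, siteZ_inr, onDual_mul_comm, Matrix.smul_mul, smul_comm]
  simp [σ]

/-- An `X̃_c` detects only the `Z` part of `H j`, which `hz_eq` expresses through the shifts `σ c'`
of the cells paired with `c`. These are the exponents in the image of `X̃_c`. -/
theorem pauliX_mul_H (c : C) (j : J) :
    pauliX (Pi.single (Sum.inr c) 1 : E ⊕ C → ZMod 2) * W.H j =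
      sgn ((∑ c', cupD c' c • W.σ c') j) • (W.H j * pauliX (Pi.single (Sum.inr c) 1)) := by
  rw [H, Matrix.mul_smul, siteX_inr, onDual_mul_comm, Matrix.smul_mul, smul_comm]
  simp [σ, W.hz_eq]

theorem onPrimal_commute_A {x z : E → ZMod 2} {y : J → ZMod 2} :
    onPrimal x z * W.A y = sgn (z ⬝ᵥ W.t y + cupMap cup (W.t y) ⬝ᵥ x) • (W.A y * onPrimal x z) := by
  rw [A, Matrix.mul_smul, onPrimal_mul_comm, Matrix.smul_mul, smul_comm]

theorem onDual_commute_A (x z : C → ZMod 2) (y : J → ZMod 2) :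
    Commute (onDual x z) (W.A y) :=
  (onPrimal_commute_onDual _ _ _ _).symm.smul_right _

theorem prod_star_mul_prod (S : Finset (E)) (y : J → ZMod 2) :
    star (∏ e ∈ S, W.φ e y) * ∏ e ∈ S, W.φ e y = 1 := by
  rw [star_prod, ← Finset.prod_mul_distrib]
  exact Finset.prod_eq_one fun e _ => W.φ_unit e y

theorem V_mem_unitary : W.V ∈ Matrix.unitaryGroup (Config (E ⊕ C)) ℂ :=
  W.inv.calculus_mem_unitary (fun _ j => (W.onPrimal_commute_H _ _ j).smul_left _)
    fun y => smul_mem_unitary (weyl_mem_unitary _ _) (W.prod_star_mul_prod _ y)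

/-- Conjugation of an operator on the `(k+1)`-cells. -/
theorem primal_mul_V {x z : E → ZMod 2}
    {G : Op (E ⊕ C)} (hG : ∀ u v, Commute (onPrimal u v) G)
    (h : ∀ y, jointProj W.H y * G = sgn (z ⬝ᵥ W.t y + cupMap cup (W.t y) ⬝ᵥ x) • jointProj W.H y) :
    onPrimal x z * W.V = W.V * (onPrimal x z * G) := by
  unfold V calculus
  rw [Finset.mul_sum, Finset.sum_mul]
  refine Finset.sum_congr rfl fun y _ => ?_
  have h1 := commute_jointProj (W.onPrimal_commute_H x z) y
  have h2 : Commute (W.A y) G := (hG _ _).smul_left _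
  -- The sign picked up in passing `A y` is, by `h`, the value of `G` on the sector `y`.
  rw [← Matrix.mul_assoc, h1.eq, Matrix.mul_assoc, onPrimal_commute_A, (hG x z).eq,
    Matrix.mul_assoc, ← Matrix.mul_assoc (W.A y) G, h2.eq, Matrix.mul_smul, Matrix.mul_assoc G,
    ← Matrix.mul_assoc _ G, h, Matrix.smul_mul]

/-- Conjugation of an operator on the `k`-cells that shifts the labels. -/
theorem dual_mul_V {x z : C → ZMod 2} {s : J → ZMod 2}
    (hs : ∀ j, onDual x z * W.H j = sgn (s j) • (W.H j * onDual x z))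
    {G : Op (E ⊕ C)} (hG : Commute (onDual x z) G)
    (h : ∀ y, W.sector y → W.A (y + s) = W.A y * G) :
    onDual x z * W.V = W.V * (onDual x z * G) := by
  unfold V
  rw [mul_calculus hs (W.onDual_commute_A x z), calculus, Finset.sum_mul]
  refine Finset.sum_congr rfl fun y _ => ?_
  by_cases hy : W.sector y
  · rw [h y hy, hG.eq]
    simp only [Matrix.mul_assoc]
  · have h0 : jointProj W.H y = 0 := W.proj_eq_zero y hy
    simp [h0]

theorem conj_eq {O G : Op (E ⊕ C)} (h : O * W.V = W.V * (O * G)) :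
    W.Vᴴ * O * W.V = O * G := by
  have hV := Matrix.mem_unitaryGroup_iff'.1 W.V_mem_unitary
  rw [Matrix.star_eq_conjTranspose] at hV
  rw [Matrix.mul_assoc, h, ← Matrix.mul_assoc, hV, one_mul]

theorem conj_Z_primal (e : E) : W.Vᴴ * pauliZ (Pi.single (Sum.inl e) 1) * W.V =
    pauliZ (Pi.single (Sum.inl e) 1) * dualFlux inc cupD e := by
  refine W.conj_eq ?_
  rw [siteZ_inl]
  refine W.primal_mul_V (fun u v => onPrimal_commute_onDual _ _ _ _) fun y => ?_
  have hf : jointProj W.H y * dualFlux inc cupD e = sgn (W.t y e) • jointProj W.H y :=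
    W.flux y e
  rw [hf, dotProduct_zero, add_zero, single_one_dotProduct]

theorem conj_Z_dual (c : C) : W.Vᴴ * pauliZ (Pi.single (Sum.inr c) 1) * W.V =
    pauliZ (Pi.single (Sum.inr c) 1) * primalFlux inc cup c := by
  refine W.conj_eq ?_
  have hs := W.pauliZ_mul_H c
  rw [siteZ_inr] at hs ⊢
  exact W.dual_mul_V hs (onPrimal_commute_onDual _ _ _ _).symm fun _ hy => W.A_add hy c

theorem conj_X_primal (e : E) : W.Vᴴ * pauliX (Pi.single (Sum.inl e) 1) * W.V =
    pauliX (Pi.single (Sum.inl e) 1) *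
      (Finset.univ.toList.map fun e' => opPow (dualFlux inc cupD e') (cup e' e)).prod := by
  refine W.conj_eq ?_
  rw [siteX_inl]
  refine W.primal_mul_V (fun u v => Commute.list_prod_right _ _ ?_) fun y => ?_
  · intro B hB
    obtain ⟨e', -, rfl⟩ := List.mem_map.1 hB
    exact (onPrimal_commute_onDual _ _ _ _).opPow_right _
  · have hf : ∀ e', jointProj W.H y * dualFlux inc cupD e' = sgn (W.t y e') • jointProj W.H y :=
      W.flux y
    rw [mul_list_opPow hf (fun e' => cup e' e), Finset.sum_map_toList, zero_dotProduct,
      zero_add, cupMap_single_dotProduct]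

theorem conj_X_dual (c : C) : W.Vᴴ * pauliX (Pi.single (Sum.inr c) 1) * W.V =
    pauliX (Pi.single (Sum.inr c) 1) *
      (Finset.univ.toList.map fun c' => opPow (primalFlux inc cup c') (cupD c' c)).prod := by
  refine W.conj_eq ?_
  have hs := W.pauliX_mul_H c
  rw [siteX_inr] at hs ⊢
  refine W.dual_mul_V hs (Commute.list_prod_right _ _ ?_) fun y hy =>
    (W.sector_A_add_sum _ hy).2.2
  intro B hB
  obtain ⟨e', -, rfl⟩ := List.mem_map.1 hB
  exact (onPrimal_commute_onDual _ _ _ _).symm.opPow_right _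

theorem list_primalFlux_mulVec {f g : C → ZMod 2} {ψ : Config (E ⊕ C) → ℂ}
    (h : ∀ c, primalFlux inc cup c *ᵥ ψ = sgn (g c) • ψ) (l : List (C)) :
    (l.map fun c => opPow (primalFlux inc cup c) (f c)).prod *ᵥ ψ =
      sgn (l.map fun c => f c * g c).sum • ψ := by
  induction l with
  | nil => simp [sgn_zero]
  | cons c l ih =>
    have h01 : f c = 0 ∨ f c = 1 := by
      generalize f c = a; revert a; decide
    simp only [List.map_cons, List.sum_cons, List.prod_cons]
    rcases h01 with h0 | h0
    · simp only [h0, opPow_zero, one_mul, zero_mul, zero_add]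
      exact ih
    · rw [h0, opPow_one, ← Matrix.mulVec_mulVec, ih, Matrix.mulVec_smul, h,
        smul_smul, ← sgn_add, one_mul, add_comm]

theorem V_mulVec (a : E → ZMod 2) (b : C → ZMod 2) (ψ : Config (E ⊕ C) → ℂ)
    (hG : ∀ c, primalFlux inc cup c *ᵥ ψ = sgn (∑ e, inc c e * a e) • ψ)
    (hD : ∀ e, dualFlux inc cupD e *ᵥ ψ = sgn (∑ c, inc c e * b c) • ψ) :
    W.V *ᵥ ψ = sgn (∑ e, a e * ∑ c, inc c e * b c) • ψ := by
  have hsum : ∑ c, b c * ∑ e, inc c e * a e = ∑ e, a e * ∑ c, inc c e * b c := by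
    simp only [Finset.mul_sum]
    rw [Finset.sum_comm]
    refine Finset.sum_congr rfl fun e _ => Finset.sum_congr rfl fun c _ => ?_
    ring
  have key : ∀ y, (jointProj W.H y * W.A y) *ᵥ ψ =
      sgn (∑ e, a e * ∑ c, inc c e * b c) • (jointProj W.H y *ᵥ ψ) := by
    intro y
    by_cases hy : W.sector y
    -- If the flux of the sector is not `db`, some dual flux operator has two different eigenvalues
    -- on the component of `ψ` there, so that component vanishes.
    · by_cases ht : W.t y = fun e => ∑ c, inc c e * b c
      · obtain ⟨h1, h2, h3⟩ := W.sector_A_add_sum b hy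
        -- Shifting twice by `b` returns to `y`. Thus `A y` is the product of the `G_c` times the
        -- operator at flux zero, and the latter is `1` by `phase_zero`.
        obtain ⟨-, -, h6⟩ := W.sector_A_add_sum b h1
        rw [add_assoc, add_self_eq_zero_of_zmodTwo, add_zero] at h6
        have h0 : W.t (y + ∑ c, b c • W.σ c) = 0 := by
          have hb : ∑ c, b c • inc c = fun e => ∑ c, inc c e * b c := by
            ext e
            simp [mul_comm]
          rw [h2, ht, hb, add_self_eq_zero_of_zmodTwo]
        have hA : W.A (y + ∑ c, b c • W.σ c) = 1 := by
          unfold A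
          rw [W.phase_zero _ h1 h0, h0, cupMap_zero, onPrimal_zero, one_smul]
        rw [h6, hA, one_mul, ← Matrix.mulVec_mulVec, list_primalFlux_mulVec hG, Finset.sum_map_toList,
          Matrix.mulVec_smul, hsum]
      · obtain ⟨e, he⟩ := Function.ne_iff.1 ht
        have hf : jointProj W.H y * dualFlux inc cupD e = sgn (W.t y e) • jointProj W.H y :=
          W.flux y e
        have h1 : sgn (∑ c, inc c e * b c) • (jointProj W.H y *ᵥ ψ) =
            sgn (W.t y e) • (jointProj W.H y *ᵥ ψ) := by
          rw [← Matrix.mulVec_smul, ← hD e, Matrix.mulVec_mulVec, hf, Matrix.smul_mulVec]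
        rw [← sub_eq_zero, ← sub_smul] at h1
        have h2 : jointProj W.H y *ᵥ ψ = 0 := (smul_eq_zero.1 h1).resolve_left
          fun h => he (sgn_injective (sub_eq_zero.1 h)).symm
        have hc : Commute (W.A y) (jointProj W.H y) :=
          commute_jointProj (fun j => (W.onPrimal_commute_H _ _ j).smul_left _) y
        rw [← hc.eq, ← Matrix.mulVec_mulVec, h2, Matrix.mulVec_zero, smul_zero]
    · have h0 : jointProj W.H y = 0 := W.proj_eq_zero y hy
      simp [h0]
  have h1 : ∑ y, jointProj W.H y *ᵥ ψ = ψ := by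
    have hone : ∑ y, jointProj W.H y = 1 := W.inv.sum_jointProj
    rw [← Matrix.sum_mulVec, hone, Matrix.one_mulVec]
  unfold V calculus
  rw [Matrix.sum_mulVec]
  simp_rw [key]
  rw [← Finset.smul_sum, h1]

/-- The part of `W.A` that flips the qubits of `S`. -/
noncomputable def flipPart (S : Finset E) (y : J → ZMod 2) : Op (E ⊕ C) :=
  (∏ e ∈ S, W.φ e y) • onPrimal (fun e => if e ∈ S then W.t y e else 0) 0

/-- The part of `W.A` with the phases induced by the flux through `S`. -/
def phasePart (S : Finset E) (y : J → ZMod 2) : Op (E ⊕ C) :=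
  onPrimal 0 fun e' => ∑ e ∈ S, W.t y e * cup e e'

theorem flipPart_mul_phasePart (y : J → ZMod 2) :
    W.flipPart Finset.univ y * W.phasePart Finset.univ y = W.A y := by
  unfold flipPart phasePart A
  rw [Matrix.smul_mul, onPrimal_mul, zero_dotProduct, sgn_zero, one_smul, add_zero, zero_add]
  simp only [Finset.mem_univ, if_true]
  rfl

theorem flipPart_commute_H (S : Finset E) (y : J → ZMod 2) (j : J) :
    Commute (W.flipPart S y) (W.H j) :=
  (W.onPrimal_commute_H _ _ j).smul_left _

/-- The `X` factors commute with each other, and so do the `Z` factors, but a mixed pair may not.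
Once separated, each half is multiplicative over disjoint sets of cells. -/
theorem V_eq : W.V = calculus W.H (W.flipPart Finset.univ) * calculus W.H (W.phasePart Finset.univ) := by
  have h : calculus W.H (W.flipPart Finset.univ) * calculus W.H (W.phasePart Finset.univ) = _ :=
    W.inv.calculus_mul (W.flipPart_commute_H Finset.univ)
  rw [h]
  simp_rw [W.flipPart_mul_phasePart]
  rfl

theorem inc_eq_zero (W : LinkingData inc cup cupD pos J ρ) {c : C} {e : E}
    (h : ¬ ∀ a, torusNorm (pos (Sum.inr c) a - pos (Sum.inl e) a) ≤ ρ) : inc c e = 0 := by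
  by_contra h0
  exact h (W.inc_local c e h0)

/-- A function of the labels near `e` commutes with the Pauli operators far from `e`. -/
theorem commute_calculus_of_local {F : (J → ZMod 2) → Op (E ⊕ C)} {e : E}
    (hF : ∀ x z y, Commute (onDual x z) (F y))
    (hloc : ∀ c, (¬ ∀ a, torusNorm (pos (Sum.inr c) a - pos (Sum.inl e) a) ≤ ρ) →
      ∀ y, F (y + W.σ c) = F y)
    {c : C} (hc : Sum.inr c ∉ torusBall pos (2 * ρ) (pos (Sum.inl e))) :
    Commute (pauliX (Pi.single (Sum.inr c) 1)) (calculus W.H F) ∧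
      Commute (pauliZ (Pi.single (Sum.inr c) 1)) (calculus W.H F) := by
  refine ⟨commute_calculus (W.pauliX_mul_H c) ?_ ?_, commute_calculus (W.pauliZ_mul_H c) ?_ ?_⟩
  · intro y; rw [siteX_inr]; exact hF _ _ y
  · have key : ∀ T : Finset C, ∀ y,
        F (y + ∑ c' ∈ T, cupD c' c • W.σ c') = F y := by
      intro T
      induction T using Finset.induction_on with
      | empty => intro y; simp
      | insert c' T hc' ih =>
        intro y
        rw [Finset.sum_insert hc', ← add_assoc, ih]
        by_cases h0 : cupD c' c = 0
        · rw [h0, zero_smul, add_zero]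
        · have h1 : cupD c' c = 1 := by
            revert h0; generalize cupD c' c = a; revert a; decide
          rw [h1, one_smul]
          -- The shift caused by `X̃_c` comes from cells `c'` within `ρ` of `c`. Leaving the ball of
          -- radius `2 * ρ` therefore keeps every such `c'` out of the ball of radius `ρ` about `e`.
          refine hloc c' (fun h => hc (mem_torusBall.2 fun a => ?_)) y
          have h2 := torusNorm_sub_le (pos (Sum.inr c) a) (pos (Sum.inr c') a) (pos (Sum.inl e) a)
          have h3 := W.cupD_local c' c h0 a
          rw [torusNorm_sub_comm] at h3
          have h4 := h a
          omega
    exact key Finset.univ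
  · intro y; rw [siteZ_inr]; exact hF _ _ y
  · exact hloc c fun h => hc (mem_torusBall.2 fun a => (h a).trans (by omega))

/-- A controlled gate that flips only the qubit `e`; its controls `t y e` and `φ e y` change only
under shifts by cells near `e`. -/
theorem supportedOn_flipPart (e : E) :
    SupportedOn (torusBall pos (2 * ρ) (pos (Sum.inl e))) (calculus W.H (W.flipPart {e})) := by
  have hloc : ∀ c, (¬ ∀ a, torusNorm (pos (Sum.inr c) a - pos (Sum.inl e) a) ≤ ρ) →
      ∀ y, W.flipPart {e} (y + W.σ c) = W.flipPart {e} y := by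
    intro c hc y
    unfold flipPart
    rw [Finset.prod_singleton, Finset.prod_singleton,
      show W.φ e (y + W.σ c) = _ from W.φ_local e c y hc]
    congr 2
    ext e'
    simp only [Finset.mem_singleton]
    split_ifs with h
    · rw [h, show W.t (y + W.σ c) = _ from W.t_add y c, Pi.add_apply]
      rw [W.inc_eq_zero hc, add_zero]
    · rfl
  have hdual := fun c hc => W.commute_calculus_of_local (F := W.flipPart {e})
    (e := e) (c := c) (fun x z y => (onPrimal_commute_onDual _ _ x z).symm.smul_right _) hloc hc
  have hprimal : ∀ e', e' ≠ e → ∀ x z y, (z = 0 ∨ z = Pi.single e' 1) →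
      Commute (onPrimal x z) (W.flipPart {e} y) := by
    intro e' he x z y hz
    refine (onPrimal_commute ?_).smul_right _
    rw [zero_dotProduct]
    rcases hz with rfl | rfl
    · rw [zero_dotProduct]
    · simp [he]
  refine supportedOn_of_commute (fun q hq => ?_) (fun q hq => ?_)
  · rcases q with e' | c
    · have he : e' ≠ e := by
        rintro rfl
        exact hq (mem_torusBall.2 fun a => by rw [sub_self, torusNorm_zero]; omega)
      rw [siteX_inl]
      exact commute_calculus (s := 0) (fun j => by
        rw [Pi.zero_apply, sgn_zero, one_smul, (W.onPrimal_commute_H _ _ j).eq])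
        (fun y => hprimal e' he _ _ y (Or.inl rfl)) (fun y => by rw [add_zero])
    · exact (hdual c hq).1
  · rcases q with e' | c
    · have he : e' ≠ e := by
        rintro rfl
        exact hq (mem_torusBall.2 fun a => by rw [sub_self, torusNorm_zero]; omega)
      rw [siteZ_inl]
      exact commute_calculus (s := 0) (fun j => by
        rw [Pi.zero_apply, sgn_zero, one_smul, (W.onPrimal_commute_H _ _ j).eq])
        (fun y => hprimal e' he _ _ y (Or.inr rfl)) (fun y => by rw [add_zero])
    · exact (hdual c hq).2

/-- The `Z` factors reach the cells `e'` paired with `e` by `cup`, and the only control is `t y e`.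
-/
theorem supportedOn_phasePart (e : E) :
    SupportedOn (torusBall pos (2 * ρ) (pos (Sum.inl e))) (calculus W.H (W.phasePart {e})) := by
  have hloc : ∀ c, (¬ ∀ a, torusNorm (pos (Sum.inr c) a - pos (Sum.inl e) a) ≤ ρ) →
      ∀ y, W.phasePart {e} (y + W.σ c) = W.phasePart {e} y := by
    intro c hc y
    unfold phasePart
    simp only [Finset.sum_singleton]
    rw [show W.t (y + W.σ c) = _ from W.t_add y c, Pi.add_apply, W.inc_eq_zero hc, add_zero]
  have hdual := fun c hc => W.commute_calculus_of_local (F := W.phasePart {e})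
    (e := e) (c := c) (fun x z y => (onPrimal_commute_onDual _ _ x z).symm) hloc hc
  refine supportedOn_of_commute (fun q hq => ?_) (fun q hq => ?_)
  · rcases q with e' | c
    · have h0 : cup e e' = 0 := by
        by_contra h0
        refine hq (mem_torusBall.2 fun a => ?_)
        have := W.cup_local e e' h0 a
        rw [torusNorm_sub_comm] at this
        omega
      rw [siteX_inl]
      refine commute_calculus (s := 0) (fun j => by
        rw [Pi.zero_apply, sgn_zero, one_smul, (W.onPrimal_commute_H _ _ j).eq])
        (fun y => onPrimal_commute ?_) (fun y => by rw [add_zero])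
      simp [h0]
    · exact (hdual c hq).1
  · rcases q with e' | c
    · rw [siteZ_inl]
      refine commute_calculus (s := 0) (fun j => by
        rw [Pi.zero_apply, sgn_zero, one_smul, (W.onPrimal_commute_H _ _ j).eq])
        (fun y => onPrimal_commute ?_) (fun y => by rw [add_zero])
      rw [dotProduct_zero, dotProduct_zero]
    · exact (hdual c hq).2

theorem isCircuit_V [NeZero L] {T : Type} [Fintype T] [DecidableEq T] (κ : E → T)
    (hκ : ∀ i j : E, pos (Sum.inl i) = pos (Sum.inl j) → κ i = κ j → i = j) :
    IsCircuit pos (2 * (2 * ρ))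
      (Fintype.card ((Fin d → Fin (2 * (2 * ρ) + 1) × Bool) × T) +
        Fintype.card ((Fin d → Fin (2 * (2 * ρ) + 1) × Bool) × T)) W.V := by
  rw [W.V_eq]
  refine IsCircuit.mul ?_ ?_
  · refine isCircuit_of_multiplicative (fun e => pos (Sum.inl e)) κ hκ (2 * ρ)
      (fun S => calculus W.H (W.flipPart S)) ?_ ?_ ?_ ?_
    · have h : W.flipPart ∅ = fun _ => 1 := by
        ext1 y
        simp only [flipPart, Finset.prod_empty, Finset.notMem_empty, if_false, one_smul]
        exact onPrimal_zero
      rw [h]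
      exact W.inv.calculus_one
    · intro S S' hd
      refine Eq.trans ?_ (W.inv.calculus_mul (W.flipPart_commute_H S)).symm
      change calculus W.H _ = calculus W.H _
      congr 1
      ext1 y
      unfold flipPart
      rw [smul_mul_smul_comm, onPrimal_mul, zero_dotProduct, sgn_zero, one_smul, add_zero,
        Finset.prod_union hd]
      congr 2
      ext e
      by_cases h1 : e ∈ S
      · simp [h1, Finset.disjoint_left.1 hd h1]
      · simp [h1]
    · intro e
      exact W.inv.calculus_mem_unitary (W.flipPart_commute_H _)
        fun y => smul_mem_unitary (weyl_mem_unitary _ _) (W.prod_star_mul_prod _ y)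
    · exact W.supportedOn_flipPart
  · refine isCircuit_of_multiplicative (fun e => pos (Sum.inl e)) κ hκ (2 * ρ)
      (fun S => calculus W.H (W.phasePart S)) ?_ ?_ ?_ ?_
    · have h : W.phasePart ∅ = fun _ => 1 := by
        ext1 y
        simp only [phasePart, Finset.sum_empty]
        exact onPrimal_zero
      rw [h]
      exact W.inv.calculus_one
    · intro S S' hd
      refine Eq.trans ?_ (W.inv.calculus_mul fun y j => W.onPrimal_commute_H _ _ j).symm
      change calculus W.H _ = calculus W.H _
      congr 1
      ext1 y
      unfold phasePart
      rw [onPrimal_mul, dotProduct_zero, sgn_zero, one_smul, add_zero]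
      congr 1
      ext e
      exact Finset.sum_union hd
    · intro e
      exact W.inv.calculus_mem_unitary (fun y j => W.onPrimal_commute_H _ _ j)
        fun y => weyl_mem_unitary _ _
    · exact W.supportedOn_phasePart

end LinkingData

end Sectors

/-! ### Tensor products of integer matrices, one factor per direction -/

section TensorProduct

variable {n : ℕ} {α : Type}

/-- The tensor product of the matrices `F i`. -/
def tens (F : Fin n → Matrix α α ℤ) : Matrix (Fin n → α) (Fin n → α) ℤ :=
  Matrix.of fun x y => ∏ i, F i (x i) (y i)

theorem tens_apply (F : Fin n → Matrix α α ℤ) (x y : Fin n → α) :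
    tens F x y = ∏ i, F i (x i) (y i) := rfl

theorem tens_mul [Fintype α] (F G : Fin n → Matrix α α ℤ) :
    tens F * tens G = tens fun i => F i * G i := by
  ext x y
  simp only [Matrix.mul_apply, tens_apply]
  have := Finset.prod_univ_sum (fun _ : Fin n => (Finset.univ : Finset α))
    fun i a => F i (x i) a * G i a (y i)
  rw [Fintype.piFinset_univ] at this
  rw [this]
  exact Finset.sum_congr rfl fun z _ => Finset.prod_mul_distrib.symm

theorem tens_transpose (F : Fin n → Matrix α α ℤ) : (tens F)ᵀ = tens fun i => (F i)ᵀ := rfl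

theorem tens_smul (ε : Fin n → ℤ) (F : Fin n → Matrix α α ℤ) :
    (tens fun i => ε i • F i) = (∏ i, ε i) • tens F := by
  ext x y
  simp [tens_apply, Finset.prod_mul_distrib]

theorem tens_eq_zero {F : Fin n → Matrix α α ℤ} {j : Fin n} (h : F j = 0) : tens F = 0 := by
  ext x y
  rw [tens_apply]
  exact Finset.prod_eq_zero (Finset.mem_univ j) (by rw [h]; rfl)

theorem tens_add_slot {F G K : Fin n → Matrix α α ℤ} (j : Fin n) (hj : K j = F j + G j)
    (hF : ∀ i, i ≠ j → K i = F i) (hG : ∀ i, i ≠ j → K i = G i) :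
    tens K = tens F + tens G := by
  classical
  ext x y
  rw [Matrix.add_apply]
  simp only [tens_apply]
  rw [← Finset.mul_prod_erase _ _ (Finset.mem_univ j), ← Finset.mul_prod_erase _ _ (Finset.mem_univ j),
    ← Finset.mul_prod_erase _ (fun i => G i (x i) (y i)) (Finset.mem_univ j), hj, Matrix.add_apply,
    add_mul]
  congr 2
  · exact Finset.prod_congr rfl fun i hi => by rw [hF i (Finset.ne_of_mem_erase hi)]
  · exact Finset.prod_congr rfl fun i hi => by rw [hG i (Finset.ne_of_mem_erase hi)]

theorem tens_sub_slot {F G K : Fin n → Matrix α α ℤ} (j : Fin n) (hj : K j = F j - G j)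
    (hF : ∀ i, i ≠ j → K i = F i) (hG : ∀ i, i ≠ j → K i = G i) :
    tens K = tens F - tens G := by
  rw [eq_sub_iff_add_eq, ← tens_add_slot (K := F) j (by rw [hj, sub_add_cancel])
    (fun i hi => (hF i hi).symm) fun i hi => (hF i hi).symm.trans (hG i hi)]

theorem tens_neg_slot {F K : Fin n → Matrix α α ℤ} (j : Fin n) (hj : K j = -F j)
    (hF : ∀ i, i ≠ j → K i = F i) : tens K = -tens F := by
  have h : tens (Function.update F j 0) = 0 := tens_eq_zero (Function.update_self j 0 F)
  rw [← zero_sub, ← h]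
  refine tens_sub_slot j (by rw [hj, Function.update_self, zero_sub]) (fun i hi => ?_) hF
  rw [hF i hi, Function.update_of_ne hi]

/-- A telescoping sum that replaces the factors `a i` by `b i`, one by one. -/
theorem sum_tens_telescope (a b : Fin n → Matrix α α ℤ) :
    ∑ m, (tens fun i => if i < m then a i else if i = m then b i - a i else b i) =
      tens b - tens a := by
  let T : ℕ → Matrix (Fin n → α) (Fin n → α) ℤ := fun m =>
    tens fun i => if (i : ℕ) < m then a i else b i
  have h : ∀ m : Fin n, (tens fun i => if i < m then a i else if i = m then b i - a i else b i) =
      T m - T (m + 1) := by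
    intro m
    refine tens_sub_slot m ?_ (fun i hi => ?_) fun i hi => ?_
    · simp
    · simp only [Fin.lt_def, if_neg hi]
    · have hne : (i : ℕ) ≠ m := fun h => hi (Fin.ext h)
      have : ((i : ℕ) < m + 1) ↔ (i : ℕ) < m := by omega
      simp only [Fin.lt_def, if_neg hi, this]
  simp_rw [h]
  rw [Fin.sum_univ_eq_sum_range (fun m => T m - T (m + 1)) n, Finset.sum_range_sub']
  congr 1
  simp [T]

theorem prod_neg_one_lt (j : Fin n) : ∏ i : Fin n, (if i < j then (-1 : ℤ) else 1) = (-1) ^ (j : ℕ) := by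
  rw [Finset.prod_ite, Finset.prod_const_one, mul_one, Finset.prod_const]
  congr 1
  rw [← Fin.card_Iio j]
  congr 1
  ext i
  simp

/-- The Koszul sign collected when the string of `signMat` in the directions below `j` passes a `∪₂`
term: cup factors anticommute with `signMat`, while the edge factors at `p` and `q` commute with it.
-/
theorem prod_string_sign (j : Fin n) (p q : Fin n) :
    ∏ i : Fin n, (if i < j then -1 * (if i = p then (-1 : ℤ) else 1) * (if i = q then -1 else 1)
      else 1) = (-1) ^ (j : ℕ) * (if p < j then -1 else 1) * (if q < j then -1 else 1) := by
  have h : ∀ p : Fin n, ∏ i : Fin n, (if i = p then (if p < j then (-1 : ℤ) else 1) else 1) =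
      if p < j then -1 else 1 := fun p => by rw [Finset.prod_ite_eq' ]; simp
  rw [← prod_neg_one_lt, ← h p, ← h q, ← Finset.prod_mul_distrib, ← Finset.prod_mul_distrib]
  refine Finset.prod_congr rfl fun i _ => ?_
  by_cases hi : i < j
  · by_cases hp : i = p
    · by_cases hq : i = q
      · subst hp; subst hq; simp [hi]
      · subst hp; simp [hi, hq]
    · by_cases hq : i = q
      · subst hq; simp [hi, hp]
      · simp [hi, hp, hq]
  · by_cases hp : i = p
    · by_cases hq : i = q
      · subst hp; subst hq; simp [hi]
      · subst hp; simp [hi, hq]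
    · by_cases hq : i = q
      · subst hq; simp [hi, hp]
      · simp [hi, hp, hq]

end TensorProduct

/-! ### Cochain operations on the circle -/

section Circle

variable (L : ℕ)

/-- The shift of the circle `ℤ/L`. -/
def shiftMat : Matrix (ZMod L) (ZMod L) ℤ := Matrix.of fun x y => if y = x + 1 then 1 else 0

/-- The sign `(-1)^dim` of the cells of the circle: vertices are on the left, edges on the right. -/
def signMat : Matrix (ZMod L ⊕ ZMod L) (ZMod L ⊕ ZMod L) ℤ := Matrix.fromBlocks 1 0 0 (-1)

/-- The coboundary of the circle. -/
def cobMat : Matrix (ZMod L ⊕ ZMod L) (ZMod L ⊕ ZMod L) ℤ :=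
  Matrix.fromBlocks 0 0 (shiftMat L - 1) 0

/-- The cup product pairing of the circle. -/
def cupMat : Matrix (ZMod L ⊕ ZMod L) (ZMod L ⊕ ZMod L) ℤ := Matrix.fromBlocks 0 1 (shiftMat L) 0

/-- The cup product pairing of the circle in the opposite order. -/
def cupMatOp : Matrix (ZMod L ⊕ ZMod L) (ZMod L ⊕ ZMod L) ℤ :=
  Matrix.fromBlocks 0 (shiftMat L)ᵀ 1 0

/-- The `∪₁` pairing of the circle. -/
def edgeMat : Matrix (ZMod L ⊕ ZMod L) (ZMod L ⊕ ZMod L) ℤ := Matrix.fromBlocks 0 0 0 1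

theorem signMat_transpose : (signMat L)ᵀ = signMat L := by
  simp [signMat, Matrix.fromBlocks_transpose]

theorem cupMat_transpose : (cupMat L)ᵀ = cupMatOp L := by
  simp [cupMat, cupMatOp, Matrix.fromBlocks_transpose]

theorem edgeMat_transpose : (edgeMat L)ᵀ = edgeMat L := by
  simp [edgeMat, Matrix.fromBlocks_transpose]

variable [NeZero L]

theorem shiftMat_mul_transpose : shiftMat L * (shiftMat L)ᵀ = 1 := by
  ext x y
  simp [Matrix.mul_apply, shiftMat, Matrix.one_apply, eq_comm]

theorem shiftMat_transpose_mul : (shiftMat L)ᵀ * shiftMat L = 1 :=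
  mul_eq_one_comm.1 (shiftMat_mul_transpose L)

theorem signMat_mul_self : signMat L * signMat L = 1 := by
  simp [signMat, Matrix.fromBlocks_multiply]

theorem cupMat_mul_signMat : cupMat L * signMat L = -(signMat L * cupMat L) := by
  simp [cupMat, signMat, Matrix.fromBlocks_multiply, Matrix.fromBlocks_neg]

theorem cupMatOp_mul_signMat : cupMatOp L * signMat L = -(signMat L * cupMatOp L) := by
  simp [cupMatOp, signMat, Matrix.fromBlocks_multiply, Matrix.fromBlocks_neg]

theorem edgeMat_mul_signMat : edgeMat L * signMat L = -edgeMat L := by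
  simp [edgeMat, signMat, Matrix.fromBlocks_multiply, Matrix.fromBlocks_neg]

theorem signMat_mul_edgeMat : signMat L * edgeMat L = -edgeMat L := by
  simp [edgeMat, signMat, Matrix.fromBlocks_multiply, Matrix.fromBlocks_neg]

theorem cobMat_mul_signMat : cobMat L * signMat L = cobMat L := by
  simp [cobMat, signMat, Matrix.fromBlocks_multiply]

theorem signMat_mul_cobMat : signMat L * cobMat L = -cobMat L := by
  simp [cobMat, signMat, Matrix.fromBlocks_multiply, Matrix.fromBlocks_neg]

theorem cobMat_mul_self : cobMat L * cobMat L = 0 := by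
  simp [cobMat, Matrix.fromBlocks_multiply]

theorem cobMat_transpose_mul_signMat : (cobMat L)ᵀ * signMat L = -(cobMat L)ᵀ := by
  simp [cobMat, signMat, Matrix.fromBlocks_multiply, Matrix.fromBlocks_neg,
    Matrix.fromBlocks_transpose]

theorem cobMat_transpose_mul_cupMat :
    (cobMat L)ᵀ * cupMat L = Matrix.fromBlocks (1 - shiftMat L) 0 0 0 := by
  simp [cobMat, cupMat, Matrix.fromBlocks_multiply, Matrix.fromBlocks_transpose, sub_mul,
    shiftMat_transpose_mul]

theorem cupMat_mul_cobMat :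
    cupMat L * cobMat L = -Matrix.fromBlocks (1 - shiftMat L) 0 0 0 := by
  simp [cobMat, cupMat, Matrix.fromBlocks_multiply, Matrix.fromBlocks_neg]

theorem cobMat_transpose_mul_cupMatOp :
    (cobMat L)ᵀ * cupMatOp L = Matrix.fromBlocks ((shiftMat L)ᵀ - 1) 0 0 0 := by
  simp [cobMat, cupMatOp, Matrix.fromBlocks_multiply, Matrix.fromBlocks_transpose]

theorem cupMatOp_mul_cobMat :
    cupMatOp L * cobMat L = -Matrix.fromBlocks ((shiftMat L)ᵀ - 1) 0 0 0 := by
  simp [cobMat, cupMatOp, Matrix.fromBlocks_multiply, Matrix.fromBlocks_neg, mul_sub,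
    shiftMat_transpose_mul]

theorem signMat_pow_mul_blocks (j : ℕ) (M : Matrix (ZMod L) (ZMod L) ℤ) :
    signMat L ^ j * Matrix.fromBlocks M 0 0 0 = Matrix.fromBlocks M 0 0 0 := by
  induction j with
  | zero => rw [pow_zero, one_mul]
  | succ j ih =>
    rw [pow_succ, Matrix.mul_assoc]
    have : signMat L * Matrix.fromBlocks M 0 0 0 = Matrix.fromBlocks M 0 0 0 := by
      simp [signMat, Matrix.fromBlocks_multiply]
    rw [this, ih]

theorem cobMat_transpose_mul_signMat_pow (j : ℕ) :
    (cobMat L)ᵀ * signMat L ^ j = (-1 : ℤ) ^ j • (cobMat L)ᵀ := by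
  induction j with
  | zero => simp
  | succ j ih =>
    rw [pow_succ, ← Matrix.mul_assoc, ih, Matrix.smul_mul, cobMat_transpose_mul_signMat, pow_succ,
      mul_smul, neg_one_smul]

/-- Leibniz and Stokes on the circle: the cup pairing is closed. Hence a coboundary taken in a
direction carrying a cup factor contributes nothing. -/
theorem cobMat_signMat_cupMat (j : ℕ) :
    (cobMat L)ᵀ * (signMat L ^ j * cupMat L) +
      (-1 : ℤ) ^ j • (signMat L ^ j * cupMat L * cobMat L) = 0 := by
  rw [← Matrix.mul_assoc, cobMat_transpose_mul_signMat_pow, Matrix.smul_mul, ← smul_add,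
    Matrix.mul_assoc, cobMat_transpose_mul_cupMat, cupMat_mul_cobMat, mul_neg,
    signMat_pow_mul_blocks, add_neg_cancel, smul_zero]

theorem cobMat_signMat_cupMatOp (j : ℕ) :
    (cobMat L)ᵀ * (signMat L ^ j * cupMatOp L) +
      (-1 : ℤ) ^ j • (signMat L ^ j * cupMatOp L * cobMat L) = 0 := by
  rw [← Matrix.mul_assoc, cobMat_transpose_mul_signMat_pow, Matrix.smul_mul, ← smul_add,
    Matrix.mul_assoc, cobMat_transpose_mul_cupMatOp, cupMatOp_mul_cobMat, mul_neg,
    signMat_pow_mul_blocks, add_neg_cancel, smul_zero]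

theorem signMat_pow_of_even {j : ℕ} (h : Even j) : signMat L ^ j = 1 := by
  obtain ⟨i, rfl⟩ := h
  rw [← two_mul, pow_mul, pow_two, signMat_mul_self, one_pow]

theorem signMat_pow_of_odd {j : ℕ} (h : Odd j) : signMat L ^ j = signMat L := by
  obtain ⟨i, rfl⟩ := h
  rw [pow_succ, signMat_pow_of_even L (even_two_mul i), one_mul]

/-- The edge pairing is the homotopy between the two orders of the cup product. It is the only
source of nonzero terms in the coboundary of `∪₂`. -/
theorem cobMat_edgeMat (j : ℕ) :
    (cobMat L)ᵀ * edgeMat L + (-1 : ℤ) ^ j • (edgeMat L * cobMat L) =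
      signMat L ^ (j + 1) * (cupMatOp L - cupMat L) := by
  have h1 : (cobMat L)ᵀ * edgeMat L = Matrix.fromBlocks 0 ((shiftMat L)ᵀ - 1) 0 0 := by
    simp [cobMat, edgeMat, Matrix.fromBlocks_multiply, Matrix.fromBlocks_transpose]
  have h2 : edgeMat L * cobMat L = Matrix.fromBlocks 0 0 (shiftMat L - 1) 0 := by
    simp [cobMat, edgeMat, Matrix.fromBlocks_multiply]
  have h3 : cupMatOp L - cupMat L =
      Matrix.fromBlocks 0 ((shiftMat L)ᵀ - 1) (1 - shiftMat L) 0 := by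
    simp [cupMatOp, cupMat, sub_eq_add_neg, Matrix.fromBlocks_neg, Matrix.fromBlocks_add]
  rw [h1, h2, h3]
  rcases Nat.even_or_odd j with h | h
  · rw [signMat_pow_of_odd L h.add_one, h.neg_one_pow, one_smul]
    simp [signMat, Matrix.fromBlocks_multiply, Matrix.fromBlocks_add]
  · rw [signMat_pow_of_even L h.add_one, h.neg_one_pow, one_mul]
    simp [Matrix.fromBlocks_neg, Matrix.fromBlocks_add]

theorem signMat_pow_mul_cupMat_mul_signMat (j : ℕ) :
    signMat L ^ j * cupMat L * signMat L = -(signMat L ^ (j + 1) * cupMat L) := by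
  rw [Matrix.mul_assoc, cupMat_mul_signMat, mul_neg, ← Matrix.mul_assoc, ← pow_succ]

theorem signMat_pow_mul_cupMatOp_mul_signMat (j : ℕ) :
    signMat L ^ j * cupMatOp L * signMat L = -(signMat L ^ (j + 1) * cupMatOp L) := by
  rw [Matrix.mul_assoc, cupMatOp_mul_signMat, mul_neg, ← Matrix.mul_assoc, ← pow_succ]

theorem cupMatOp_mul_signMat_pow (j : ℕ) :
    cupMatOp L * signMat L ^ j = (-1 : ℤ) ^ j • (signMat L ^ j * cupMatOp L) := by
  induction j with
  | zero => simp
  | succ j ih =>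
    rw [pow_succ, ← Matrix.mul_assoc, ih, Matrix.smul_mul, Matrix.mul_assoc, cupMatOp_mul_signMat,
      mul_neg, ← Matrix.mul_assoc, pow_succ, mul_smul, neg_one_smul]

theorem cupMat_mul_signMat_pow (j : ℕ) :
    cupMat L * signMat L ^ j = (-1 : ℤ) ^ j • (signMat L ^ j * cupMat L) := by
  induction j with
  | zero => simp
  | succ j ih =>
    rw [pow_succ, ← Matrix.mul_assoc, ih, Matrix.smul_mul, Matrix.mul_assoc, cupMat_mul_signMat,
      mul_neg, ← Matrix.mul_assoc, pow_succ, mul_smul, neg_one_smul]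

end Circle

/-! ### Integral `∪₁` and `∪₂` on the torus -/

section TorusCochains

variable (L : ℕ) [NeZero L] (n : ℕ)

/-- The component of the coboundary of the torus in the direction `j`. -/
def torusCobAt (j : Fin n) : Matrix (Fin n → ZMod L ⊕ ZMod L) (Fin n → ZMod L ⊕ ZMod L) ℤ :=
  tens fun i => if i < j then signMat L else if i = j then cobMat L else 1

/-- The integral coboundary of the torus. A cell of the torus is a product of cells of circles. -/
def torusCob : Matrix (Fin n → ZMod L ⊕ ZMod L) (Fin n → ZMod L ⊕ ZMod L) ℤ :=
  ∑ j, torusCobAt L n j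

/-- An integral lift of the `∪₁` pairing of the torus. -/
def torusCupOne : Matrix (Fin n → ZMod L ⊕ ZMod L) (Fin n → ZMod L ⊕ ZMod L) ℤ :=
  ∑ m : Fin n, tens fun i => if i < m then signMat L ^ (i + 1 : ℕ) * cupMat L
    else if i = m then edgeMat L else signMat L ^ (i : ℕ) * cupMatOp L

/-- The factors of the term of the `∪₂` pairing with overlap in the directions `p < q`. -/
def cupTwoFactor (p q i : Fin n) : Matrix (ZMod L ⊕ ZMod L) (ZMod L ⊕ ZMod L) ℤ :=
  if i < p then signMat L ^ (i : ℕ) * cupMat L else if i = p then edgeMat L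
    else if i < q then signMat L ^ (i + 1 : ℕ) * cupMatOp L else if i = q then edgeMat L
    else signMat L ^ (i : ℕ) * cupMat L

/-- An integral lift of the `∪₂` pairing of the torus. -/
def torusCupTwo : Matrix (Fin n → ZMod L ⊕ ZMod L) (Fin n → ZMod L ⊕ ZMod L) ℤ :=
  ∑ p : Fin n, ∑ q : Fin n, if p < q then tens (cupTwoFactor L n p q) else 0

variable {n}

theorem torusCobAt_anticomm (j l : Fin n) :
    torusCobAt L n j * torusCobAt L n l + torusCobAt L n l * torusCobAt L n j = 0 := by
  wlog h : j ≤ l generalizing j l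
  · rw [add_comm]
    exact this l j (le_of_not_ge h)
  unfold torusCobAt
  rw [tens_mul, tens_mul]
  rcases h.eq_or_lt with rfl | h
  · rw [tens_eq_zero (j := j) (by simp [cobMat_mul_self]), add_zero]
  · rw [← eq_neg_iff_add_eq_zero]
    refine tens_neg_slot j ?_ fun i hi => ?_
    · simp [h, cobMat_mul_signMat, signMat_mul_cobMat]
    · rcases lt_or_gt_of_ne hi with h1 | h1
      · simp [h1, h1.trans h]
      · simp [h1.not_gt, hi]

/-- Summing the anticommutators over all pairs of directions gives twice the square, and over `ℤ`
the factor `2` cancels. -/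
theorem torusCob_mul_self : torusCob L n * torusCob L n = 0 := by
  have h : torusCob L n * torusCob L n + torusCob L n * torusCob L n = 0 := by
    unfold torusCob
    rw [Finset.sum_mul_sum]
    conv_lhs => rw [← Finset.sum_comm]
    conv_lhs => arg 2; rw [Finset.sum_comm]
    rw [← Finset.sum_add_distrib]
    refine Finset.sum_eq_zero fun j _ => ?_
    rw [← Finset.sum_add_distrib]
    exact Finset.sum_eq_zero fun l _ => by
      rw [add_comm]
      exact torusCobAt_anticomm L _ _
  ext x y
  have := congrFun (congrFun h x) y
  rw [Matrix.add_apply, Matrix.zero_apply] at this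
  rw [Matrix.zero_apply]
  omega

theorem cupTwoFactor_mul_signMat {p q : Fin n} (hpq : p < q) (i : Fin n) :
    cupTwoFactor L n p q i * signMat L =
      (-1 * (if i = p then (-1 : ℤ) else 1) * (if i = q then -1 else 1)) •
        (signMat L * cupTwoFactor L n p q i) := by
  unfold cupTwoFactor
  by_cases h1 : i < p
  · rw [if_pos h1, if_neg h1.ne, if_neg (h1.trans hpq).ne,
      signMat_pow_mul_cupMat_mul_signMat, pow_succ', Matrix.mul_assoc]
    simp
  by_cases h2 : i = p
  · have hq : i ≠ q := h2 ▸ hpq.ne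
    rw [if_neg h1, if_pos h2, if_pos h2, if_neg hq, edgeMat_mul_signMat, signMat_mul_edgeMat]
    simp
  by_cases h3 : i < q
  · rw [if_neg h1, if_neg h2, if_pos h3, if_neg h2, if_neg h3.ne,
      signMat_pow_mul_cupMatOp_mul_signMat, pow_succ' _ (i + 1 : ℕ), Matrix.mul_assoc]
    simp
  by_cases h4 : i = q
  · rw [if_neg h1, if_neg h2, if_neg h3, if_pos h4, if_neg h2, if_pos h4, edgeMat_mul_signMat,
      signMat_mul_edgeMat]
    simp
  · rw [if_neg h1, if_neg h2, if_neg h3, if_neg h4, if_neg h2, if_neg h4,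
      signMat_pow_mul_cupMat_mul_signMat, pow_succ', Matrix.mul_assoc]
    simp

/-- The coboundary in the direction `j` of a term of the `∪₂` pairing. -/
theorem cob_cupTwo_slot {p q : Fin n} (hpq : p < q) (j : Fin n) :
    (torusCobAt L n j)ᵀ * tens (cupTwoFactor L n p q) +
        tens (cupTwoFactor L n p q) * torusCobAt L n j =
      tens fun i => if i < j then signMat L * cupTwoFactor L n p q i else if i = j then
        (cobMat L)ᵀ * cupTwoFactor L n p q i +
          ((-1) ^ (j : ℕ) * (if p < j then (-1 : ℤ) else 1) * (if q < j then -1 else 1)) •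
            (cupTwoFactor L n p q i * cobMat L) else cupTwoFactor L n p q i := by
  symm
  unfold torusCobAt
  rw [tens_transpose, tens_mul, tens_mul]
  have h : (tens fun i => cupTwoFactor L n p q i *
      (if i < j then signMat L else if i = j then cobMat L else 1)) =
      tens fun i => if i < j then signMat L * cupTwoFactor L n p q i else if i = j then
        ((-1) ^ (j : ℕ) * (if p < j then (-1 : ℤ) else 1) * (if q < j then -1 else 1)) •
          (cupTwoFactor L n p q i * cobMat L) else cupTwoFactor L n p q i := by
    have h1 : (fun i => cupTwoFactor L n p q i *
        (if i < j then signMat L else if i = j then cobMat L else 1)) = fun i =>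
        (if i < j then -1 * (if i = p then (-1 : ℤ) else 1) * (if i = q then -1 else 1) else 1) •
        (if i < j then signMat L * cupTwoFactor L n p q i else if i = j then
          cupTwoFactor L n p q i * cobMat L else cupTwoFactor L n p q i) := by
      ext1 i
      by_cases hi : i < j
      · rw [if_pos hi, if_pos hi, if_pos hi, cupTwoFactor_mul_signMat L hpq]
      · rw [if_neg hi, if_neg hi, if_neg hi, one_smul]
        by_cases hj : i = j
        · rw [if_pos hj, if_pos hj]
        · rw [if_neg hj, if_neg hj, mul_one]
    have h2 : (fun i => if i < j then signMat L * cupTwoFactor L n p q i else if i = j then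
        ((-1) ^ (j : ℕ) * (if p < j then (-1 : ℤ) else 1) * (if q < j then -1 else 1)) •
          (cupTwoFactor L n p q i * cobMat L) else cupTwoFactor L n p q i) = fun i =>
        (if i = j then (-1) ^ (j : ℕ) * (if p < j then (-1 : ℤ) else 1) * (if q < j then -1 else 1)
          else 1) • (if i < j then signMat L * cupTwoFactor L n p q i else if i = j then
          cupTwoFactor L n p q i * cobMat L else cupTwoFactor L n p q i) := by
      ext1 i
      by_cases hi : i < j
      · rw [if_pos hi, if_pos hi, if_neg hi.ne, one_smul]
      · rw [if_neg hi, if_neg hi]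
        by_cases hj : i = j
        · rw [if_pos hj, if_pos hj, if_pos hj]
        · rw [if_neg hj, if_neg hj, if_neg hj, one_smul]
    rw [h1, h2, tens_smul, tens_smul, prod_string_sign, Finset.prod_ite_eq', if_pos (Finset.mem_univ j)]
  rw [h]
  refine tens_add_slot j ?_ (fun i hi => ?_) fun i hi => ?_
  · simp
  · by_cases h1 : i < j
    · simp [h1, signMat_transpose]
    · simp [h1, hi]
  · simp [hi]

/-- The Leibniz rule for the `∪₂` pairing: its coboundary is the antisymmetrization of `∪₁`. -/
theorem cob_cupTwo :
    (torusCob L n)ᵀ * torusCupTwo L n + torusCupTwo L n * torusCob L n =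
      (∑ m : Fin n, tens fun i => if i < m then signMat L ^ (i + 1 : ℕ) * cupMatOp L
        else if i = m then edgeMat L else signMat L ^ (i : ℕ) * cupMat L) - torusCupOne L n := by
  -- the factors of the intermediate terms
  let a : Fin n → Fin n → Matrix (ZMod L ⊕ ZMod L) (ZMod L ⊕ ZMod L) ℤ := fun m i =>
    if i < m then signMat L ^ (i + 1 : ℕ) * cupMat L else if i = m then edgeMat L
      else signMat L ^ (i : ℕ) * cupMat L
  let b : Fin n → Fin n → Matrix (ZMod L ⊕ ZMod L) (ZMod L ⊕ ZMod L) ℤ := fun m i =>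
    if i < m then signMat L ^ (i + 1 : ℕ) * cupMatOp L else if i = m then edgeMat L
      else signMat L ^ (i : ℕ) * cupMat L
  let b' : Fin n → Fin n → Matrix (ZMod L ⊕ ZMod L) (ZMod L ⊕ ZMod L) ℤ := fun m i =>
    if i < m then signMat L ^ (i + 1 : ℕ) * cupMat L else if i = m then edgeMat L
      else signMat L ^ (i : ℕ) * cupMatOp L
  -- `T q p` and `T' p q` are the contributions of the directions `p` and `q` to the coboundary of
  -- the term `(p, q)`. The sum of `T q p` over `p` telescopes from `a q` to `b q`, that of `T' p q`
  -- over `q` from `b' p` to `a p`. The `a` terms then cancel. Terms with `¬ p < q` may be added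
  -- freely, since the strings agree in that slot.
  let T : Fin n → Fin n → Matrix (Fin n → ZMod L ⊕ ZMod L) (Fin n → ZMod L ⊕ ZMod L) ℤ :=
    fun q p => tens fun i => if i < p then a q i else if i = p then b q i - a q i else b q i
  let T' : Fin n → Fin n → Matrix (Fin n → ZMod L ⊕ ZMod L) (Fin n → ZMod L ⊕ ZMod L) ℤ :=
    fun p q => tens fun i => if i < q then b' p i else if i = q then a p i - b' p i else a p i
  have hT : ∀ p q, ¬ p < q → T q p = 0 := by
    intro p q h
    refine tens_eq_zero (j := p) ?_
    simp only [lt_irrefl, if_false, if_true, a, b, h]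
    simp
  have hT' : ∀ p q, ¬ p < q → T' p q = 0 := by
    intro p q h
    refine tens_eq_zero (j := q) ?_
    rcases (not_lt.1 h).eq_or_lt with h1 | h1
    · simp [a, b', h1]
    · simp [a, b', h1]
  have hslot : ∀ p q, p < q → ∑ j, ((torusCobAt L n j)ᵀ * tens (cupTwoFactor L n p q) +
      tens (cupTwoFactor L n p q) * torusCobAt L n j) = T q p + T' p q := by
    intro p q hpq
    rw [Finset.sum_eq_add p q hpq.ne]
    · congr 1
      · rw [cob_cupTwo_slot L hpq]
        simp only [T]
        congr 1
        ext1 i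
        by_cases h1 : i < p
        · simp only [if_pos h1, a, if_pos (h1.trans hpq), cupTwoFactor]
          rw [← Matrix.mul_assoc, ← pow_succ']
        by_cases h2 : i = p
        · subst h2
          simp only [lt_irrefl, if_false, if_true, a, b, if_pos hpq, hpq.not_gt, cupTwoFactor,
            mul_one]
          rw [cobMat_edgeMat, mul_sub]
        · simp only [if_neg h1, if_neg h2, b, cupTwoFactor]
      · rw [cob_cupTwo_slot L hpq]
        simp only [T']
        -- Two signs cancel: `signMat * edgeMat = -edgeMat` in the slot `p`, and the reversed
        -- difference in the slot `q`.
        refine Eq.trans (b := -tens fun i => if i < q then b' p i else if i = q then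
          b' p i - a p i else a p i) ?_ (Eq.symm ?_)
        · refine tens_neg_slot p ?_ fun i hi => ?_
          · simp [hpq, cupTwoFactor, b', signMat_mul_edgeMat]
          · by_cases h1 : i < q
            · by_cases h2 : i < p
              · simp only [if_pos h1, if_pos h2, b', cupTwoFactor]
                rw [← Matrix.mul_assoc, ← pow_succ']
              · simp only [if_pos h1, if_neg h2, if_neg hi, b', cupTwoFactor]
                rw [← Matrix.mul_assoc, ← pow_succ', pow_add, pow_one, pow_succ,
                  Matrix.mul_assoc (signMat L ^ (i : ℕ)), signMat_mul_self, mul_one]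
            · by_cases h2 : i = q
              · subst h2
                simp only [lt_irrefl, if_false, if_true, a, b', if_neg hi, hpq.not_gt, if_pos hpq,
                  cupTwoFactor, mul_one, mul_neg]
                have := cobMat_edgeMat L (i + 1 : ℕ)
                rw [pow_succ, mul_neg, mul_one] at this
                rw [this, ← mul_sub, pow_succ, pow_succ, Matrix.mul_assoc (signMat L ^ (i : ℕ)),
                  signMat_mul_self, mul_one]
              · have h3 : ¬ i < p := fun h => h1 (h.trans hpq)
                simp only [if_neg h1, if_neg h2, if_neg h3, if_neg hi, a, cupTwoFactor]
        · refine tens_neg_slot q ?_ fun i hi => ?_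
          · simp
          · simp only [if_neg hi]
    -- In every direction other than `p` and `q` the factor is a closed cup pairing; the cases are
    -- the position of `j` relative to `p < q`.
    · intro j _ hj
      rw [cob_cupTwo_slot L hpq]
      refine tens_eq_zero (j := j) ?_
      rw [if_neg (lt_irrefl j), if_pos rfl]
      unfold cupTwoFactor
      by_cases h1 : j < p
      · simp only [if_pos h1, h1.not_gt, if_false, (h1.trans hpq).not_gt, mul_one]
        exact cobMat_signMat_cupMat L _
      have h1' : p < j := lt_of_le_of_ne (not_lt.1 h1) (Ne.symm hj.1)
      by_cases h2 : j < q
      · simp only [if_neg h1, if_neg hj.1, if_pos h2, if_pos h1', h2.not_gt, if_false, mul_one]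
        rw [← pow_succ]
        exact cobMat_signMat_cupMatOp L _
      have h2' : q < j := lt_of_le_of_ne (not_lt.1 h2) (Ne.symm hj.2)
      simp only [if_neg h1, if_neg hj.1, if_neg h2, if_neg hj.2, if_pos h1', if_pos h2']
      rw [mul_assoc, mul_neg_one, neg_neg, mul_one]
      exact cobMat_signMat_cupMat L _
    · exact fun h => absurd (Finset.mem_univ _) h
    · exact fun h => absurd (Finset.mem_univ _) h
  have hall : (torusCob L n)ᵀ * torusCupTwo L n + torusCupTwo L n * torusCob L n =
      ∑ p, ∑ q, (T q p + T' p q) := by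
    unfold torusCupTwo
    rw [Finset.mul_sum, Finset.sum_mul, ← Finset.sum_add_distrib]
    refine Finset.sum_congr rfl fun p _ => ?_
    rw [Finset.mul_sum, Finset.sum_mul, ← Finset.sum_add_distrib]
    refine Finset.sum_congr rfl fun q _ => ?_
    by_cases hpq : p < q
    · rw [if_pos hpq, ← hslot p q hpq, Finset.sum_add_distrib]
      unfold torusCob
      rw [Matrix.transpose_sum, Finset.sum_mul, Finset.mul_sum]
    · rw [if_neg hpq, hT p q hpq, hT' p q hpq, mul_zero, zero_mul]
  have h1 : ∀ q, ∑ p, T q p = tens (b q) - tens (a q) := fun q => sum_tens_telescope _ _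
  have h2 : ∀ p, ∑ q, T' p q = tens (a p) - tens (b' p) := fun p => sum_tens_telescope _ _
  rw [hall]
  simp_rw [Finset.sum_add_distrib]
  rw [Finset.sum_comm]
  simp_rw [h1, h2]
  rw [Finset.sum_sub_distrib, Finset.sum_sub_distrib, sub_add_sub_cancel]
  rfl

/-- Transposition exchanges the two cup orders, and moving the powers of `signMat` back to the left
costs signs. The extra signs from the slots below `m` cancel the one missing at `m`, which leaves
`(-1) ^ ∑ i`. This is where dimension `1` mod `4` matters. -/
theorem torusCupOne_transpose (hn : Even (∑ i : Fin n, (i : ℕ))) :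
    (torusCupOne L n)ᵀ = ∑ m : Fin n, tens fun i =>
      if i < m then signMat L ^ (i + 1 : ℕ) * cupMatOp L
        else if i = m then edgeMat L else signMat L ^ (i : ℕ) * cupMat L := by
  unfold torusCupOne
  rw [Matrix.transpose_sum]
  refine Finset.sum_congr rfl fun m _ => ?_
  rw [tens_transpose]
  have h : (fun i : Fin n => (if i < m then signMat L ^ (i + 1 : ℕ) * cupMat L
      else if i = m then edgeMat L else signMat L ^ (i : ℕ) * cupMatOp L)ᵀ) = fun i : Fin n =>
      ((-1 : ℤ) ^ (i : ℕ) * (if i < m then -1 else 1) * (if i = m then (-1) ^ (m : ℕ) else 1)) •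
      (if i < m then signMat L ^ (i + 1 : ℕ) * cupMatOp L
        else if i = m then edgeMat L else signMat L ^ (i : ℕ) * cupMat L) := by
    ext1 i
    have hop : (cupMatOp L)ᵀ = cupMat L := by rw [← cupMat_transpose, Matrix.transpose_transpose]
    by_cases h1 : i < m
    · rw [if_pos h1, if_pos h1, if_neg h1.ne, if_pos h1, Matrix.transpose_mul,
        Matrix.transpose_pow, signMat_transpose, cupMat_transpose, cupMatOp_mul_signMat_pow,
        pow_succ, mul_one]
    by_cases h2 : i = m
    · subst h2
      rw [if_neg h1, if_pos rfl, if_neg h1, if_pos rfl, if_neg h1, if_pos rfl, edgeMat_transpose,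
        mul_one, ← mul_pow, neg_one_mul, neg_neg, one_pow, one_smul]
    · rw [if_neg h1, if_neg h2, if_neg h1, if_neg h2, if_neg h1, if_neg h2, Matrix.transpose_mul,
        Matrix.transpose_pow, signMat_transpose, hop, cupMat_mul_signMat_pow, mul_one, mul_one]
  rw [h, tens_smul, Finset.prod_mul_distrib, Finset.prod_mul_distrib, prod_neg_one_lt,
    Finset.prod_ite_eq', if_pos (Finset.mem_univ m), Finset.prod_pow_eq_pow_sum, hn.neg_one_pow,
    one_mul, ← mul_pow, neg_one_mul, neg_neg, one_pow, one_smul]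

/-- The `∪₁` pairing is symmetric up to the coboundary of the `∪₂` pairing. -/
theorem torusCupOne_symm (hn : Even (∑ i : Fin n, (i : ℕ))) :
    (torusCob L n)ᵀ * torusCupTwo L n + torusCupTwo L n * torusCob L n =
      (torusCupOne L n)ᵀ - torusCupOne L n := by
  rw [cob_cupTwo, torusCupOne_transpose L hn]

end TorusCochains

/-! ### Bilinear forms symmetric up to a coboundary -/

section IntegralForms

variable {F : Type} [Fintype F]

/-- The bilinear form of a matrix. -/
def bil (M : Matrix F F ℤ) (u v : F → ℤ) : ℤ := u ⬝ᵥ (M *ᵥ v)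

theorem bil_add_left (M : Matrix F F ℤ) (u u' v : F → ℤ) :
    bil M (u + u') v = bil M u v + bil M u' v := add_dotProduct _ _ _

theorem bil_add_right (M : Matrix F F ℤ) (u v v' : F → ℤ) :
    bil M u (v + v') = bil M u v + bil M u v' := by
  rw [bil, Matrix.mulVec_add, dotProduct_add]; rfl

theorem bil_smul_left (M : Matrix F F ℤ) (a : ℤ) (u v : F → ℤ) :
    bil M (a • u) v = a * bil M u v := smul_dotProduct _ _ _

theorem bil_smul_right (M : Matrix F F ℤ) (a : ℤ) (u v : F → ℤ) :
    bil M u (a • v) = a * bil M u v := by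
  rw [bil, Matrix.mulVec_smul, dotProduct_smul]; rfl

theorem bil_transpose (M : Matrix F F ℤ) (u v : F → ℤ) : bil Mᵀ u v = bil M v u := by
  rw [bil, Matrix.mulVec_transpose, dotProduct_comm, ← Matrix.dotProduct_mulVec]; rfl

theorem bil_sub (M N : Matrix F F ℤ) (u v : F → ℤ) : bil (M - N) u v = bil M u v - bil N u v := by
  rw [bil, Matrix.sub_mulVec, dotProduct_sub]; rfl

theorem bil_add (M N : Matrix F F ℤ) (u v : F → ℤ) : bil (M + N) u v = bil M u v + bil N u v := by
  rw [bil, Matrix.add_mulVec, dotProduct_add]; rfl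

theorem bil_mul (M N : Matrix F F ℤ) (u v : F → ℤ) : bil (M * N) u v = bil M u (N *ᵥ v) := by
  rw [bil, ← Matrix.mulVec_mulVec]; rfl

theorem bil_transpose_mul (M N : Matrix F F ℤ) (u v : F → ℤ) :
    bil (Mᵀ * N) u v = bil N (M *ᵥ u) v := by
  rw [bil_mul, bil_transpose, bil, bil, dotProduct_comm]

theorem bil_zero_left (M : Matrix F F ℤ) (v : F → ℤ) : bil M 0 v = 0 := zero_dotProduct _

theorem bil_zero_right (M : Matrix F F ℤ) (u : F → ℤ) : bil M u 0 = 0 := by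
  rw [bil, Matrix.mulVec_zero, dotProduct_zero]

theorem bil_eq_sum (M : Matrix F F ℤ) (u v : F → ℤ) :
    bil M u v = ∑ x, ∑ y, u x * (M x y * v y) := by
  simp [bil, dotProduct, Matrix.mulVec, Finset.mul_sum]

theorem bil_eq_sum_of_support {E : Type} [Fintype E] {ι : E → F} (hι : Function.Injective ι)
    (M : Matrix F F ℤ) {u v : F → ℤ} (hu : ∀ x, x ∉ Set.range ι → u x = 0)
    (hv : ∀ x, x ∉ Set.range ι → v x = 0) :
    bil M u v = ∑ e, ∑ e', u (ι e) * (M (ι e) (ι e') * v (ι e')) := by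
  rw [bil_eq_sum]
  symm
  refine Fintype.sum_of_injective ι hι _ _ (fun x hx => ?_) fun e => ?_
  · exact Finset.sum_eq_zero fun y _ => by rw [hu x hx, zero_mul]
  · exact Fintype.sum_of_injective ι hι _ _ (fun x hx => by rw [hv x hx, mul_zero, mul_zero])
      fun e' => rfl

variable {D K P : Matrix F F ℤ} (hK : Dᵀ * P + P * D = Kᵀ - K)
include hK

theorem bil_flip (u v : F → ℤ) :
    bil K v u = bil K u v + bil P (D *ᵥ u) v + bil P u (D *ᵥ v) := by
  have h : bil (Dᵀ * P + P * D) u v = bil (Kᵀ - K) u v := by rw [hK]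
  rw [bil_add, bil_transpose_mul, bil_mul, bil_sub, bil_transpose] at h
  linarith

theorem bil_symm {u v : F → ℤ} (hu : D *ᵥ u = 0) (hv : D *ᵥ v = 0) : bil K u v = bil K v u := by
  rw [bil_flip hK, hu, hv, bil_zero_left, bil_zero_right, add_zero, add_zero]

/-- Modulo `4`, the quadratic form of `K` on closed vectors only depends on the residues mod `2`. -/
theorem bil_reduce {u t h : F → ℤ} (hu : D *ᵥ u = 0) (ht : t = u + (2 : ℤ) • h) :
    bil (K - P * D) t t =
      bil K u u + 4 * (bil K u h + bil K h h - bil P h (D *ᵥ h)) := by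
  -- The mixed terms are `2 K(u, h) + 2 K(h, u)`. The correction `P * D` removes exactly the
  -- difference of `2 K(h, u)` from `2 K(u, h)`, so that they add up to a multiple of `4`.
  have h1 := bil_flip hK u h
  rw [hu, bil_zero_left, add_zero] at h1
  rw [ht]
  simp only [bil_sub, bil_mul, bil_add_left, bil_add_right, bil_smul_left, bil_smul_right,
    hu, bil_zero_right]
  rw [h1]
  ring

end IntegralForms

/-! ### Powers of `i` -/

section Phases

theorem I_zpow_add (m n : ℤ) : Complex.I ^ (m + n) = Complex.I ^ m * Complex.I ^ n :=
  zpow_add₀ Complex.I_ne_zero m n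

theorem I_zpow_four_mul (n : ℤ) : Complex.I ^ (4 * n) = 1 := by
  rw [zpow_mul]
  have h : Complex.I ^ (4 : ℤ) = 1 := by
    rw [show (4 : ℤ) = ((4 : ℕ) : ℤ) from rfl, zpow_natCast, Complex.I_pow_four]
  rw [h, one_zpow]

theorem I_zpow_sum {ι : Type} (s : Finset ι) (f : ι → ℤ) :
    ∏ i ∈ s, Complex.I ^ f i = Complex.I ^ ∑ i ∈ s, f i := by
  classical
  induction s using Finset.induction_on with
  | empty => simp
  | insert i s hi ih => rw [Finset.prod_insert hi, Finset.sum_insert hi, ih, I_zpow_add]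

theorem star_I_zpow_mul (n : ℤ) : star (Complex.I ^ n) * Complex.I ^ n = 1 := by
  rw [star_zpow₀, ← mul_zpow]
  simp

theorem zmodTwo_val_cast (a : ZMod 2) : (((a.val : ℕ) : ℤ) : ZMod 2) = a := by
  rw [Int.cast_natCast, ZMod.natCast_val, ZMod.cast_id]

end Phases

/-! ### Quadratic phases and linking data from integral lifts -/

/-- Integral lifts of the cochain operations: `D` is the coboundary on cells of all dimensions, `K`
the `∪₁` pairing, and `P` the `∪₂` pairing. The maps `ιE` and `ιC` include the cells that carry
qubits, and `hatC`, `hatE` are the Poincaré duality maps. -/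
structure IntegralLift {E C : Type} [Fintype E] [DecidableEq E] [Fintype C] [DecidableEq C]
    {d L : ℕ} (inc : C → E → ZMod 2) (cup : E → E → ZMod 2) (cupD : C → C → ZMod 2)
    (pos : E ⊕ C → Fin d → ZMod L) (F : Type) [Fintype F] [DecidableEq F] where
  D : Matrix F F ℤ
  K : Matrix F F ℤ
  P : Matrix F F ℤ
  D_mul_self : D * D = 0
  symm : Dᵀ * P + P * D = Kᵀ - K
  ιE : E → F
  ιC : C → F
  ιE_inj : Function.Injective ιE
  support : ∀ x c, D x (ιC c) ≠ 0 → x ∈ Set.range ιE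
  alternating : ∀ c x y, D x (ιC c) ≠ 0 → D y (ιC c) ≠ 0 → K x y = 0
  inc_eq : ∀ c e, (D (ιE e) (ιC c) : ZMod 2) = inc c e
  cup_eq : ∀ e e', (K (ιE e) (ιE e') : ZMod 2) = cup e e'
  hatC : C ≃ E
  hatE : E → C
  inc_hat : ∀ c e, inc (hatE e) (hatC c) = inc c e
  cup_hat : ∀ c c', cupD c c' = cup (hatC c) (hatC c')
  inc_local : ∀ c e, inc c e ≠ 0 → ∀ a, torusNorm (pos (Sum.inr c) a - pos (Sum.inl e) a) ≤ 1
  cup_local : ∀ e' e, cup e' e ≠ 0 → ∀ a, torusNorm (pos (Sum.inl e') a - pos (Sum.inl e) a) ≤ 3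
  cupD_local : ∀ c' c, cupD c' c ≠ 0 → ∀ a, torusNorm (pos (Sum.inr c') a - pos (Sum.inr c) a) ≤ 3
  form_local : ∀ e e', (K - P * D) (ιE e) (ιE e') ≠ 0 →
    ∀ a, torusNorm (pos (Sum.inl e') a - pos (Sum.inl e) a) ≤ 2

namespace IntegralLift

variable {E C : Type} [Fintype E] [DecidableEq E] [Fintype C] [DecidableEq C]
  {d L : ℕ} {inc : C → E → ZMod 2} {cup : E → E → ZMod 2} {cupD : C → C → ZMod 2}
  {pos : E ⊕ C → Fin d → ZMod L} {F : Type} [Fintype F] [DecidableEq F]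
  (W : IntegralLift inc cup cupD pos F)

/-- The integral coboundary of an integral cochain. -/
def cob (n : C → ℤ) : F → ℤ := fun x => ∑ c, W.D x (W.ιC c) * n c

theorem D_mulVec_cob (n : C → ℤ) : W.D *ᵥ W.cob n = 0 := by
  ext x
  have h : (W.D *ᵥ W.cob n) x = ∑ c, (W.D * W.D) x (W.ιC c) * n c := by
    simp only [Matrix.mulVec, dotProduct, cob, Matrix.mul_apply, Finset.mul_sum, Finset.sum_mul]
    rw [Finset.sum_comm]
    exact Finset.sum_congr rfl fun c _ => Finset.sum_congr rfl fun y _ => by ring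
  rw [h, W.D_mul_self]
  simp

theorem cob_add (n n' : C → ℤ) : W.cob (n + n') = W.cob n + W.cob n' := by
  ext x
  simp [cob, mul_add, Finset.sum_add_distrib]

theorem cob_zero : W.cob 0 = 0 := by
  ext x
  simp [cob]

theorem cob_single (c : C) (x : F) : W.cob (Pi.single c 1) x = W.D x (W.ιC c) := by
  simp [cob, Pi.single_apply]

theorem cob_eq_zero (n : C → ℤ) {x : F} (hx : x ∉ Set.range W.ιE) : W.cob n x = 0 := by
  refine Finset.sum_eq_zero fun c _ => ?_
  have h : W.D x (W.ιC c) = 0 := by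
    by_contra h
    exact hx (W.support x c h)
  rw [h, zero_mul]

/-- The coboundary mod `2`. -/
theorem cob_cast (n : C → ℤ) (e : E) :
    ((W.cob n (W.ιE e) : ℤ) : ZMod 2) = ∑ c, inc c e * (n c : ZMod 2) := by
  simp [cob, W.inc_eq]

theorem bil_cob_symm (n n' : C → ℤ) :
    bil W.K (W.cob n) (W.cob n') = bil W.K (W.cob n') (W.cob n) :=
  bil_symm W.symm (W.D_mulVec_cob n) (W.D_mulVec_cob n')

/-- Any two cells in the coboundary of `c` have zero pairing, by `alternating`. For `k = 0` this is
unavailable, since an edge pairs with itself. -/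
theorem bil_cob_single (c : C) :
    bil W.K (W.cob (Pi.single c 1)) (W.cob (Pi.single c 1)) = 0 := by
  rw [bil_eq_sum]
  refine Finset.sum_eq_zero fun x _ => Finset.sum_eq_zero fun y _ => ?_
  rw [W.cob_single, W.cob_single]
  by_cases hx : W.D x (W.ιC c) = 0
  · rw [hx, zero_mul]
  by_cases hy : W.D y (W.ιC c) = 0
  · rw [hy, mul_zero, mul_zero]
  rw [W.alternating c x y hx hy, zero_mul, mul_zero]

/-- The refinement property: as an exponent of `i`, the increment is the sign with which the
corresponding Pauli operators multiply. -/
theorem bil_cob_add_single (n : C → ℤ) (c : C) :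
    bil W.K (W.cob (n + Pi.single c 1)) (W.cob (n + Pi.single c 1)) =
      bil W.K (W.cob n) (W.cob n) + 2 * bil W.K (W.cob n) (W.cob (Pi.single c 1)) := by
  rw [W.cob_add, bil_add_left, bil_add_right, bil_add_right, W.bil_cob_single,
    W.bil_cob_symm (Pi.single c 1)]
  ring

theorem bil_cob_cast (n n' : C → ℤ) :
    ((bil W.K (W.cob n) (W.cob n') : ℤ) : ZMod 2) =
      cupMap cup (fun e => (W.cob n (W.ιE e) : ZMod 2)) ⬝ᵥ
        fun e => (W.cob n' (W.ιE e) : ZMod 2) := by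
  rw [bil_eq_sum_of_support W.ιE_inj _ (fun x hx => W.cob_eq_zero n hx)
    fun x hx => W.cob_eq_zero n' hx]
  push_cast
  simp only [W.cup_eq, dotProduct, cupMap, Finset.sum_mul]
  rw [Finset.sum_comm]
  exact Finset.sum_congr rfl fun e _ => Finset.sum_congr rfl fun e' _ => by ring

/-- The lift of a cochain mod `2` with values in `{0, 1}`. -/
def lift (t : E → ZMod 2) : F → ℤ := fun x => ∑ e, if W.ιE e = x then ((t e).val : ℤ) else 0

theorem lift_apply (t : E → ZMod 2) (e : E) : W.lift t (W.ιE e) = (t e).val := by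
  simp [lift, W.ιE_inj.eq_iff]

theorem lift_eq_zero (t : E → ZMod 2) {x : F} (hx : x ∉ Set.range W.ιE) : W.lift t x = 0 :=
  Finset.sum_eq_zero fun e _ => if_neg fun h => hx ⟨e, h⟩

/-- The phase factors of the linking phase. -/
noncomputable def phase (e : E) (t : E → ZMod 2) : ℂ :=
  Complex.I ^ ∑ e', ((t e).val : ℤ) * ((W.K - W.P * W.D) (W.ιE e) (W.ιE e') * ((t e').val : ℤ))

theorem prod_phase (t : E → ZMod 2) :
    ∏ e, W.phase e t = Complex.I ^ bil (W.K - W.P * W.D) (W.lift t) (W.lift t) := by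
  unfold phase
  rw [I_zpow_sum, bil_eq_sum_of_support W.ιE_inj _ (fun x hx => W.lift_eq_zero t hx)
    fun x hx => W.lift_eq_zero t hx]
  simp_rw [W.lift_apply]

/-- On coboundaries, the phase is given by the `∪₁` square of any integral lift. -/
theorem prod_phase_of_cob {t : E → ZMod 2} {n : C → ℤ}
    (h : ∀ e, ((W.cob n (W.ιE e) : ℤ) : ZMod 2) = t e) :
    ∏ e, W.phase e t = Complex.I ^ bil W.K (W.cob n) (W.cob n) := by
  have hx : ∀ x, ∃ m, W.lift t x = W.cob n x + 2 * m := by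
    intro x
    by_cases hx : x ∈ Set.range W.ιE
    · obtain ⟨e, rfl⟩ := hx
      have h2 : ((W.lift t (W.ιE e) - W.cob n (W.ιE e) : ℤ) : ZMod 2) = 0 := by
        rw [Int.cast_sub, h, W.lift_apply, zmodTwo_val_cast, sub_self]
      obtain ⟨m, hm⟩ := (ZMod.intCast_zmod_eq_zero_iff_dvd _ 2).1 h2
      exact ⟨m, by push_cast at hm; linarith⟩
    · exact ⟨0, by rw [W.lift_eq_zero t hx, W.cob_eq_zero n hx]; rfl⟩
  choose m hm using hx
  rw [W.prod_phase, bil_reduce W.symm (W.D_mulVec_cob n) (t := W.lift t) (h := m) (funext hm),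
    I_zpow_add, I_zpow_four_mul, mul_one]

/-- The integral cochain dual to an integral chain mod `2`. -/
def hatLift (s : E → ℤ) : C → ℤ := fun c => ∑ e, if W.hatE e = c then s e else 0

theorem sum_hatLift (s : E → ℤ) (g : C → ZMod 2) :
    ∑ c, g c * (W.hatLift s c : ZMod 2) = ∑ e, g (W.hatE e) * (s e : ZMod 2) := by
  simp only [hatLift, Int.cast_sum, Int.cast_ite, Int.cast_zero, Finset.mul_sum]
  rw [Finset.sum_comm]
  exact Finset.sum_congr rfl fun e _ => by simp

theorem cob_hatLift_cast (s : E → ℤ) (c : C) :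
    ((W.cob (W.hatLift s) (W.ιE (W.hatC c)) : ℤ) : ZMod 2) = ∑ e, inc c e * (s e : ZMod 2) := by
  rw [W.cob_cast, W.sum_hatLift s fun c' => inc c' (W.hatC c)]
  simp_rw [W.inc_hat]

theorem hatLift_add (s s' : E → ℤ) : W.hatLift (s + s') = W.hatLift s + W.hatLift s' := by
  ext c
  simp only [hatLift, Pi.add_apply]
  rw [← Finset.sum_add_distrib]
  exact Finset.sum_congr rfl fun e _ => by split_ifs <;> simp

theorem hatLift_single (e : E) : W.hatLift (Pi.single e 1) = Pi.single (W.hatE e) 1 := by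
  ext c
  simp only [hatLift, Pi.single_apply]
  rw [Finset.sum_eq_single e]
  · simp [eq_comm]
  · intro e' _ he
    simp [he]
  · exact fun h => absurd (Finset.mem_univ e) h

theorem cupMap_hat_dotProduct (x x' : C → ZMod 2) :
    cupMap cupD x ⬝ᵥ x' = cupMap cup (x ∘ W.hatC.symm) ⬝ᵥ (x' ∘ W.hatC.symm) := by
  simp only [dotProduct, cupMap, W.cup_hat, Function.comp]
  rw [← Equiv.sum_comp W.hatC]
  refine Finset.sum_congr rfl fun c _ => ?_
  rw [← Equiv.sum_comp W.hatC]
  simp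

theorem bil_hatLift_cast (s s' : E → ℤ) :
    ((bil W.K (W.cob (W.hatLift s)) (W.cob (W.hatLift s')) : ℤ) : ZMod 2) =
      cupMap cupD (fun c => ∑ e, inc c e * (s e : ZMod 2)) ⬝ᵥ
        fun c => ∑ e, inc c e * (s' e : ZMod 2) := by
  rw [W.bil_cob_cast, W.cupMap_hat_dotProduct]
  have h : ∀ s : E → ℤ, (fun e => ((W.cob (W.hatLift s) (W.ιE e) : ℤ) : ZMod 2)) =
      (fun c => ∑ e, inc c e * (s e : ZMod 2)) ∘ W.hatC.symm := by
    intro s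
    ext e
    obtain ⟨c, rfl⟩ := W.hatC.surjective e
    rw [W.cob_hatLift_cast]
    simp
  rw [h, h]

/-- Duality expresses the commutation signs of the dual flux operators by the same form `K` on
integral coboundaries, so its symmetry and vanishing squares serve both lattices. -/
theorem dualFlux_form (e e' : E) :
    cupMap cupD (fun c => inc c e) ⬝ᵥ (fun c => inc c e') =
      ((bil W.K (W.cob (Pi.single (W.hatE e) 1)) (W.cob (Pi.single (W.hatE e') 1)) : ℤ) :
        ZMod 2) := by
  have h : ∀ e, (fun c => ∑ e', inc c e' * ((Pi.single e 1 : E → ℤ) e' : ZMod 2)) =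
      fun c => inc c e := by
    intro e
    ext c
    simp [Pi.single_apply]
  rw [← W.hatLift_single, ← W.hatLift_single, W.bil_hatLift_cast, h, h]

theorem dualFlux_involutions (W : IntegralLift inc cup cupD pos F) : CommutingInvolutions (dualFlux inc cupD) where
  comm e e' := onDual_commute (by rw [W.dualFlux_form, W.dualFlux_form, W.bil_cob_symm])
  sq e := by
    unfold dualFlux
    rw [onDual_mul, W.dualFlux_form, W.bil_cob_single, Int.cast_zero, sgn_zero, one_smul,
      add_self_eq_zero_of_zmodTwo, add_self_eq_zero_of_zmodTwo, onDual_zero]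
  herm e := by
    unfold dualFlux onDual
    rw [weyl_conjTranspose, sumElim_dotProduct_sumElim, zero_dotProduct, zero_add,
      W.dualFlux_form, W.bil_cob_single, Int.cast_zero, sgn_zero, one_smul]

/-- The product of dual flux operators over an integral chain. -/
noncomputable def chainFlux (inc : C → E → ZMod 2) (cupD : C → C → ZMod 2) (q : ℤ) (s : E → ℤ) :
    Op (E ⊕ C) :=
  Complex.I ^ q • onDual (fun c => ∑ e, inc c e * (s e : ZMod 2))
    (cupMap cupD fun c => ∑ e, inc c e * (s e : ZMod 2))

/-- The exponent grows by `2 K(s, e)`, and that power of `i` is the sign from `onDual_mul`. With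
this normalization `chainFlux` is an honest product of dual flux operators. -/
theorem chainFlux_add (s : E → ℤ) (e : E) :
    chainFlux inc cupD (bil W.K (W.cob (W.hatLift (s + Pi.single e 1)))
        (W.cob (W.hatLift (s + Pi.single e 1)))) (s + Pi.single e 1) =
      chainFlux inc cupD (bil W.K (W.cob (W.hatLift s)) (W.cob (W.hatLift s))) s *
        dualFlux inc cupD e := by
  have h1 : (fun c => ∑ e', inc c e' * ((s + Pi.single e 1 : E → ℤ) e' : ZMod 2)) =
      (fun c => ∑ e', inc c e' * (s e' : ZMod 2)) + fun c => inc c e := by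
    ext c
    simp [mul_add, Finset.sum_add_distrib, Pi.single_apply]
  have h2 : (fun c => ∑ e', inc c e' * ((Pi.single e 1 : E → ℤ) e' : ZMod 2)) =
      fun c => inc c e := by
    ext c
    simp [Pi.single_apply]
  have h3 := W.bil_hatLift_cast s (Pi.single e 1)
  rw [h2, W.hatLift_single] at h3
  unfold chainFlux dualFlux
  rw [h1, W.hatLift_add, W.hatLift_single, W.bil_cob_add_single, Matrix.smul_mul, onDual_mul, ← h3,
    sgn_intCast, I_zpow_add, mul_smul, cupMap_add]

theorem prod_dualFlux (s : E → ZMod 2) (l : List E) :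
    (l.map fun e => opPow (dualFlux inc cupD e) (s e)).prod =
      chainFlux inc cupD (bil W.K
        (W.cob (W.hatLift (l.map fun e => (Pi.single e ((s e).val : ℤ) : E → ℤ)).sum))
        (W.cob (W.hatLift (l.map fun e => (Pi.single e ((s e).val : ℤ) : E → ℤ)).sum)))
        (l.map fun e => (Pi.single e ((s e).val : ℤ) : E → ℤ)).sum := by
  have key : ∀ (l : List E) (v : E → ℤ),
      chainFlux inc cupD (bil W.K (W.cob (W.hatLift v)) (W.cob (W.hatLift v))) v *
        (l.map fun e => opPow (dualFlux inc cupD e) (s e)).prod =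
      chainFlux inc cupD (bil W.K
        (W.cob (W.hatLift (v + (l.map fun e => (Pi.single e ((s e).val : ℤ) : E → ℤ)).sum)))
        (W.cob (W.hatLift (v + (l.map fun e => (Pi.single e ((s e).val : ℤ) : E → ℤ)).sum))))
        (v + (l.map fun e => (Pi.single e ((s e).val : ℤ) : E → ℤ)).sum) := by
    intro l
    induction l with
    | nil => intro v; simp
    | cons e l ih =>
      intro v
      have h01 : s e = 0 ∨ s e = 1 := by
        generalize s e = a; revert a; decide
      simp only [List.map_cons, List.sum_cons, List.prod_cons]
      rcases h01 with h | h
      · rw [h, opPow_zero, one_mul, ZMod.val_zero, Nat.cast_zero, Pi.single_zero, zero_add, ih]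
      · rw [h, opPow_one, ← mul_assoc, ← W.chainFlux_add, ih, ← add_assoc, ZMod.val_one,
          Nat.cast_one]
  have h := key l 0
  have h0 : W.hatLift 0 = 0 := by
    ext c
    simp [hatLift]
  have h1 : chainFlux inc cupD (bil W.K (W.cob (W.hatLift 0)) (W.cob (W.hatLift 0))) 0 =
      (1 : Op (E ⊕ C)) := by
    have hz : (fun c : C => ∑ e, inc c e * (((0 : E → ℤ) e : ℤ) : ZMod 2)) = 0 := by
      ext c
      simp
    rw [h0, W.cob_zero, bil_zero_left, chainFlux, zpow_zero, one_smul, hz, cupMap_zero, onDual_zero]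
  rwa [h1, one_mul, zero_add] at h

/-- The product of the dual flux operators over a cycle is `1`. -/
theorem prod_dualFlux_eq_one (W : IntegralLift inc cup cupD pos F) {s : E → ZMod 2}
    (hs : ∀ c, ∑ e, inc c e * s e = 0) :
    (Finset.univ.toList.map fun e => opPow (dualFlux inc cupD e) (s e)).prod = 1 := by
  rw [W.prod_dualFlux, Finset.sum_map_toList]
  have hv : ∑ e, (Pi.single e ((s e).val : ℤ) : E → ℤ) = fun e => ((s e).val : ℤ) :=
    Finset.univ_sum_single _
  rw [hv]
  -- For a cycle mod `2`, the integral coboundary of the dual cochain is even, so its `K` square is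
  -- a multiple of `4` and the phase disappears.
  have hx : ∀ x, ∃ m, W.cob (W.hatLift fun e => ((s e).val : ℤ)) x = 2 * m := by
    intro x
    by_cases hx : x ∈ Set.range W.ιE
    · obtain ⟨e, rfl⟩ := hx
      obtain ⟨c, rfl⟩ := W.hatC.surjective e
      have h2 := W.cob_hatLift_cast (fun e => ((s e).val : ℤ)) c
      simp_rw [zmodTwo_val_cast] at h2
      rw [hs c] at h2
      obtain ⟨m, hm⟩ := (ZMod.intCast_zmod_eq_zero_iff_dvd _ 2).1 h2
      exact ⟨m, by push_cast at hm; linarith⟩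
    · exact ⟨0, by rw [W.cob_eq_zero _ hx]; rfl⟩
  choose m hm using hx
  have hm' : W.cob (W.hatLift fun e => ((s e).val : ℤ)) = (2 : ℤ) • m := funext hm
  have hz : (fun c : C => ∑ e, inc c e * (((s e).val : ℤ) : ZMod 2)) = 0 := by
    ext c
    simp_rw [zmodTwo_val_cast]
    exact hs c
  rw [hm', bil_smul_left, bil_smul_right, ← mul_assoc, show (2 * 2 : ℤ) = 4 from rfl, chainFlux,
    I_zpow_four_mul, one_smul, hz, cupMap_zero, onDual_zero]

/-- Only coboundaries occur as fluxes. -/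
theorem jointProj_eq_zero (W : IntegralLift inc cup cupD pos F) {y : E → ZMod 2}
    (hy : ¬ ∃ b : C → ZMod 2, ∀ e, y e = ∑ c, inc c e * b c) :
    jointProj (dualFlux inc cupD) y = 0 := by
  let A : (C → ZMod 2) →ₗ[ZMod 2] (E → ZMod 2) := Matrix.mulVecLin (Matrix.of fun e c => inc c e)
  have hA : y ∉ LinearMap.range A := by
    rintro ⟨b, hb⟩
    exact hy ⟨b, fun e => (congrFun hb e).symm⟩
  -- A functional separating `y` from the coboundaries has a cycle as its coefficient vector. The
  -- product of dual fluxes over that cycle is `1`, but on the sector `y` it equals `(-1)^(f y) =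
  -- -1`; hence the projector is its own negative.
  obtain ⟨f, hf, hle⟩ := Submodule.exists_le_ker_of_notMem hA
  have hfe : ∀ v, f v = ∑ e, f (Pi.single e 1) * v e := by
    intro v
    conv_lhs => rw [← Finset.univ_sum_single v, map_sum]
    refine Finset.sum_congr rfl fun e _ => ?_
    rw [show (Pi.single e (v e) : E → ZMod 2) = v e • Pi.single e 1 by
      rw [← Pi.single_smul, smul_eq_mul, mul_one], map_smul, smul_eq_mul, mul_comm]
  have hs : ∀ c, ∑ e, inc c e * f (Pi.single e 1) = 0 := by
    intro c
    have h : f (A (Pi.single c 1)) = 0 := hle ⟨_, rfl⟩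
    rw [hfe] at h
    rw [← h]
    refine Finset.sum_congr rfl fun e _ => ?_
    rw [show A (Pi.single c 1) e = inc c e by simp [A], mul_comm]
  have hc : ∀ e, jointProj (dualFlux inc cupD) y * dualFlux inc cupD e =
      sgn (y e) • jointProj (dualFlux inc cupD) y := by
    intro e
    rw [← W.dualFlux_involutions.mul_jointProj_self,
      (commute_jointProj (fun j => W.dualFlux_involutions.comm e j) y).eq]
  have h := mul_list_opPow hc (fun e => f (Pi.single e 1)) Finset.univ.toList
  have h01 : f y = 1 := by
    revert hf; generalize f y = a; revert a; decide
  rw [W.prod_dualFlux_eq_one hs, mul_one, Finset.sum_map_toList, ← hfe, h01, sgn_one,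
    neg_one_smul] at h
  ext u v
  have huv := congrFun (congrFun h u) v
  rw [Matrix.neg_apply] at huv
  exact self_eq_neg.1 huv

/-- The linking data of the lattice. -/
noncomputable def linkingData : LinkingData inc cup cupD pos E 3 where
  inc_local c e h a := (W.inc_local c e h a).trans (by norm_num)
  cup_local := W.cup_local
  cupD_local := W.cupD_local
  lam _ := 1
  hx e c := inc c e
  hz e := cupMap cupD fun c => inc c e
  inv := by
    simp only [one_smul]
    exact W.dualFlux_involutions
  hz_eq e c := Finset.sum_congr rfl fun c' _ => mul_comm _ _
  t y := y
  flux y e := by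
    simp only [one_smul]
    have h := W.dualFlux_involutions.mul_jointProj_self e y
    rw [(commute_jointProj (fun j => W.dualFlux_involutions.comm e j) y).eq] at h
    exact h
  t_add y c := rfl
  φ := W.phase
  φ_unit e y := star_I_zpow_mul _
  -- The range `3` is `2 + 1`: the form connects `e` to cells within `2`, and incidence adds `1`.
  φ_local e c y h := by
    have hne : ∀ e', (∀ a, torusNorm (pos (Sum.inl e') a - pos (Sum.inl e) a) ≤ 2) →
        inc c e' = 0 := by
      intro e' he
      by_contra h0
      refine h fun a => ?_
      have := torusNorm_sub_le (pos (Sum.inr c) a) (pos (Sum.inl e') a) (pos (Sum.inl e) a)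
      have h1 := W.inc_local c e' h0 a
      have h2 := he a
      omega
    have he : inc c e = 0 := hne e fun a => by rw [sub_self, torusNorm_zero]; omega
    unfold phase
    congr 1
    refine Finset.sum_congr rfl fun e' _ => ?_
    by_cases h0 : (W.K - W.P * W.D) (W.ιE e) (W.ιE e') = 0
    · rw [h0, zero_mul, zero_mul, mul_zero, mul_zero]
    · rw [Pi.add_apply, Pi.add_apply, he, hne e' (W.form_local e e' h0), add_zero, add_zero]
  sector y := ∃ b : C → ZMod 2, ∀ e, y e = ∑ c, inc c e * b c
  sector_add := by
    rintro y c ⟨b, hb⟩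
    refine ⟨b + Pi.single c 1, fun e => ?_⟩
    simp [hb, mul_add, Finset.sum_add_distrib, Pi.single_apply]
  proj_eq_zero y hy := by
    simp only [one_smul]
    exact W.jointProj_eq_zero hy
  phase_add := by
    -- Both phases are evaluated on integral coboundaries, those of `b` and of `b` plus the cell
    -- `c`. Their squares differ by twice the pairing of `db` with `dc`, which matches the sign in
    -- the product with `G_c`.
    rintro y c ⟨b, hb⟩
    have h1 : ∀ e, ((W.cob (fun c => ((b c).val : ℤ)) (W.ιE e) : ℤ) : ZMod 2) = y e := by
      intro e
      rw [W.cob_cast, hb]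
      simp_rw [zmodTwo_val_cast]
    have h2 : ∀ e, ((W.cob (Pi.single c 1) (W.ιE e) : ℤ) : ZMod 2) = inc c e := by
      intro e
      rw [W.cob_single, W.inc_eq]
    have h3 : ∀ e, ((W.cob ((fun c => ((b c).val : ℤ)) + Pi.single c 1) (W.ιE e) : ℤ) : ZMod 2) =
        (y + inc c) e := by
      intro e
      rw [W.cob_add, Pi.add_apply, Int.cast_add, h1, h2, Pi.add_apply]
    have h4 := W.bil_cob_cast (fun c => ((b c).val : ℤ)) (Pi.single c 1)
    rw [show (fun e => ((W.cob (fun c => ((b c).val : ℤ)) (W.ιE e) : ℤ) : ZMod 2)) = y from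
      funext h1, show (fun e => ((W.cob (Pi.single c 1) (W.ιE e) : ℤ) : ZMod 2)) = inc c from
      funext h2] at h4
    rw [W.prod_phase_of_cob h1, show (y + fun j => inc c j) = y + inc c from rfl,
      W.prod_phase_of_cob h3, W.bil_cob_add_single, primalFlux, onPrimal_mul, I_zpow_add,
      ← sgn_intCast, h4, smul_smul, cupMap_add]
  phase_zero y _ hy := by
    refine Finset.prod_eq_one fun e _ => ?_
    subst hy
    simp [phase]

end IntegralLift

/-! ### Entries of the circle matrices -/

section CircleEntries

variable {L : ℕ}

/-- The coordinate of a cell of the circle. -/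
def circleBase (a : ZMod L ⊕ ZMod L) : ZMod L := Sum.elim id id a

theorem signMat_pow_mul_apply [NeZero L] (j : ℕ) (M : Matrix (ZMod L ⊕ ZMod L) (ZMod L ⊕ ZMod L) ℤ)
    (a b : ZMod L ⊕ ZMod L) :
    (signMat L ^ j * M) a b = Sum.elim (fun _ => (1 : ℤ)) (fun _ => (-1) ^ j) a * M a b := by
  have h : signMat L = Matrix.diagonal (Sum.elim (fun _ => 1) fun _ => -1) := by
    ext a b
    rcases a with a | a <;> rcases b with b | b <;>
      simp [signMat, Matrix.diagonal_apply, Matrix.one_apply, apply_ite Neg.neg]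
  rw [h, Matrix.diagonal_pow, Matrix.diagonal_mul]
  rcases a with a | a <;> simp

theorem signMat_pow_mul_cast [NeZero L] (j : ℕ) (M : Matrix (ZMod L ⊕ ZMod L) (ZMod L ⊕ ZMod L) ℤ)
    (a b : ZMod L ⊕ ZMod L) :
    (((signMat L ^ j * M) a b : ℤ) : ZMod 2) = (M a b : ZMod 2) := by
  rw [signMat_pow_mul_apply]
  rcases a with a | a <;> simp [show (-1 : ZMod 2) = 1 from rfl]

theorem of_signMat_pow_mul_ne_zero [NeZero L] {j : ℕ}
    {M : Matrix (ZMod L ⊕ ZMod L) (ZMod L ⊕ ZMod L) ℤ} {a b : ZMod L ⊕ ZMod L}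
    (h : (signMat L ^ j * M) a b ≠ 0) : M a b ≠ 0 := by
  rw [signMat_pow_mul_apply] at h
  exact right_ne_zero_of_mul h

theorem signMat_cast [NeZero L] (a b : ZMod L ⊕ ZMod L) :
    ((signMat L a b : ℤ) : ZMod 2) = if a = b then 1 else 0 := by
  have h := signMat_pow_mul_cast 1 1 a b
  rw [pow_one, mul_one] at h
  rw [h, Matrix.one_apply]
  split_ifs <;> simp

theorem eq_of_signMat_ne_zero [NeZero L] {a b : ZMod L ⊕ ZMod L} (h : signMat L a b ≠ 0) :
    a = b := by
  rw [← mul_one (signMat L), ← pow_one (signMat L)] at h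
  by_contra hab
  exact of_signMat_pow_mul_ne_zero h (Matrix.one_apply_ne hab)

open Classical in
theorem cupMat_apply (a b : ZMod L ⊕ ZMod L) : cupMat L a b =
    if (∃ x, a = Sum.inl x ∧ b = Sum.inr x) ∨ ∃ x, a = Sum.inr x ∧ b = Sum.inl (x + 1)
      then 1 else 0 := by
  rcases a with a | a <;> rcases b with b | b <;>
    simp [cupMat, shiftMat, Matrix.one_apply, eq_comm]

open Classical in
theorem cupMatOp_apply (a b : ZMod L ⊕ ZMod L) : cupMatOp L a b =
    if (∃ x, a = Sum.inr x ∧ b = Sum.inl x) ∨ ∃ x, a = Sum.inl (x + 1) ∧ b = Sum.inr x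
      then 1 else 0 := by
  rcases a with a | a <;> rcases b with b | b <;>
    simp [cupMatOp, shiftMat, Matrix.one_apply, eq_comm]

open Classical in
theorem edgeMat_apply (a b : ZMod L ⊕ ZMod L) : edgeMat L a b =
    if ∃ x, a = Sum.inr x ∧ b = Sum.inr x then 1 else 0 := by
  rcases a with a | a <;> rcases b with b | b <;>
    simp [edgeMat, Matrix.one_apply, eq_comm]

theorem cobMat_inr_inl (x y : ZMod L) : cobMat L (Sum.inr x) (Sum.inl y) =
    (if y = x + 1 then 1 else 0) - if x = y then 1 else 0 := by
  simp [cobMat, shiftMat, Matrix.one_apply]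

theorem of_cobMat_ne_zero [NeZero L] {a b : ZMod L ⊕ ZMod L} (h : cobMat L a b ≠ 0) :
    a.isRight ∧ b.isLeft ∧ torusNorm (circleBase a - circleBase b) ≤ 1 := by
  rcases a with a | a <;> rcases b with b | b
  · exact absurd rfl h
  · exact absurd rfl h
  · refine ⟨rfl, rfl, ?_⟩
    rw [cobMat_inr_inl] at h
    simp only [circleBase, Sum.elim_inl, Sum.elim_inr, id]
    by_cases h1 : b = a + 1
    · rw [h1, torusNorm_sub_comm, add_sub_cancel_left]
      exact torusNorm_one_le
    · by_cases h2 : a = b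
      · rw [h2, sub_self, torusNorm_zero]
        exact zero_le_one
      · rw [if_neg h1, if_neg h2] at h
        exact absurd rfl h
  · exact absurd rfl h

theorem of_cupMat_ne_zero [NeZero L] {a b : ZMod L ⊕ ZMod L} (h : cupMat L a b ≠ 0) :
    (¬ (a.isRight ∧ b.isRight)) ∧ torusNorm (circleBase a - circleBase b) ≤ 1 := by
  rw [cupMat_apply] at h
  simp only [ne_eq, ite_eq_right_iff, one_ne_zero, imp_false, not_not] at h
  rcases h with ⟨x, rfl, rfl⟩ | ⟨x, rfl, rfl⟩
  · simp [circleBase, torusNorm_zero]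
  · simpa [circleBase, torusNorm_neg] using torusNorm_one_le

theorem of_cupMatOp_ne_zero [NeZero L] {a b : ZMod L ⊕ ZMod L} (h : cupMatOp L a b ≠ 0) :
    (¬ (a.isRight ∧ b.isRight)) ∧ torusNorm (circleBase a - circleBase b) ≤ 1 := by
  rw [cupMatOp_apply] at h
  simp only [ne_eq, ite_eq_right_iff, one_ne_zero, imp_false, not_not] at h
  rcases h with ⟨x, rfl, rfl⟩ | ⟨x, rfl, rfl⟩
  · simp [circleBase, torusNorm_zero]
  · simpa [circleBase] using torusNorm_one_le

theorem of_edgeMat_ne_zero {a b : ZMod L ⊕ ZMod L} (h : edgeMat L a b ≠ 0) :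
    torusNorm (circleBase a - circleBase b) ≤ 1 := by
  rw [edgeMat_apply] at h
  simp only [ne_eq, ite_eq_right_iff, one_ne_zero, imp_false, not_not] at h
  obtain ⟨x, rfl, rfl⟩ := h
  simp [circleBase, torusNorm_zero]

end CircleEntries

/-! ### Locality of the torus forms -/

section TorusEntries

variable {L n : ℕ} [NeZero L]

theorem of_torusCob_ne_zero {x y : Fin n → ZMod L ⊕ ZMod L} (h : torusCob L n x y ≠ 0) :
    ∃ j, (∀ i, i ≠ j → x i = y i) ∧ (x j).isRight ∧ (y j).isLeft ∧
      torusNorm (circleBase (x j) - circleBase (y j)) ≤ 1 := by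
  unfold torusCob at h
  rw [Matrix.sum_apply] at h
  obtain ⟨j, -, hj⟩ := Finset.exists_ne_zero_of_sum_ne_zero h
  rw [torusCobAt, tens_apply, Finset.prod_ne_zero_iff] at hj
  refine ⟨j, fun i hi => ?_, ?_⟩
  · have h1 := hj i (Finset.mem_univ i)
    by_cases hlt : i < j
    · rw [if_pos hlt] at h1
      exact eq_of_signMat_ne_zero h1
    · rw [if_neg hlt, if_neg hi] at h1
      by_contra h2
      exact h1 (Matrix.one_apply_ne h2)
  · have h1 := hj j (Finset.mem_univ j)
    rw [if_neg (lt_irrefl j), if_pos rfl] at h1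
    exact of_cobMat_ne_zero h1

theorem torusNorm_le_of_torusCob_ne_zero {x y : Fin n → ZMod L ⊕ ZMod L}
    (h : torusCob L n x y ≠ 0) (i : Fin n) :
    torusNorm (circleBase (x i) - circleBase (y i)) ≤ 1 := by
  obtain ⟨j, h1, -, -, h2⟩ := of_torusCob_ne_zero h
  by_cases hi : i = j
  · rw [hi]; exact h2
  · rw [h1 i hi, sub_self, torusNorm_zero]; exact zero_le_one

theorem of_torusCupOne_ne_zero {x y : Fin n → ZMod L ⊕ ZMod L} (h : torusCupOne L n x y ≠ 0) :
    ∃ m, (∀ i, i ≠ m → ¬ ((x i).isRight ∧ (y i).isRight)) ∧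
      ∀ i, torusNorm (circleBase (x i) - circleBase (y i)) ≤ 1 := by
  unfold torusCupOne at h
  rw [Matrix.sum_apply] at h
  obtain ⟨m, -, hm⟩ := Finset.exists_ne_zero_of_sum_ne_zero h
  rw [tens_apply, Finset.prod_ne_zero_iff] at hm
  have key : ∀ i, (i ≠ m → ¬ ((x i).isRight ∧ (y i).isRight)) ∧
      torusNorm (circleBase (x i) - circleBase (y i)) ≤ 1 := by
    intro i
    have h1 := hm i (Finset.mem_univ i)
    by_cases hlt : i < m
    · rw [if_pos hlt] at h1
      have h2 := of_cupMat_ne_zero (of_signMat_pow_mul_ne_zero h1)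
      exact ⟨fun _ => h2.1, h2.2⟩
    by_cases hi : i = m
    · rw [if_neg hlt, if_pos hi] at h1
      exact ⟨fun h => absurd hi h, of_edgeMat_ne_zero h1⟩
    · rw [if_neg hlt, if_neg hi] at h1
      have h2 := of_cupMatOp_ne_zero (of_signMat_pow_mul_ne_zero h1)
      exact ⟨fun _ => h2.1, h2.2⟩
  exact ⟨m, fun i => (key i).1, fun i => (key i).2⟩

theorem torusNorm_le_of_torusCupTwo_ne_zero {x y : Fin n → ZMod L ⊕ ZMod L}
    (h : torusCupTwo L n x y ≠ 0) (i : Fin n) :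
    torusNorm (circleBase (x i) - circleBase (y i)) ≤ 1 := by
  unfold torusCupTwo at h
  rw [Matrix.sum_apply] at h
  obtain ⟨p, -, hp⟩ := Finset.exists_ne_zero_of_sum_ne_zero h
  rw [Matrix.sum_apply] at hp
  obtain ⟨q, -, hq⟩ := Finset.exists_ne_zero_of_sum_ne_zero hp
  split_ifs at hq
  · rw [tens_apply, Finset.prod_ne_zero_iff] at hq
    have h1 := hq i (Finset.mem_univ i)
    unfold cupTwoFactor at h1
    split_ifs at h1
    · exact (of_cupMat_ne_zero (of_signMat_pow_mul_ne_zero h1)).2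
    · exact of_edgeMat_ne_zero h1
    · exact (of_cupMatOp_ne_zero (of_signMat_pow_mul_ne_zero h1)).2
    · exact of_edgeMat_ne_zero h1
    · exact (of_cupMat_ne_zero (of_signMat_pow_mul_ne_zero h1)).2
  · exact absurd rfl hq

theorem torusNorm_le_of_form_ne_zero {x y : Fin n → ZMod L ⊕ ZMod L}
    (h : (torusCupOne L n - torusCupTwo L n * torusCob L n) x y ≠ 0) (i : Fin n) :
    torusNorm (circleBase (x i) - circleBase (y i)) ≤ 2 := by
  rw [Matrix.sub_apply] at h
  by_cases h1 : torusCupOne L n x y = 0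
  · rw [h1, zero_sub, neg_ne_zero, Matrix.mul_apply] at h
    obtain ⟨z, -, hz⟩ := Finset.exists_ne_zero_of_sum_ne_zero h
    have h2 := torusNorm_le_of_torusCupTwo_ne_zero (left_ne_zero_of_mul hz) i
    have h3 := torusNorm_le_of_torusCob_ne_zero (right_ne_zero_of_mul hz) i
    have h4 := torusNorm_sub_le (circleBase (x i)) (circleBase (z i)) (circleBase (y i))
    omega
  · obtain ⟨m, -, h2⟩ := of_torusCupOne_ne_zero h1
    exact (h2 i).trans (by norm_num)

end TorusEntries

/-! ### Cells as products of cells of circles -/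

section Cells

variable {d L n : ℕ}

/-- A cell of the torus as a product of cells of circles. -/
def cellCoord (c : Cell d L n) : Fin d → ZMod L ⊕ ZMod L :=
  fun i => if i ∈ c.2.1 then Sum.inr (c.1 i) else Sum.inl (c.1 i)

theorem circleBase_cellCoord (c : Cell d L n) (i : Fin d) : circleBase (cellCoord c i) = c.1 i := by
  unfold cellCoord
  split_ifs <;> rfl

theorem isRight_cellCoord (c : Cell d L n) (i : Fin d) : (cellCoord c i).isRight ↔ i ∈ c.2.1 := by
  unfold cellCoord
  split_ifs with h <;> simp [h]

theorem cellCoord_injective : Function.Injective (cellCoord : Cell d L n → _) := by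
  intro c c' h
  refine Prod.ext (funext fun i => ?_) (Subtype.ext (Finset.ext fun i => ?_))
  · rw [← circleBase_cellCoord, h, circleBase_cellCoord]
  · rw [← isRight_cellCoord, h, isRight_cellCoord]

theorem cellCoord_eq_iff {m : ℕ} (c : Cell d L n) (c' : Cell d L m) (i : Fin d) :
    cellCoord c i = cellCoord c' i ↔ c.1 i = c'.1 i ∧ (i ∈ c.2.1 ↔ i ∈ c'.2.1) := by
  unfold cellCoord
  by_cases h : i ∈ c.2.1 <;> by_cases h' : i ∈ c'.2.1 <;> simp [h, h']

theorem mem_range_cellCoord {x : Fin d → ZMod L ⊕ ZMod L}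
    (h : (Finset.univ.filter fun i => (x i).isRight).card = n) :
    x ∈ Set.range (cellCoord : Cell d L n → _) := by
  refine ⟨(fun i => circleBase (x i), ⟨_, h⟩), funext fun i => ?_⟩
  unfold cellCoord
  rcases hx : x i with a | a <;> simp [hx, circleBase]

variable [NeZero L]

theorem mem_range_of_torusCob_ne_zero {x : Fin d → ZMod L ⊕ ZMod L} {c : Cell d L n}
    (h : torusCob L d x (cellCoord c) ≠ 0) : x ∈ Set.range (cellCoord : Cell d L (n + 1) → _) := by
  obtain ⟨j, h1, h2, h3, -⟩ := of_torusCob_ne_zero h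
  have hj : j ∉ c.2.1 := by
    rw [← isRight_cellCoord]
    rcases hc : cellCoord c j with a | a
    · simp
    · rw [hc] at h3; simp at h3
  refine mem_range_cellCoord ?_
  have hx : (Finset.univ.filter fun i => (x i).isRight) = insert j c.2.1 := by
    ext i
    simp only [Finset.mem_filter, Finset.mem_univ, true_and, Finset.mem_insert]
    by_cases hi : i = j
    · simp [hi, h2]
    · rw [h1 i hi, isRight_cellCoord]
      simp [hi]
  rw [hx, Finset.card_insert_of_notMem hj, c.2.2]

theorem subset_of_torusCob_ne_zero {x : Fin d → ZMod L ⊕ ZMod L} {c : Cell d L n}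
    (h : torusCob L d x (cellCoord c) ≠ 0) {i : Fin d} (hi : i ∈ c.2.1) : (x i).isRight := by
  obtain ⟨j, h1, h2, -, -⟩ := of_torusCob_ne_zero h
  by_cases hij : i = j
  · rw [hij]; exact h2
  · rw [h1 i hij, isRight_cellCoord]; exact hi

/-- Mod `2` the factors away from `j` become identities, so they force `e` and `c` to agree in those
directions; the factor at `j` is the incidence of the circle. -/
theorem torusCob_cast (c : Cell d L n) (e : Cell d L (n + 1)) :
    ((torusCob L d (cellCoord e) (cellCoord c) : ℤ) : ZMod 2) = incidence c e := by
  unfold torusCob incidence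
  rw [Matrix.sum_apply, Int.cast_sum]
  refine Finset.sum_congr rfl fun j _ => ?_
  rw [torusCobAt, tens_apply, Int.cast_prod]
  have h1 : ∀ i, i ≠ j → (((if i < j then signMat L else if i = j then cobMat L else 1)
      (cellCoord e i) (cellCoord c i) : ℤ) : ZMod 2) =
      if cellCoord e i = cellCoord c i then 1 else 0 := by
    intro i hi
    by_cases hlt : i < j
    · rw [if_pos hlt, signMat_cast]
    · rw [if_neg hlt, if_neg hi, Matrix.one_apply]
      split_ifs <;> simp
  rw [← Finset.mul_prod_erase _ _ (Finset.mem_univ j),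
    Finset.prod_congr rfl fun i hi => h1 i (Finset.ne_of_mem_erase hi), Finset.prod_ite_zero,
    Finset.prod_const_one, if_neg (lt_irrefl j), if_pos rfl]
  simp only [Finset.mem_erase, Finset.mem_univ, and_true, cellCoord_eq_iff]
  by_cases hc : j ∉ c.2.1 ∧ e.2.1 = insert j c.2.1
  · rw [if_pos hc]
    have hmem : ∀ i, i ≠ j → (i ∈ e.2.1 ↔ i ∈ c.2.1) := by
      intro i hi
      rw [hc.2]
      simp [hi]
    have he : cellCoord e j = Sum.inr (e.1 j) := if_pos (by rw [hc.2]; simp)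
    have hcj : cellCoord c j = Sum.inl (c.1 j) := if_neg hc.1
    rw [he, hcj, cobMat_inr_inl]
    have h2 : (c.1 = e.1) ↔ (e.1 j = c.1 j) ∧ ∀ i, i ≠ j → e.1 i = c.1 i := by
      constructor
      · intro h; rw [h]; exact ⟨rfl, fun _ _ => rfl⟩
      · rintro ⟨h, h'⟩
        ext i
        by_cases hi : i = j
        · rw [hi, h]
        · rw [h' i hi]
    have h3 : (c.1 = e.1 + Pi.single j 1) ↔
        (c.1 j = e.1 j + 1) ∧ ∀ i, i ≠ j → e.1 i = c.1 i := by
      constructor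
      · intro h
        rw [h]
        exact ⟨by simp, fun i hi => by simp [hi]⟩
      · rintro ⟨h, h'⟩
        ext i
        by_cases hi : i = j
        · rw [hi, h]; simp
        · rw [← h' i hi]; simp [hi]
    have h4 : (∀ i, i ≠ j → e.1 i = c.1 i ∧ (i ∈ e.2.1 ↔ i ∈ c.2.1)) ↔
        ∀ i, i ≠ j → e.1 i = c.1 i :=
      ⟨fun h i hi => (h i hi).1, fun h i hi => ⟨h i hi, hmem i hi⟩⟩
    simp only [h2, h3]
    by_cases ha : ∀ i, i ≠ j → e.1 i = c.1 i
    · rw [if_pos (h4.2 ha)]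
      simp only [and_iff_left ha]
      push_cast
      rw [mul_one, sub_eq_add_neg, show ∀ a : ZMod 2, -a = a from by decide, add_comm]
    · rw [if_neg (mt h4.1 ha), if_neg (mt And.right ha), if_neg (mt And.right ha), mul_zero, add_zero]
  · rw [if_neg hc]
    rw [mul_eq_zero]
    by_contra hcon
    push Not at hcon
    obtain ⟨h5, h6⟩ := hcon
    have h7 : cobMat L (cellCoord e j) (cellCoord c j) ≠ 0 := fun h => h5 (by rw [h]; rfl)
    obtain ⟨h8, h9, -⟩ := of_cobMat_ne_zero h7
    have h10 : j ∉ c.2.1 := by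
      intro h
      rw [cellCoord, if_pos h] at h9
      simp at h9
    refine hc ⟨h10, ?_⟩
    have h11 : ∀ i, i ≠ j → e.1 i = c.1 i ∧ (i ∈ e.2.1 ↔ i ∈ c.2.1) := by
      by_contra h
      exact h6 (if_neg h)
    ext i
    by_cases hi : i = j
    · rw [hi, ← isRight_cellCoord]
      simp [h8]
    · rw [(h11 i hi).2]
      simp [hi]

/-- For fixed `m`, the condition defining `cupOne` splits into one condition per direction, since
the base `p` can be chosen coordinate by coordinate. Its indicator is therefore a product over
directions. -/
theorem torusCupOne_cast (c' c : Cell d L n) :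
    ((torusCupOne L d (cellCoord c') (cellCoord c) : ℤ) : ZMod 2) = cupOne c' c := by
  classical
  let Q : Fin d → Prop := fun m => ∃ p : Fin d → ZMod L,
      c'.2.1 ∪ c.2.1 = Finset.univ ∧ c'.2.1 ∩ c.2.1 = {m} ∧
      c'.1 = (p + fun i => if i ∉ c'.2.1 ∧ m < i then 1 else 0) ∧
      c.1 = (p + fun i => if i ∉ c.2.1 ∧ i < m then 1 else 0)
  have hterm : ∀ m, ((tens (fun i => if i < m then signMat L ^ (i + 1 : ℕ) * cupMat L
      else if i = m then edgeMat L else signMat L ^ (i : ℕ) * cupMatOp L)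
      (cellCoord c') (cellCoord c) : ℤ) : ZMod 2) = if Q m then 1 else 0 := by
    intro m
    have hQ : Q m ↔ ∀ i, (i ∈ c'.2.1 ∨ i ∈ c.2.1) ∧ (i ∈ c'.2.1 ∧ i ∈ c.2.1 ↔ i = m) ∧
        ∃ p : ZMod L, c'.1 i = p + (if i ∉ c'.2.1 ∧ m < i then 1 else 0) ∧
          c.1 i = p + if i ∉ c.2.1 ∧ i < m then 1 else 0 := by
      constructor
      · rintro ⟨p, h1, h2, h3, h4⟩ i
        refine ⟨?_, ?_, p i, congrFun h3 i, congrFun h4 i⟩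
        · rw [← Finset.mem_union, h1]; exact Finset.mem_univ i
        · rw [← Finset.mem_inter, h2, Finset.mem_singleton]
      · intro h
        choose h1 h2 p h3 h4 using h
        refine ⟨p, ?_, ?_, funext h3, funext h4⟩
        · ext i; simpa using h1 i
        · ext i; simpa using h2 i
    have hfac : ∀ i, (((if i < m then signMat L ^ (i + 1 : ℕ) * cupMat L
        else if i = m then edgeMat L else signMat L ^ (i : ℕ) * cupMatOp L)
        (cellCoord c' i) (cellCoord c i) : ℤ) : ZMod 2) =
        if (i ∈ c'.2.1 ∨ i ∈ c.2.1) ∧ (i ∈ c'.2.1 ∧ i ∈ c.2.1 ↔ i = m) ∧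
          ∃ p : ZMod L, c'.1 i = p + (if i ∉ c'.2.1 ∧ m < i then 1 else 0) ∧
          c.1 i = p + if i ∉ c.2.1 ∧ i < m then 1 else 0 then 1 else 0 := by
      intro i
      rcases lt_trichotomy i m with h | h | h
      · rw [if_pos h, signMat_pow_mul_cast, cupMat_apply]
        by_cases h1 : i ∈ c'.2.1 <;> by_cases h2 : i ∈ c.2.1 <;>
          simp [cellCoord, h1, h2, h, h.ne, h.not_gt, eq_comm]
      · rw [if_neg h.not_lt, if_pos h, edgeMat_apply]
        by_cases h1 : i ∈ c'.2.1 <;> by_cases h2 : i ∈ c.2.1 <;>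
          simp [cellCoord, h1, h2, h, eq_comm] <;> simp [← h, h1, h2]
      · rw [if_neg h.not_gt, if_neg h.ne', signMat_pow_mul_cast, cupMatOp_apply]
        by_cases h1 : i ∈ c'.2.1 <;> by_cases h2 : i ∈ c.2.1 <;>
          simp [cellCoord, h1, h2, h, h.ne', h.not_gt, eq_comm]
    rw [tens_apply, Int.cast_prod]
    simp_rw [hfac]
    rw [Finset.prod_ite_zero, Finset.prod_const_one]
    simp only [hQ, Finset.mem_univ, true_implies]
  unfold torusCupOne
  rw [Matrix.sum_apply, Int.cast_sum]
  simp_rw [hterm]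
  unfold cupOne
  by_cases h : ∃ m, Q m
  · obtain ⟨m, hm⟩ := h
    -- The direction `m` is determined by the intersection of the direction sets, so at most one
    -- term survives.
    rw [Finset.sum_eq_single m, if_pos hm]
    · exact (if_pos ⟨m, hm⟩).symm
    · intro m' _ hne
      refine if_neg fun hm' => hne ?_
      obtain ⟨p, -, h1, -⟩ := hm
      obtain ⟨p', -, h2, -⟩ := hm'
      exact Finset.singleton_injective (h2.symm.trans h1)
    · exact fun h => absurd (Finset.mem_univ m) h
  · rw [Finset.sum_eq_zero fun m _ => if_neg fun hm => h ⟨m, hm⟩]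
    exact (if_neg h).symm

end Cells

/-! ### Poincaré duality and the lattice for `k ≥ 2` -/

section Duality

variable {k L : ℕ}

/-- The `k`-cell Poincaré dual to a `(k+1)`-cell. -/
def codualCell (e : Cell (2 * k + 1) L (k + 1)) : Cell (2 * k + 1) L k :=
  (fun i => if i ∈ e.2.1 then e.1 i + 1 else e.1 i,
    ⟨e.2.1ᶜ, by rw [Finset.card_compl, e.2.2, Fintype.card_fin]; omega⟩)

/-- Poincaré duality as a bijection. -/
def dualCellEquiv : Cell (2 * k + 1) L k ≃ Cell (2 * k + 1) L (k + 1) where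
  toFun := dualCell
  invFun e := (fun i => if i ∈ e.2.1 then e.1 i else e.1 i - 1,
    ⟨e.2.1ᶜ, by rw [Finset.card_compl, e.2.2, Fintype.card_fin]; omega⟩)
  left_inv c := by
    refine Prod.ext (funext fun i => ?_) (Subtype.ext (compl_compl c.2.1))
    by_cases h : i ∈ c.2.1 <;> simp [dualCell, h]
  right_inv e := by
    refine Prod.ext (funext fun i => ?_) (Subtype.ext (compl_compl e.2.1))
    by_cases h : i ∈ e.2.1 <;> simp [dualCell, h]

/-- Duality exchanges the near and the far face in the direction `j`. The map `codualCell` differs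
from the inverse of `dualCell` by the translation by `(1, …, 1)`, the effect of two half shifts. -/
theorem incidence_codualCell_dualCell (c : Cell (2 * k + 1) L k)
    (e : Cell (2 * k + 1) L (k + 1)) :
    incidence (codualCell e) (dualCell c) = incidence c e := by
  unfold incidence
  refine Finset.sum_congr rfl fun j _ => ?_
  have hcond : (j ∉ (codualCell e).2.1 ∧ (dualCell c).2.1 = insert j (codualCell e).2.1) ↔
      (j ∉ c.2.1 ∧ e.2.1 = insert j c.2.1) := by
    simp only [codualCell, dualCell, Finset.mem_compl, not_not]
    constructor
    · rintro ⟨h1, h2⟩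
      have h3 : ∀ i, i ∉ c.2.1 ↔ i = j ∨ i ∉ e.2.1 := fun i => by
        rw [← Finset.mem_compl, h2]; simp
      refine ⟨(h3 j).2 (Or.inl rfl), ?_⟩
      ext i
      have := h3 i
      by_cases hi : i = j
      · simp [hi, h1]
      · simp only [hi, false_or] at this
        simp [hi, not_iff_not.1 this]
    · rintro ⟨h1, h2⟩
      refine ⟨by rw [h2]; simp, ?_⟩
      rw [h2]
      ext i
      by_cases hi : i = j
      · simp [hi, h1]
      · simp [hi]
  by_cases h : j ∉ c.2.1 ∧ e.2.1 = insert j c.2.1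
  · rw [if_pos (hcond.2 h), if_pos h, add_comm]
    have hmem : ∀ i, i ≠ j → (i ∈ e.2.1 ↔ i ∈ c.2.1) := by
      intro i hi
      rw [h.2]
      simp [hi]
    have hej : j ∈ e.2.1 := by rw [h.2]; simp
    have h1 : ((codualCell e).1 = (dualCell c).1 + Pi.single j 1) ↔ c.1 = e.1 := by
      rw [funext_iff, funext_iff]
      refine forall_congr' fun i => ?_
      simp only [codualCell, dualCell, Pi.add_apply]
      by_cases hi : i = j
      · subst hi
        simp [hej, h.1, eq_comm]
      · by_cases hc : i ∈ c.2.1 <;> simp [hi, hmem i hi, hc, eq_comm]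
    have h2 : ((codualCell e).1 = (dualCell c).1) ↔ c.1 = e.1 + Pi.single j 1 := by
      rw [funext_iff, funext_iff]
      refine forall_congr' fun i => ?_
      simp only [codualCell, dualCell, Pi.add_apply]
      by_cases hi : i = j
      · subst hi
        simp [hej, h.1, eq_comm]
      · by_cases hc : i ∈ c.2.1 <;> simp [hi, hmem i hi, hc, eq_comm]
    simp only [h1, h2]
  · rw [if_neg (mt hcond.1 h), if_neg h]

theorem torusNorm_dualCell_le [NeZero L] (c : Cell (2 * k + 1) L k) (a : Fin (2 * k + 1)) :
    torusNorm ((dualCell c).1 a - c.1 a) ≤ 1 := by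
  simp only [dualCell]
  split_ifs
  · rw [add_sub_cancel_left]; exact torusNorm_one_le
  · rw [sub_self, torusNorm_zero]; exact zero_le_one

/-- The sum is `(2 * k + 1) * k`, which has the parity of `k`. -/
theorem even_sum_fin (hk : Even k) : Even (∑ i : Fin (2 * k + 1), (i : ℕ)) := by
  rw [Fin.sum_univ_eq_sum_range (fun i => i)]
  have h := Finset.sum_range_id_mul_two (2 * k + 1)
  have h2 : ∑ i ∈ Finset.range (2 * k + 1), i = (2 * k + 1) * k := by
    have : (2 * k + 1) * (2 * k + 1 - 1) = (2 * k + 1) * k * 2 := by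
      rw [Nat.add_sub_cancel]; ring
    omega
  rw [h2]
  exact hk.mul_left _

theorem torusNorm_le_of_cupOne_ne_zero [NeZero L] {d n : ℕ} {c' c : Cell d L n}
    (h : cupOne c' c ≠ 0) (a : Fin d) : torusNorm (c'.1 a - c.1 a) ≤ 1 := by
  rw [← torusCupOne_cast] at h
  have h0 : torusCupOne L d (cellCoord c') (cellCoord c) ≠ 0 := fun h0 => h (by rw [h0]; rfl)
  obtain ⟨-, -, h1⟩ := of_torusCupOne_ne_zero h0
  have := h1 a
  rwa [circleBase_cellCoord, circleBase_cellCoord] at this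

theorem torusNorm_le_of_incidence_ne_zero [NeZero L] {d n : ℕ} {c : Cell d L n}
    {e : Cell d L (n + 1)} (h : incidence c e ≠ 0) (a : Fin d) :
    torusNorm (c.1 a - e.1 a) ≤ 1 := by
  rw [← torusCob_cast] at h
  have h0 : torusCob L d (cellCoord e) (cellCoord c) ≠ 0 := fun h0 => h (by rw [h0]; rfl)
  have := torusNorm_le_of_torusCob_ne_zero h0 a
  rwa [circleBase_cellCoord, circleBase_cellCoord, torusNorm_sub_comm] at this

/-- The integral lifts of the cochain operations of the lattice. -/
def walkerWangLift [NeZero L] (hk : Even k) (h2 : 2 ≤ k) :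
    IntegralLift (incidence (d := 2 * k + 1) (L := L) (n := k)) cupOne
      (fun c c' => cupOne (dualCell c) (dualCell c')) Qubit.pos
      (Fin (2 * k + 1) → ZMod L ⊕ ZMod L) where
  D := torusCob L (2 * k + 1)
  K := torusCupOne L (2 * k + 1)
  P := torusCupTwo L (2 * k + 1)
  D_mul_self := torusCob_mul_self L
  symm := torusCupOne_symm L (even_sum_fin hk)
  ιE := cellCoord
  ιC := cellCoord
  ιE_inj := cellCoord_injective
  support x c h := mem_range_of_torusCob_ne_zero h
  alternating c x y hx hy := by
    by_contra h
    obtain ⟨m, hm, -⟩ := of_torusCupOne_ne_zero h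
    -- Both cells extend along all `k ≥ 2` directions of `c`, so they share one other than `m`,
    -- while `∪₁` permits an overlap in `m` only.
    obtain ⟨i, hi, hne⟩ := Finset.exists_mem_ne (show 1 < c.2.1.card by rw [c.2.2]; omega) m
    exact hm i hne ⟨subset_of_torusCob_ne_zero hx hi, subset_of_torusCob_ne_zero hy hi⟩
  inc_eq c e := torusCob_cast c e
  cup_eq e e' := torusCupOne_cast e e'
  hatC := dualCellEquiv
  hatE := codualCell
  inc_hat := incidence_codualCell_dualCell
  cup_hat c c' := rfl
  inc_local c e h a := torusNorm_le_of_incidence_ne_zero h a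
  cup_local e' e h a := (torusNorm_le_of_cupOne_ne_zero h a).trans (by norm_num)
  cupD_local c' c h a := by
    have h1 := torusNorm_le_of_cupOne_ne_zero h a
    have h2 := torusNorm_dualCell_le c' a
    have h3 := torusNorm_dualCell_le c a
    have h4 := torusNorm_sub_le (c'.1 a) ((dualCell c').1 a) (c.1 a)
    have h5 := torusNorm_sub_le ((dualCell c').1 a) ((dualCell c).1 a) (c.1 a)
    rw [torusNorm_sub_comm (c'.1 a) ((dualCell c').1 a)] at h4
    exact (h4.trans (add_le_add h2 (h5.trans (add_le_add h1 h3))))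
  form_local e e' h a := by
    have := torusNorm_le_of_form_ne_zero h a
    rwa [circleBase_cellCoord, circleBase_cellCoord, torusNorm_sub_comm] at this

end Duality

/-! ### The case `k = 0`: labels from Pauli `Y` operators -/

section Chain

variable {E C : Type} [Fintype E] [DecidableEq E] [Fintype C] [DecidableEq C] {d L : ℕ}

/-- The Pauli `Y` operators of the vertices. -/
theorem commutingInvolutions_pauliY : CommutingInvolutions fun v : C =>
    Complex.I • (onDual (Pi.single v 1) (Pi.single v 1) : Op (E ⊕ C)) where
  comm v w := ((onDual_commute (by rw [single_one_dotProduct, single_one_dotProduct,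
    Pi.single_apply, Pi.single_apply]; simp only [eq_comm])).smul_left _).smul_right _
  sq v := by
    rw [Matrix.smul_mul, Matrix.mul_smul, smul_smul, onDual_mul, add_self_eq_zero_of_zmodTwo,
      onDual_zero, smul_smul]
    simp [sgn_one]
  herm v := by
    rw [Matrix.conjTranspose_smul, onDual, weyl_conjTranspose, sumElim_dotProduct_sumElim, smul_smul]
    simp [sgn_one]

/-- A chain of edges and vertices: the local model of the one-dimensional lattice. -/
structure EdgeModel (inc : C → E → ZMod 2) (cup : E → E → ZMod 2)
    (cupD : C → C → ZMod 2) (pos : E ⊕ C → Fin d → ZMod L) where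
  src : E ≃ C
  tgt : E ≃ C
  src_ne_tgt : ∀ e, src e ≠ tgt e
  inc_eq : ∀ c e, inc c e = (Pi.single (src e) 1 + Pi.single (tgt e) 1 : C → ZMod 2) c
  cup_eq : ∀ e e', cup e e' = if e = e' then 1 else 0
  cupD_eq : ∀ c c', cupD c c' = if c = c' then 1 else 0
  src_local : ∀ e a, torusNorm (pos (Sum.inr (src e)) a - pos (Sum.inl e) a) ≤ 3
  tgt_local : ∀ e a, torusNorm (pos (Sum.inr (tgt e)) a - pos (Sum.inl e) a) ≤ 3

namespace EdgeModel

variable {inc : C → E → ZMod 2} {cup : E → E → ZMod 2} {cupD : C → C → ZMod 2}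
  {pos : E ⊕ C → Fin d → ZMod L} (W : EdgeModel inc cup cupD pos)

include W

omit [Fintype C] in
theorem cupMap_eq (τ : E → ZMod 2) : cupMap cup τ = τ := by
  ext e
  simp [cupMap, W.cup_eq]

omit [Fintype E] in
theorem cupMap_dual_eq (τ : C → ZMod 2) : cupMap cupD τ = τ := by
  ext e
  simp [cupMap, W.cupD_eq]

omit [Fintype E] [Fintype C] in
theorem inc_fun_eq (e : E) : (fun c => inc c e) = Pi.single (W.src e) 1 + Pi.single (W.tgt e) 1 :=
  funext fun c => W.inc_eq c e

omit [Fintype E] in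
theorem sum_inc_mul (y : C → ZMod 2) (e : E) :
    ∑ c, inc c e * y c = y (W.src e) + y (W.tgt e) := by
  simp [W.inc_eq, add_mul, Finset.sum_add_distrib, Pi.single_apply]

/-- Each vertex is the source of exactly one edge and the target of exactly one. -/
theorem sum_inc (c : C) : ∑ e, inc c e = 0 := by
  simp_rw [W.inc_eq, Pi.add_apply, Finset.sum_add_distrib, Pi.single_apply]
  rw [Equiv.sum_comp W.src fun c' => if c = c' then (1 : ZMod 2) else 0,
    Equiv.sum_comp W.tgt fun c' => if c = c' then (1 : ZMod 2) else 0, CharTwo.add_self_eq_zero]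

/-- The eigenvalues of the `Y` operators thus determine the dual fluxes. The minus sign is the
reason for the `+ 1` in the flux `t` of the linking data. -/
theorem dualFlux_eq (e : E) : dualFlux inc cupD e =
    -((Complex.I • (onDual (Pi.single (W.src e) 1) (Pi.single (W.src e) 1) : Op (E ⊕ C))) *
      (Complex.I • onDual (Pi.single (W.tgt e) 1) (Pi.single (W.tgt e) 1))) := by
  rw [Matrix.smul_mul, Matrix.mul_smul, smul_smul, onDual_mul, Complex.I_mul_I, dualFlux,
    W.cupMap_dual_eq, W.inc_fun_eq, single_one_dotProduct, Pi.single_eq_of_ne (W.src_ne_tgt e),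
    sgn_zero, one_smul, neg_one_smul, neg_neg]

/-- Flipping `y c` changes the term of an edge at `c` by the label of its other end, which is the
flux of the edge plus `y c + 1`. The last summand occurs once for each of the two edges at `c` and
drops out. -/
theorem sum_phase (y : C → ZMod 2) (c : C) :
    ∑ e, (y + Pi.single c 1 : C → ZMod 2) (W.src e) * (y + Pi.single c 1 : C → ZMod 2) (W.tgt e) =
      ∑ e, y (W.src e) * y (W.tgt e) + ∑ e, (∑ c', inc c' e * y c' + 1) * inc c e := by
  have h : ∀ e, (∑ c', inc c' e * y c' + 1) * inc c e =
      ((y + Pi.single c 1 : C → ZMod 2) (W.src e) * (y + Pi.single c 1 : C → ZMod 2) (W.tgt e) - y (W.src e) * y (W.tgt e)) +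
        (y c + 1) * inc c e := by
    intro e
    rw [W.sum_inc_mul, W.inc_eq]
    simp only [Pi.add_apply, Pi.single_apply]
    have hne := W.src_ne_tgt e
    by_cases h1 : W.src e = c
    · have h2 : W.tgt e ≠ c := fun h => hne (h1.trans h.symm)
      simp only [h1, h2, h2.symm, if_true, if_false]
      generalize y c = a; generalize y (W.tgt e) = b; revert a b; decide
    · by_cases h2 : W.tgt e = c
      · simp only [h1, h2, Ne.symm h1, if_true, if_false]
        generalize y c = a; generalize y (W.src e) = b; revert a b; decide
      · simp only [h1, h2, Ne.symm h1, Ne.symm h2, if_false]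
        ring
  simp_rw [h]
  rw [Finset.sum_add_distrib, Finset.sum_sub_distrib, ← Finset.mul_sum, W.sum_inc]
  ring

/-- The linking data of the one-dimensional lattice. -/
noncomputable def linkingData : LinkingData inc cup cupD pos C 3 where
  inc_local c e h a := by
    rw [W.inc_eq, Pi.add_apply] at h
    by_cases h1 : c = W.src e
    · rw [h1]; exact W.src_local e a
    · by_cases h2 : c = W.tgt e
      · rw [h2]; exact W.tgt_local e a
      · simp [h1, h2] at h
  cup_local e' e h a := by
    rw [W.cup_eq] at h
    rw [show e' = e by by_contra h'; exact h (if_neg h'), sub_self, torusNorm_zero]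
    exact Nat.zero_le _
  cupD_local c' c h a := by
    rw [W.cupD_eq] at h
    rw [show c' = c by by_contra h'; exact h (if_neg h'), sub_self, torusNorm_zero]
    exact Nat.zero_le _
  lam _ := Complex.I
  hx v := Pi.single v 1
  hz v := Pi.single v 1
  inv := commutingInvolutions_pauliY
  hz_eq v c := by simp [W.cupD_eq, Pi.single_apply, eq_comm]
  t y e := ∑ c, inc c e * y c + 1
  flux y e := by
    have h : ∀ v, jointProj (fun v : C => Complex.I • (onDual (Pi.single v 1) (Pi.single v 1) :
        Op (E ⊕ C))) y * (Complex.I • onDual (Pi.single v 1) (Pi.single v 1)) =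
        sgn (y v) • jointProj (fun v : C => Complex.I • onDual (Pi.single v 1) (Pi.single v 1)) y := by
      intro v
      rw [← commutingInvolutions_pauliY.mul_jointProj_self,
        (commute_jointProj (fun j => commutingInvolutions_pauliY.comm v j) y).eq]
    rw [W.dualFlux_eq, mul_neg, ← mul_assoc, h, Matrix.smul_mul, h, smul_smul, W.sum_inc_mul,
      sgn_add, sgn_add, sgn_one, mul_neg_one, neg_smul]
  t_add y c := by
    ext e
    simp only [Pi.add_apply, mul_add, Finset.sum_add_distrib]
    rw [show ∑ c', inc c' e * (Pi.single c' 1 : C → ZMod 2) c = inc c e by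
      simp [Pi.single_apply]]
    ring
  φ e y := sgn (y (W.src e) * y (W.tgt e))
  φ_unit e y := by rw [star_sgn, sgn_mul_self]
  φ_local e c y h := by
    have h1 : W.src e ≠ c := fun h1 => h (h1 ▸ W.src_local e)
    have h2 : W.tgt e ≠ c := fun h2 => h (h2 ▸ W.tgt_local e)
    simp [Pi.single_apply, h1.symm, h2.symm]
  -- No label is excluded: the fluxes need not be coboundaries, and are not when the number of edges
  -- is odd.
  sector _ := True
  sector_add _ _ _ := trivial
  proj_eq_zero y h := absurd trivial h
  phase_add y c _ := by
    have hprod : ∀ f : E → ZMod 2, ∏ e, sgn (f e) = sgn (∑ e, f e) := by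
      intro f
      induction (Finset.univ : Finset E) using Finset.induction_on with
      | empty => simp [sgn_zero]
      | insert e S he ih => rw [Finset.prod_insert he, Finset.sum_insert he, ih, sgn_add]
    have hs : (fun j => (Pi.single j 1 : C → ZMod 2) c) = Pi.single c 1 := by
      ext j
      simp [Pi.single_apply, eq_comm]
    rw [hs, hprod, hprod, W.sum_phase, primalFlux, onPrimal_mul, W.cupMap_eq, W.cupMap_eq,
      W.cupMap_eq, smul_smul, sgn_add]
    rfl
  -- Zero flux means that the two ends of every edge carry different labels, so one of them is `0`.
  phase_zero y _ h := by
    refine Finset.prod_eq_one fun e _ => ?_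
    have h1 := congrFun h e
    rw [W.sum_inc_mul, Pi.zero_apply] at h1
    rw [show y (W.src e) * y (W.tgt e) = 0 by
      revert h1; generalize y (W.src e) = a; generalize y (W.tgt e) = b; revert a b; decide,
      sgn_zero]

end EdgeModel

end Chain

/-! ### The periodic line as a chain -/

section Line

variable {L : ℕ}

theorem directions_of_vertex (c : Cell (2 * 0 + 1) L 0) : c.2.1 = ∅ :=
  Finset.card_eq_zero.1 c.2.2

theorem directions_of_edge (e : Cell (2 * 0 + 1) L (0 + 1)) : e.2.1 = Finset.univ :=
  (Finset.card_eq_iff_eq_univ _).1 e.2.2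

theorem incidence_line (c : Cell (2 * 0 + 1) L 0) (e : Cell (2 * 0 + 1) L (0 + 1)) :
    incidence c e = (if c.1 = e.1 then 1 else 0) + if c.1 = e.1 + 1 then 1 else 0 := by
  unfold incidence
  rw [Fin.sum_univ_one, directions_of_vertex, directions_of_edge, if_pos (by decide),
    show (Pi.single 0 1 : Fin (2 * 0 + 1) → ZMod L) = 1 from by
      ext i; rw [Fin.fin_one_eq_zero i]; simp]

open Classical in
theorem cupOne_line (e e' : Cell (2 * 0 + 1) L (0 + 1)) :
    cupOne e e' = if e = e' then 1 else 0 := by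
  have h : ∀ p : Fin (2 * 0 + 1) → ZMod L, (p + fun _ => 0) = p := add_zero
  unfold cupOne
  refine if_congr ?_ rfl rfl
  rw [directions_of_edge, directions_of_edge]
  simp only [Finset.mem_univ, not_true, false_and, if_false, h]
  constructor
  · rintro ⟨m, p, -, -, h1, h2⟩
    exact Prod.ext (h1.trans h2.symm)
      (Subtype.ext ((directions_of_edge e).trans (directions_of_edge e').symm))
  · rintro rfl
    exact ⟨0, e.1, by decide, by decide, rfl, rfl⟩

/-- The edges and vertices of the periodic one-dimensional lattice. -/
def lineModel [NeZero L] (hL : L ≠ 1) :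
    EdgeModel (incidence (d := 2 * 0 + 1) (L := L) (n := 0)) cupOne
      (fun c c' => cupOne (dualCell c) (dualCell c')) Qubit.pos where
  src :=
    { toFun := fun e => (e.1, ⟨∅, rfl⟩)
      invFun := fun c => (c.1, ⟨Finset.univ, rfl⟩)
      left_inv := fun e => Prod.ext rfl (Subtype.ext (directions_of_edge e).symm)
      right_inv := fun c => Prod.ext rfl (Subtype.ext (directions_of_vertex c).symm) }
  tgt :=
    { toFun := fun e => (e.1 + 1, ⟨∅, rfl⟩)
      invFun := fun c => (c.1 - 1, ⟨Finset.univ, rfl⟩)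
      left_inv := fun e => Prod.ext (add_sub_cancel_right _ _)
        (Subtype.ext (directions_of_edge e).symm)
      right_inv := fun c => Prod.ext (sub_add_cancel _ _)
        (Subtype.ext (directions_of_vertex c).symm) }
  src_ne_tgt e h := by
    have h1 := congrFun (congrArg Prod.fst h) 0
    have h2 : (1 : ZMod L) = 0 := left_eq_add.1 h1
    exact hL (ZMod.subsingleton_iff.1 (subsingleton_of_zero_eq_one h2.symm))
  inc_eq c e := by
    have h : ∀ p, c = (p, ⟨∅, rfl⟩) ↔ c.1 = p := fun p =>
      ⟨fun h => congrArg Prod.fst h,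
        fun h => Prod.ext h (Subtype.ext (directions_of_vertex c))⟩
    rw [incidence_line, Pi.add_apply, Pi.single_apply, Pi.single_apply]
    simp only [Equiv.coe_fn_mk, h]
  cup_eq := cupOne_line
  cupD_eq c c' := by
    rw [cupOne_line]
    exact if_congr dualCellEquiv.injective.eq_iff rfl rfl
  src_local e a := by
    show torusNorm (e.1 a - e.1 a) ≤ 3
    rw [sub_self, torusNorm_zero]
    exact Nat.zero_le _
  tgt_local e a := by
    show torusNorm (e.1 a + 1 - e.1 a) ≤ 3
    rw [add_sub_cancel_left]
    exact torusNorm_one_le.trans (by norm_num)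

end Line

/-! ### From linking data to the three properties -/

section Main

variable {k L : ℕ} [NeZero L]

theorem LinkingData.implementsWalkerWangQCA {J : Type} [Fintype J] [DecidableEq J]
    (W : LinkingData (incidence (d := 2 * k + 1) (L := L) (n := k)) cupOne
      (fun c c' => cupOne (dualCell c) (dualCell c')) Qubit.pos J 3) :
    ImplementsWalkerWangQCA W.V :=
  ⟨W.V_mem_unitary, W.conj_Z_primal, W.conj_Z_dual, W.conj_X_primal, W.conj_X_dual⟩

theorem LinkingData.isLinkingPhase {J : Type} [Fintype J] [DecidableEq J]
    (W : LinkingData (incidence (d := 2 * k + 1) (L := L) (n := k)) cupOne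
      (fun c c' => cupOne (dualCell c) (dualCell c')) Qubit.pos J 3) :
    IsLinkingPhase W.V :=
  W.V_mulVec

/-- The depth of the circuit for the linking phase. -/
def linkingDepth (k : ℕ) : ℕ :=
  -- The modulus is `13 = 2 * (2 * 3) + 1` for locality `3`. The direction set separates cells with
  -- a common base, and the two summands belong to the `X` and `Z` parts.
  Fintype.card ((Fin (2 * k + 1) → Fin 13 × Bool) ×
    {I : Finset (Fin (2 * k + 1)) // I.card = k + 1}) +
  Fintype.card ((Fin (2 * k + 1) → Fin 13 × Bool) ×
    {I : Finset (Fin (2 * k + 1)) // I.card = k + 1})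

theorem LinkingData.isCircuit_linkingDepth {J : Type} [Fintype J] [DecidableEq J]
    (W : LinkingData (incidence (d := 2 * k + 1) (L := L) (n := k)) cupOne
      (fun c c' => cupOne (dualCell c) (dualCell c')) Qubit.pos J 3) :
    IsCircuit Qubit.pos 12 (linkingDepth k) W.V :=
  W.isCircuit_V (fun e => e.2) fun _ _ h1 h2 => Prod.ext h1 h2

end Main

/-! ### The case `k = 0`, `L = 1` -/

section Point

/-- The only edge is a loop, whose two ends cancel mod `2`. All fluxes are therefore trivial and the
identity serves as `V`. -/
theorem incidence_point (c : Cell (2 * 0 + 1) 1 0) (e : Cell (2 * 0 + 1) 1 (0 + 1)) :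
    incidence c e = 0 := by
  rw [incidence_line, if_pos (Subsingleton.elim _ _), if_pos (Subsingleton.elim _ _)]
  rfl

theorem fluxG_point (c : Cell (2 * 0 + 1) 1 0) : fluxG c = 1 := by
  have h : primalFlux (incidence (d := 2 * 0 + 1) (L := 1) (n := 0)) cupOne c = 1 := by
    rw [primalFlux, show incidence c = 0 from funext (incidence_point c), cupMap_zero,
      onPrimal_zero]
  exact h

theorem fluxGDual_point (e : Cell (2 * 0 + 1) 1 (0 + 1)) : fluxGDual e = 1 := by
  have h : dualFlux (incidence (d := 2 * 0 + 1) (L := 1) (n := 0))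
      (fun c c' => cupOne (dualCell c) (dualCell c')) e = 1 := by
    rw [dualFlux, show (fun c => incidence c e) = 0 from funext fun c => incidence_point c e,
      cupMap_zero, onDual_zero]
  exact h

theorem list_prod_opPow_one {Q ι : Type} [Fintype Q] [DecidableEq Q] {G : ι → Op Q}
    (hG : ∀ i, G i = 1) (f : ι → ZMod 2) (l : List ι) :
    (l.map fun i => opPow (G i) (f i)).prod = 1 := by
  refine List.prod_eq_one fun A hA => ?_
  obtain ⟨i, -, rfl⟩ := List.mem_map.1 hA
  rw [hG, opPow, ite_self]

theorem implementsWalkerWangQCA_point : ImplementsWalkerWangQCA (1 : Op (Qubit 0 1)) := by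
  refine ⟨pauliX_zero (Q := Qubit 0 1) ▸ pauliX_mem_unitary 0, fun e => ?_, fun c => ?_, fun e => ?_, fun c => ?_⟩
  · rw [fluxGDual_point, Matrix.conjTranspose_one, Matrix.one_mul]
  · rw [fluxG_point, Matrix.conjTranspose_one, Matrix.one_mul]
  · rw [list_prod_opPow_one fluxGDual_point, Matrix.conjTranspose_one, Matrix.one_mul]
  · rw [list_prod_opPow_one fluxG_point, Matrix.conjTranspose_one, Matrix.one_mul]

theorem isLinkingPhase_point : IsLinkingPhase (1 : Op (Qubit 0 1)) := by
  intro a b ψ _ _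
  have h : ∀ e, coboundary b e = 0 := fun e =>
    Finset.sum_eq_zero fun c _ => by rw [incidence_point, zero_mul]
  rw [Finset.sum_eq_zero fun e _ => by rw [h, mul_zero], sgn_zero, one_smul, Matrix.one_mulVec]

end Point

/-! ### The main theorem -/

theorem mainTheorem1 (k : ℕ) (hk : Even k) :
    ∃ r D : ℕ, ∀ (L : ℕ) [NeZero L], ∃ V : Op (Qubit k L),
      ImplementsWalkerWangQCA V ∧ IsLinkingPhase V ∧ IsCircuit Qubit.pos r D V := by
  refine ⟨12, linkingDepth k, fun L _ => ?_⟩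
  rcases Nat.eq_zero_or_pos k with rfl | hpos
  · by_cases hL : L = 1
    · subst hL
      refine ⟨1, ?_, ?_, isCircuit_one _ _⟩
      -- The `NeZero 1` instance is a variable here; `convert` identifies it with the canonical one.
      · convert implementsWalkerWangQCA_point
      · convert isLinkingPhase_point
    · let W := (lineModel hL).linkingData
      exact ⟨W.V, W.implementsWalkerWangQCA, W.isLinkingPhase, W.isCircuit_linkingDepth⟩
  · have h2 : 2 ≤ k := by
      obtain ⟨m, rfl⟩ := hk
      omega
    let W := (walkerWangLift (L := L) hk h2).linkingData
    exact ⟨W.V, W.implementsWalkerWangQCA, W.isLinkingPhase, W.isCircuit_linkingDepth⟩
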